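/- **Setting.** Let $T$ be a finite tree with node set $V$, and let $\mathcal X\subseteq V$ be the set of observed nodes. Assume that $T$ is minimal, i.e. every hidden node (node of $V\setminus\mathcal X$) has at least 3 neighbors. Let $\mathrm{dist}$ be exact distances between distinct nodes of $T$, of one of the following two kinds. 1. $\mathrm{dist}$ is any symmetric distance that is positive on the edges of $T$ and additive, i.e. $\mathrm{dist}(a,c)=\mathrm{dist}(a,b)+\mathrm{dist}(b,c)$ whenever $b$ lies strictly between $a$ and $c$ on $T$. 2. $\mathrm{dist}$ is the multivariate information distance $$\mathrm{dist}(a,b)=-\log\frac{\prod_{i=1}^k\sigma_i(\mathbb E[y_ay_b^\top])}{\sqrt{\det\mathbb E[y_ay_a^\top]\,\det\mathbb E[y_by_b^\top]}}$$ ($\sigma_1\ge\dots\ge\sigma_k$ the $k$ largest singular values) of a linear latent tree model $(y_v)_{v\in V}$ on $T$, and it is positive on the edges of $T$. Here the $y_v$ are square-integrable random vectors on a standard Borel probability space, of dimensions at least $k$ and with nonsingular $\mathbb E[y_vy_v^\top]$. They are globally Markov with respect to $T$, and hidden variables take values in $\{e_1,\dots,e_k\}$. Every node that is not a leaf has dimension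 $k$. For every edge $\{a,b\}$ with $b$ hidden or not a leaf, $\mathbb E[y_a\mid y_b]=A_{a|b}\,y_b$ with $A_{a|b}$ of full column rank $k$. Assume that for every hidden node $h$ the surrogate node $\mathrm{Sg}(h)=\arg\min_{x\in\mathcal X}\mathrm{dist}(h,x)$ is well defined, i.e. the minimizer is unique. Let $\mathrm{MST}$ be a minimum spanning tree of $\mathcal X$ with respect to $\mathrm{dist}$. A node of $\mathrm{MST}$ is internal if it has at least two neighbors there. $\mathrm{nbd}[v;G]$ denotes the closed neighborhood of $v$ in $G$, and $\mathrm{path}(u,v;G)$ the path from $u$ to $v$ in $G$. **Recursive grouping** $\mathrm{RG}(\Omega)$ on a set $\Omega$ of nodes with given distances. Write $\Phi(a,b;c)=\mathrm{dist}(a,c)-\mathrm{dist}(b,c)$. While $|\Omega|>2$: call $a$ a child of $b$ if $\Phi(a,b;c)=\mathrm{dist}(a,b)$ for all $c\in\Omega\setminus\{a,b\}$. Call $a,b$ siblings if $-\mathrm{dist}(a,b)<\Phi(a,b;c)=\Phi(a,b;c')<\mathrm{dist}(a,b)$ for all $c,c'\in\Omega\setminus\{a,b\}$. Group $\Omega$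 into the families given by these two relations. In every family with at least two members, join all members to the member that is the parent of another one, or, if there is none, to a new hidden node $h$. The distances of $h$ are computed from $\mathrm{dist}(a,h)=\tfrac12(\mathrm{dist}(a,j)+\Phi(a,j;k))$ (with $a,j$ in the family and $k$ another active node) and additivity. The parents and the singletons form the new $\Omega$. When two nodes remain, join them by an edge. **Serial algorithm (CLRG).** Start with $T_{\rm CLRG}(\emptyset)=\mathrm{MST}$ and visit internal nodes of $\mathrm{MST}$ one after another. When $v_i$ is visited, replace the subtree of the current tree over $\mathrm{nbd}[v_i;T_{\rm CLRG}]$ by the output of $\mathrm{RG}$ on this set. The required distances of hidden nodes found earlier are computed from the distances to their group leaders. **Parallel algorithm (LRG).** For every internal $v_i$, independently, let $\mathrm{Adj}_i$ be the output of $\mathrm{RG}(\mathrm{nbd}[v_i;\mathrm{MST}])$. Start with $T_{\rm LRG}(\emptyset)=\mathrm{MST}$ and merge the $\mathrm{Adj}_i$ one after another. Merging $\mathrm{Adj}_i$ into the current tree means that for every neighbor $v_j$ of $v_i$ in $\mathrm{MST}$, the paths $[v_i-h_1-\dots-h_2-v_j]$ in $\mathrm{Adj}_i$ and $[v_i-h'_1-\dots-h'_2-v_j]$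 in the current tree are replaced by the union path $[v_i-h_1-\dots-h_2-h'_1-\dots-h'_2-v_j]$, and everything else in both is kept. **Claim.** (a) For every set $S$ of internal nodes of $\mathrm{MST}$, and for all orders in which CLRG visits the nodes of $S$ and in which the subtrees $\mathrm{Adj}_i$, $v_i\in S$, are merged, $T_{\rm LRG}(S)$ and $T_{\rm CLRG}(S)$ are the same latent tree, i.e. they are isomorphic by an isomorphism that fixes the observed nodes. In particular the two algorithms agree after each iteration. (b) If $S$ is the set of all internal nodes, this tree is $T$, again up to an isomorphism fixing the observed nodes. (c) The nodes of each $\mathrm{Adj}_i$ can be identified injectively with nodes of $T$, observed nodes with themselves and hidden nodes with hidden nodes, such that betweenness in $\mathrm{Adj}_i$ is betweenness in $T$. With these identifications, for any two different internal $v_i,v_j$: - if two nodes $u,w$ belong to both $\mathrm{Adj}_i$ and $\mathrm{Adj}_j$ and $\mathrm{path}(u,w;\mathrm{Adj}_i)\ne\mathrm{path}(u,w;\mathrm{Adj}_j)$, then $v_i$ and $v_j$ are neighbors in $\mathrm{MST}$ and $\{u,w\}=\{v_i,v_j\}$; - if $\mathrm{Adj}_i$ has an edge $\{a,b\}$ while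 $\mathrm{Adj}_j$ has a node $c$ that lies strictly between $a$ and $b$ on $T$, then $v_i$ and $v_j$ are neighbors in $\mathrm{MST}$, the edge $\{a,b\}$ lies on $\mathrm{path}(v_i,v_j;\mathrm{Adj}_i)$, and $c$ lies on $\mathrm{path}(v_i,v_j;\mathrm{Adj}_j)$. -/

import Mathlib

open scoped Classical

/-! ### Paths, finite graphs, latent trees -/

/-- The vertices, in order, of a path from `u` to `v` (the path, if the component is a tree);
empty if there is none. -/
noncomputable def pathList {N : Type*} (G : SimpleGraph N) (u v : N) : List N :=
  if h : G.Reachable u v then h.exists_isPath.choose.support else []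

/-- `a` and `b` are consecutive, in one order or the other, in the list `p`. -/
def Consecutive {N : Type*} (p : List N) (a b : N) : Prop :=
  (a, b) ∈ p.zip p.tail ∨ (b, a) ∈ p.zip p.tail

/-- The sum of the edge lengths `len` along the path from `u` to `v`. -/
noncomputable def pathLength {N : Type*} (G : SimpleGraph N) (len : N → N → ℝ) (u v : N) : ℝ :=
  (List.zipWith len (pathList G u v) (pathList G u v).tail).sum

/-- A finite graph whose vertices are taken from a fixed supply `N` of names. -/
structure NamedGraph (N : Type*) where
  verts : Finset N
  graph : SimpleGraph N

/-- The closed neighborhood `nbd[p; G]`. -/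
noncomputable def NamedGraph.closedNbd {N : Type*} (G : NamedGraph N) (p : N) : Finset N :=
  G.verts.filter fun q => q = p ∨ G.graph.Adj p q

/-- Renaming of the nodes. -/
noncomputable def NamedGraph.map {N W : Type*} (f : N → W) (G : NamedGraph N) : NamedGraph W where
  verts := G.verts.image f
  graph := G.graph.map f

/-- Every hidden node has at least three neighbors. -/
def IsMinimalLatentTree {V : Type*} (T : SimpleGraph V) (obs : Finset V) : Prop :=
  T.IsTree ∧ ∀ v, v ∉ obs → 3 ≤ (T.neighborSet v).ncard

/-- `dist` is an additive distance on the tree `T`, with positive lengths of the edges.  Only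
distances between distinct nodes matter. -/
structure IsAdditiveDistance {V : Type*} (T : SimpleGraph V) (dist : V → V → ℝ) : Prop where
  symm : ∀ a b, dist a b = dist b a
  pos : ∀ a b, T.Adj a b → 0 < dist a b
  add : ∀ a b c, b ∈ pathList T a c → b ≠ a → b ≠ c → dist a c = dist a b + dist b c

/-- `x` is the surrogate node of `v`: the strict minimizer over the observed nodes of the
distance to `v`. -/
def IsSurrogate {V : Type*} (obs : Finset V) (dist : V → V → ℝ) (v x : V) : Prop :=
  x ∈ obs ∧ ∀ x' ∈ obs, x' ≠ x → dist v x < dist v x'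

/-- The surrogate node of every hidden node is well defined. -/
def SurrogatesDefined {V : Type*} (obs : Finset V) (dist : V → V → ℝ) : Prop :=
  ∀ h, h ∉ obs → ∃ x, IsSurrogate obs dist h x

/-- Twice the total length of a graph on a finite set. -/
noncomputable def totalLength {X : Type*} [Fintype X] (dist : X → X → ℝ) (M : SimpleGraph X) : ℝ :=
  ∑ x, ∑ y, if M.Adj x y then dist x y else 0

/-- `M` is a minimum spanning tree of the complete graph on `X`. -/
def IsMST {X : Type*} [Fintype X] (dist : X → X → ℝ) (M : SimpleGraph X) : Prop :=
  M.IsTree ∧ ∀ M' : SimpleGraph X, M'.IsTree → totalLength dist M ≤ totalLength dist M'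

/-- The internal nodes of a tree. -/
def IsInternal {X : Type*} (M : SimpleGraph X) (i : X) : Prop :=
  2 ≤ (M.neighborSet i).ncard

/-! ### Recursive grouping

`N` is the supply of node names, `Ω` the active set, `d` the distances between active nodes.
When the members of a family get a new hidden parent, it receives the name `fresh r`, where `r` is
a chosen member of the family. -/

section RecursiveGrouping

variable {N : Type*} [Nonempty N]

/-- An arbitrary element of a nonempty finite set. -/
noncomputable def pick (s : Finset N) : N := Classical.epsilon fun a => a ∈ s

/-- `Φ(a, b; c) = dist(a, c) - dist(b, c)`. -/
def Phi (d : N → N → ℝ) (a b c : N) : ℝ := d a c - d b c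

/-- The test for "`a` is a leaf and `b` is its parent". -/
def IsChildOf (Ω : Finset N) (d : N → N → ℝ) (a b : N) : Prop :=
  a ∈ Ω ∧ b ∈ Ω ∧ a ≠ b ∧ ∀ c ∈ Ω, c ≠ a → c ≠ b → Phi d a b c = d a b

/-- The test for "`a` and `b` are siblings". -/
def AreSiblings (Ω : Finset N) (d : N → N → ℝ) (a b : N) : Prop :=
  a ∈ Ω ∧ b ∈ Ω ∧ a ≠ b ∧ ∀ c ∈ Ω, c ≠ a → c ≠ b → ∀ c' ∈ Ω, c' ≠ a → c' ≠ b →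
    -d a b < Phi d a b c ∧ Phi d a b c = Phi d a b c' ∧ Phi d a b c' < d a b

/-- The family of `a`: the node itself and all active nodes that are in a parent-child or in a
sibling relation with it. -/
noncomputable def family (Ω : Finset N) (d : N → N → ℝ) (a : N) : Finset N :=
  Ω.filter fun b => b = a ∨ IsChildOf Ω d a b ∨ IsChildOf Ω d b a ∨ AreSiblings Ω d a b

/-- `u` is the parent in the family `P`. -/
def IsParentIn (Ω : Finset N) (d : N → N → ℝ) (P : Finset N) (u : N) : Prop :=
  u ∈ P ∧ ∃ b ∈ P, IsChildOf Ω d b u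

/-- A family with several members, none of which is the parent, needs a hidden parent. -/
def NeedsHidden (Ω : Finset N) (d : N → N → ℝ) (P : Finset N) : Prop :=
  2 ≤ P.card ∧ ¬ ∃ u, IsParentIn Ω d P u

/-- The parent in the family, if there is one, else a chosen member. -/
noncomputable def rep (Ω : Finset N) (d : N → N → ℝ) (P : Finset N) : N :=
  if ∃ u, IsParentIn Ω d P u then Classical.epsilon fun u => IsParentIn Ω d P u else pick P

/-- The node that stands for the family in the next round: a new hidden parent if one is needed,
else the parent in the family, or its only member. -/
noncomputable def head (fresh : N → N) (Ω : Finset N) (d : N → N → ℝ) (P : Finset N) : N :=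
  if NeedsHidden Ω d P then fresh (rep Ω d P) else rep Ω d P

/-- The distance from the member `a` of the family `P` to the head of `P`.  For a new hidden head
it is `(dist(a, j) + Φ(a, j; k)) / 2`, with a sibling `j` and a third active node `k`. -/
noncomputable def distToHead (Ω : Finset N) (d : N → N → ℝ) (P : Finset N) (a : N) : ℝ :=
  if NeedsHidden Ω d P then
    (d a (pick (P.erase a)) +
      Phi d a (pick (P.erase a)) (pick ((Ω.erase a).erase (pick (P.erase a))))) / 2
  else if a = rep Ω d P then 0 else d a (rep Ω d P)

/-- The family whose head is `q`. -/
noncomputable def familyOfHead (fresh : N → N) (Ω : Finset N) (d : N → N → ℝ) (q : N) : Finset N :=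
  family Ω d (pick (Ω.filter fun a => head fresh Ω d (family Ω d a) = q))

/-- The state of recursive grouping: the active set, the distances between its members, the graph
built so far with the lengths of its edges. -/
structure RGState (N : Type*) where
  active : Finset N
  dist : N → N → ℝ
  tree : NamedGraph N
  len : N → N → ℝ

/-- One round: every member of a family is joined to the head of the family, and the heads form
the next active set. -/
noncomputable def rgRound (fresh : N → N) (s : RGState N) : RGState N :=
  if s.active.card ≤ 2 then s else
  { active := s.active.image fun a => head fresh s.active s.dist (family s.active s.dist a)
    dist := fun q q' =>
      s.dist (rep s.active s.dist (familyOfHead fresh s.active s.dist q))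
          (rep s.active s.dist (familyOfHead fresh s.active s.dist q'))
        - distToHead s.active s.dist (familyOfHead fresh s.active s.dist q)
            (rep s.active s.dist (familyOfHead fresh s.active s.dist q))
        - distToHead s.active s.dist (familyOfHead fresh s.active s.dist q')
            (rep s.active s.dist (familyOfHead fresh s.active s.dist q'))
    tree :=
      { verts := s.tree.verts ∪
          s.active.image fun a => head fresh s.active s.dist (family s.active s.dist a)
        graph := s.tree.graph ⊔ SimpleGraph.fromRel fun a q =>
          a ∈ s.active ∧ q = head fresh s.active s.dist (family s.active s.dist a) }
    len := fun a b =>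
      if a ∈ s.active ∧ b = head fresh s.active s.dist (family s.active s.dist a) then
        distToHead s.active s.dist (family s.active s.dist a) a
      else if b ∈ s.active ∧ a = head fresh s.active s.dist (family s.active s.dist b) then
        distToHead s.active s.dist (family s.active s.dist b) b
      else s.len a b }

/-- The last step: if two active nodes remain, they are joined by an edge. -/
noncomputable def rgFinish (s : RGState N) : RGState N :=
  if s.active.card ≤ 2 then
    { s with
      tree :=
        { verts := s.tree.verts
          graph := s.tree.graph ⊔ SimpleGraph.fromRel fun a b => a ∈ s.active ∧ b ∈ s.active }
      len := fun a b => if a ∈ s.active ∧ b ∈ s.active then s.dist a b else s.len a b }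
  else s

/-- Recursive grouping on the set `Ω` of input nodes with distances `d`.  A round that changes
anything shrinks the active set, so that `Ω.card` rounds are enough. -/
noncomputable def recursiveGrouping (fresh : N → N) (Ω : Finset N) (d : N → N → ℝ) : RGState N :=
  rgFinish ((rgRound fresh)^[Ω.card]
    { active := Ω, dist := d, tree := { verts := Ω, graph := ⊥ }, len := fun _ _ => 0 })

end RecursiveGrouping

/-! ### The serial algorithm (CLRG) and the parallel one (LRG) -/

/-- Names of nodes: the observed nodes, and `hid i r` for the hidden parent that recursive
grouping in the group of the leader `i` introduces above the family represented by `r`. -/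
inductive Node (X : Type*)
  | obs (x : X) : Node X
  | hid (leader : X) (child : Node X) : Node X

/-- The group leader in whose group a node was introduced; an observed node is its own. -/
def Node.leader {X : Type*} : Node X → X
  | Node.obs x => x
  | Node.hid i _ => i

section Algorithms

variable {X : Type*} [Fintype X]

/-- A spanning tree of the observed nodes, with its vertices renamed. -/
noncomputable def observedTree (M : SimpleGraph X) : NamedGraph (Node X) where
  verts := Finset.univ.image Node.obs
  graph := M.map Node.obs

/-- Distances between nodes of different leaders, from the distances of observed nodes and the
distance `off p` from each node `p` to its leader. -/
def nodeDist (dist : X → X → ℝ) (off : Node X → ℝ) (p q : Node X) : ℝ :=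
  dist p.leader q.leader - off p - off q

/-- Recursive grouping on the closed neighborhood of the leader `i` in `G`. -/
noncomputable def groupAt (dist : X → X → ℝ) (off : Node X → ℝ) (G : NamedGraph (Node X)) (i : X) :
    RGState (Node X) :=
  haveI : Nonempty (Node X) := ⟨Node.obs i⟩
  recursiveGrouping (Node.hid i) (G.closedNbd (Node.obs i)) (nodeDist dist off)

/-- The current tree of the serial algorithm, and the distance from each node to its leader. -/
structure CLRGState (X : Type*) where
  tree : NamedGraph (Node X)
  off : Node X → ℝ

/-- One iteration of the serial algorithm: recursive grouping is run on the closed neighborhood of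
`i` in the current tree, and the subtree over this neighborhood is replaced by the output. -/
noncomputable def clrgStep (dist : X → X → ℝ) (s : CLRGState X) (i : X) : CLRGState X where
  tree :=
    { verts := s.tree.verts ∪ (groupAt dist s.off s.tree i).tree.verts
      graph := SimpleGraph.fromRel fun a b =>
        (s.tree.graph.Adj a b ∧
          ¬ (a ∈ s.tree.closedNbd (Node.obs i) ∧ b ∈ s.tree.closedNbd (Node.obs i))) ∨
        (groupAt dist s.off s.tree i).tree.graph.Adj a b }
  off := fun p =>
    if p ∈ (groupAt dist s.off s.tree i).tree.verts ∧ p ∉ s.tree.verts then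
      pathLength (groupAt dist s.off s.tree i).tree.graph (groupAt dist s.off s.tree i).len
        (Node.obs i) p
    else s.off p

/-- The tree of the serial algorithm, started from the spanning tree `M`, after the nodes of `l`
have been visited in this order. -/
noncomputable def treeCLRG (dist : X → X → ℝ) (M : SimpleGraph X) (l : List X) :
    NamedGraph (Node X) :=
  (l.foldl (clrgStep dist) { tree := observedTree M, off := fun _ => 0 }).tree

/-- The local subtree `Adj_i`: recursive grouping on the closed neighborhood of `i` in the
spanning tree `M`, independently of all other groups. -/
noncomputable def localTree (dist : X → X → ℝ) (M : SimpleGraph X) (i : X) : NamedGraph (Node X) :=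
  (groupAt dist (fun _ => 0) (observedTree M) i).tree

/-- The union of `[v_i, h_1, …, h_2, v_j]` and `[v_i, h_1', …, h_2', v_j]` is
`[v_i, h_1, …, h_2, h_1', …, h_2', v_j]`. -/
def unionPath {N : Type*} (p q : List N) : List N := p.dropLast ++ q.tail

/-- The local subtree `A` of the leader `i` is merged into the tree `T`: for every neighbor `j` of
`i` in the spanning tree `M`, the paths between `i` and `j` in `A` and in `T` are replaced by their
union; everything else in `A` and in `T` is kept. -/
noncomputable def mergeAt (M : SimpleGraph X) (i : X) (T A : NamedGraph (Node X)) :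
    NamedGraph (Node X) where
  verts := T.verts ∪ A.verts
  graph := SimpleGraph.fromRel fun a b =>
    (T.graph.Adj a b ∧ ¬ ∃ j, M.Adj i j ∧
      Consecutive (pathList T.graph (Node.obs i) (Node.obs j)) a b) ∨
    (A.graph.Adj a b ∧ ¬ ∃ j, M.Adj i j ∧
      Consecutive (pathList A.graph (Node.obs i) (Node.obs j)) a b) ∨
    ∃ j, M.Adj i j ∧ Consecutive
      (unionPath (pathList A.graph (Node.obs i) (Node.obs j))
        (pathList T.graph (Node.obs i) (Node.obs j))) a b

/-- The tree of the parallel algorithm after the local subtrees of the leaders in `l` have been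
merged in this order, starting from the spanning tree `M`. -/
noncomputable def treeLRG (dist : X → X → ℝ) (M : SimpleGraph X) (l : List X) :
    NamedGraph (Node X) :=
  l.foldl (fun T i => mergeAt M i T (localTree dist M i)) (observedTree M)

end Algorithms

/-! ### The assertions -/

/-- The two graphs are the same latent tree: they are isomorphic over the observed nodes. -/
def SameLatentTree {X : Type*} (A B : NamedGraph (Node X)) : Prop :=
  ∃ f : Node X → Node X, Set.BijOn f A.verts B.verts ∧
    (∀ x, Node.obs x ∈ A.verts ↔ Node.obs x ∈ B.verts) ∧
    (∀ x, Node.obs x ∈ A.verts → f (Node.obs x) = Node.obs x) ∧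
    ∀ a ∈ A.verts, ∀ b ∈ A.verts, A.graph.Adj a b ↔ B.graph.Adj (f a) (f b)

/-- The graph `A` is the tree `T` up to the names of the hidden nodes. -/
def IsCopyOf {V : Type*} (T : SimpleGraph V) (obs : Finset V) (A : NamedGraph (Node obs)) : Prop :=
  ∃ f : Node obs → V, Set.BijOn f A.verts Set.univ ∧
    (∀ x, Node.obs x ∈ A.verts ∧ f (Node.obs x) = x) ∧
    ∀ a ∈ A.verts, ∀ b ∈ A.verts, A.graph.Adj a b ↔ T.Adj (f a) (f b)

/-- `φ` identifies the nodes of the local subtree `A` with nodes of `T`: observed nodes with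
themselves, hidden ones with hidden ones, and betweenness in `A` is betweenness in `T`. -/
structure IsIdentification {V : Type*} (T : SimpleGraph V) (obs : Finset V)
    (A : NamedGraph (Node obs)) (φ : Node obs → V) : Prop where
  inj : Set.InjOn φ A.verts
  observed : ∀ x, Node.obs x ∈ A.verts → φ (Node.obs x) = x
  hidden : ∀ i r, Node.hid i r ∈ A.verts → φ (Node.hid i r) ∉ obs
  between : ∀ a ∈ A.verts, ∀ b ∈ A.verts, ∀ c ∈ A.verts,
    b ∈ pathList A.graph a c ↔ φ b ∈ pathList T (φ a) (φ c)

/-- The subtrees `A` of `i` and `B` of `j`, with their nodes identified with nodes of `T`, are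
inconsistent only on the paths between `i` and `j`, and only if these are neighbors in the spanning
tree.  `shared`: the only pair of nodes shared by `A` and `B` with different connecting paths is
`{i, j}`.  `skipped`: if `A` has an edge that skips a node `c` of `B`, then the edge and `c` lie on
the paths between `i` and `j` in `A` and in `B`. -/
structure InconsistentOnlyOnPath {V : Type*} (T : SimpleGraph V) (obs : Finset V)
    (M : SimpleGraph obs) (i j : obs) (A B : NamedGraph V) : Prop where
  shared : ∀ u ∈ A.verts ∩ B.verts, ∀ w ∈ A.verts ∩ B.verts,
    pathList A.graph u w ≠ pathList B.graph u w → M.Adj i j ∧ s(u, w) = s(i.1, j.1)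
  skipped : ∀ a b, A.graph.Adj a b → ∀ c ∈ B.verts, c ∈ pathList T a b → c ≠ a → c ≠ b →
    M.Adj i j ∧ Consecutive (pathList A.graph i j) a b ∧ c ∈ pathList B.graph i j

/-- Correctness of the parallel algorithm for the latent tree `T` with observed nodes `obs`, with
exact distances `dist` and the minimum spanning tree `M`. -/
structure LRGCorrect {V : Type*} (T : SimpleGraph V) (obs : Finset V) (dist : V → V → ℝ)
    (M : SimpleGraph obs) : Prop where
  /-- After each iteration the serial and the parallel trees agree, whatever the order in which
  the internal nodes are visited by the one and the local subtrees are merged by the other. -/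
  agree : ∀ l l' : List obs, l.Nodup → (∀ i ∈ l, IsInternal M i) → l'.Perm l →
    SameLatentTree (treeLRG (fun x y : obs => dist x y) M l')
      (treeCLRG (fun x y : obs => dist x y) M l)
  /-- In the end the parallel algorithm returns the latent tree. -/
  recovers : ∀ l : List obs, l.Nodup → (∀ i, i ∈ l ↔ IsInternal M i) →
    IsCopyOf T obs (treeLRG (fun x y : obs => dist x y) M l)
  /-- Local subtrees are inconsistent only on the path between neighboring group leaders. -/
  inconsistency : ∃ φ : obs → Node obs → V,
    (∀ i, IsInternal M i →
      IsIdentification T obs (localTree (fun x y : obs => dist x y) M i) (φ i)) ∧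
    ∀ i j, IsInternal M i → IsInternal M j → i ≠ j →
      InconsistentOnlyOnPath T obs M i j
        ((localTree (fun x y : obs => dist x y) M i).map (φ i))
        ((localTree (fun x y : obs => dist x y) M j).map (φ j))

/-! ### Linear latent tree models and the multivariate information distance -/

section Model

open MeasureTheory ProbabilityTheory

variable {V Ω : Type*} [MeasurableSpace Ω] {dim : V → ℕ}

/-- `𝔼[y_a y_bᵀ]`. -/
noncomputable def corrMatrix (μ : Measure Ω) (y : ∀ v, Ω → EuclideanSpace ℝ (Fin (dim v)))
    (a b : V) : Matrix (Fin (dim a)) (Fin (dim b)) ℝ :=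
  Matrix.of fun i j => ∫ ω, y a ω i * y b ω j ∂μ

/-- The multivariate information distance, with the `k` largest singular values. -/
noncomputable def infoDist (k : ℕ) (μ : Measure Ω) (y : ∀ v, Ω → EuclideanSpace ℝ (Fin (dim v)))
    (a b : V) : ℝ :=
  -Real.log ((∏ i ∈ Finset.range k,
      (Matrix.toEuclideanLin (corrMatrix μ y a b)).singularValues i) /
    √((corrMatrix μ y a a).det * (corrMatrix μ y b b).det))

/-- The σ-algebra generated by the variables in `A`. -/
abbrev sigmaOf (y : ∀ v, Ω → EuclideanSpace ℝ (Fin (dim v))) (A : Set V) : MeasurableSpace Ω :=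
  ⨆ v ∈ A, MeasurableSpace.comap (y v) inferInstance

theorem sigmaOf_le {y : ∀ v, Ω → EuclideanSpace ℝ (Fin (dim v))} (hy : ∀ v, Measurable (y v))
    (A : Set V) : sigmaOf y A ≤ (inferInstance : MeasurableSpace Ω) :=
  iSup₂_le fun v _ => (hy v).comap_le

/-- A linear latent tree model on the tree `T` with observed nodes `obs`: the hidden variables are
`k`-state, encoded by the standard basis vectors; the family is Markov with respect to `T`; given a
neighboring node that is hidden, or observed but not a leaf, every variable has a conditional mean
that is linear of full column rank `k`; and the second moments are nonsingular. -/
structure IsLinearLatentTreeModel [StandardBorelSpace Ω] (T : SimpleGraph V) (obs : Finset V)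
    (k : ℕ) (μ : Measure Ω) [IsFiniteMeasure μ]
    (y : ∀ v, Ω → EuclideanSpace ℝ (Fin (dim v))) : Prop where
  measurable : ∀ v, Measurable (y v)
  memLp : ∀ v, MemLp (y v) 2 μ
  le_dim : ∀ v, k ≤ dim v
  dim_eq : ∀ v, v ∉ obs ∨ IsInternal T v → dim v = k
  hidden : ∀ v, v ∉ obs → ∀ ω, ∃ r, y v ω = EuclideanSpace.single r 1
  markov : ∀ A B C : Set V, Disjoint A B → Disjoint A C → Disjoint B C →
    (∀ a ∈ A, ∀ b ∈ B, ∀ p : T.Walk a b, ∃ c ∈ C, c ∈ p.support) →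
    CondIndep (sigmaOf y C) (sigmaOf y A) (sigmaOf y B) (sigmaOf_le measurable C) μ
  linear : ∀ a b, T.Adj a b → b ∉ obs ∨ IsInternal T b →
    ∃ L : Matrix (Fin (dim a)) (Fin (dim b)) ℝ, L.rank = k ∧
      μ[y a | sigmaOf y {b}] =ᵐ[μ] fun ω => Matrix.toEuclideanLin L (y b ω)
  det_ne_zero : ∀ v, (corrMatrix μ y v v).det ≠ 0

end Model

/-! Positivity and additivity make the distance, set to zero on the diagonal, a tree metric `D`, and
lying on a path of `T` becomes metric betweenness (`mem_pathList_iff`). All trees of the argument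
are then graphs `skel D S` or contractions of `T`, and their paths can be read off from `D`.

Recursive grouping. A family consists of the active nodes that hang on all others at the same point,
their `stem`. Passing from an active set `Q` to its stems takes away from the set of medians of `Q`
only points of `Q` that are leaves attached to their stems (`medClosure_stem`, `skel_stem`), and
some two stems always coincide (`exists_stem_eq`). Hence recursive grouping on `Q` returns the tree
over all medians of `Q` (`recursiveGrouping_spec`).

Surrogates. The nodes with the same surrogate form a connected group. By an exchange argument the
minimum spanning tree is `T` with every group contracted to its observed node (`mst_eq`). Let `contr
D sg S` be `T` with only the groups outside `S` contracted. If `i ∉ S`, the medians of the closed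
neighborhood of `i` in it are exactly the group of `i` and this neighborhood (`medClosure_nbd`),
because a hidden node has three branches and each of them contains a node of the neighborhood.
Recursive grouping at `i` therefore expands the group of `i`, and a serial step leads from `contr D
sg S` to `contr D sg (insert i S)`. A local tree is the same expansion carried out for `S = ∅`. It
differs from the tree over the region for `S` only in shortcuts to the neighboring leaders, and the
union paths repair these (`contr_insert_adj_iff_merge`). So both algorithms produce a copy of `contr
D sg S`, whatever the order, and this is `T` once all internal nodes are in `S`.

Inconsistency. Two local trees have only observed nodes in common, and as the spanning tree has no
cycle, two different common nodes can only be the two leaders. An edge of a local tree skips nodes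
of `T` only inside the group of the neighboring leader at its end.

Information distance. It is an additive distance: across an inner node `b` the correlation matrices
factor through `b`, and products of the `k` largest singular values multiply along such
factorizations (`topProd_mul_topProd`). -/

/-! ### Tree metrics -/

section TreeMetric

variable {V : Type*}

/-- `b` lies between `a` and `c`. -/
def MBtw (D : V → V → ℝ) (a b c : V) : Prop := D a c = D a b + D b c

/-- `m` is a median of `a`, `b`, `c`. -/
def IsMed (D : V → V → ℝ) (m a b c : V) : Prop := MBtw D a m b ∧ MBtw D a m c ∧ MBtw D b m c

/-- A metric with medians such that a point between `a` and `c` separates them. -/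
structure IsTreeMetric (D : V → V → ℝ) : Prop where
  self : ∀ a, D a a = 0
  symm : ∀ a b, D a b = D b a
  pos : ∀ a b, a ≠ b → 0 < D a b
  median : ∀ a b c, ∃ m, IsMed D m a b c
  split : ∀ a m c, MBtw D a m c → ∀ x, MBtw D a m x ∨ MBtw D c m x

namespace IsTreeMetric

variable {D : V → V → ℝ} (h : IsTreeMetric D)
include h

theorem nonneg (a b : V) : 0 ≤ D a b := by
  by_cases e : a = b
  · rw [e, h.self]
  · exact (h.pos a b e).le

theorem eq_of_le_zero {a b : V} (e : D a b ≤ 0) : a = b := by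
  by_contra hne
  exact absurd (h.pos a b hne) (not_lt.2 e)

theorem tri (a b c : V) : D a c ≤ D a b + D b c := by
  obtain ⟨m, h1, h2, h3⟩ := h.median a b c
  unfold MBtw at *
  have := h.symm b m
  have := h.nonneg b m
  linarith

theorem btw_left (a b : V) : MBtw D a a b := by simp [MBtw, h.self]

theorem btw_right (a b : V) : MBtw D a b b := by simp [MBtw, h.self]

theorem btw_symm {a b c : V} (k : MBtw D a b c) : MBtw D c b a := by
  unfold MBtw at *
  rw [h.symm c a, h.symm c b, h.symm b a]; linarith

theorem btw_self {a b : V} (k : MBtw D a b a) : b = a := by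
  unfold MBtw at k
  apply h.eq_of_le_zero
  rw [h.self, h.symm a b] at k; linarith

theorem btw_antisymm {a b c : V} (k : MBtw D a b c) (k' : MBtw D a c b) : b = c := by
  unfold MBtw at *
  apply h.eq_of_le_zero
  have := h.symm b c
  linarith

theorem btw_trans {a b c d : V} (k : MBtw D a b c) (k' : MBtw D a c d) : MBtw D a b d := by
  unfold MBtw at *
  have := h.tri b c d
  have := h.tri a b d
  linarith

theorem btw_trans' {a b c d : V} (k : MBtw D a b c) (k' : MBtw D a c d) : MBtw D b c d := by
  unfold MBtw at *
  have := h.tri b c d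
  have := h.tri a b d
  linarith

/-- False in a general metric space; this is where `split` enters. If `b` did not separate `a` from
`d`, it would separate `c` from `d`; since `c` separates `b` from `d`, this forces `b = c`. -/
theorem btw_chain {a b c d : V} (k : MBtw D a b c) (k' : MBtw D b c d) (hne : b ≠ c) :
    MBtw D a b d := by
  rcases h.split _ _ _ k d with k1 | k1
  · exact k1
  · exact absurd (h.btw_antisymm (h.btw_symm k1) (h.btw_symm k')).symm hne.symm

/-- Insert `b` in a gap: `a ≤ x ≤ c` on the way and `b` between `x` and `c`. -/
theorem btw_of_btw_right {a x b c : V} (k : MBtw D a x c) (k' : MBtw D x b c) : MBtw D a b c :=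
  h.btw_symm (h.btw_trans (h.btw_symm k') (h.btw_symm k))

theorem med_unique {m m' a b c : V} (k : IsMed D m a b c) (k' : IsMed D m' a b c) : m = m' := by
  obtain ⟨k1, k2, k3⟩ := k
  obtain ⟨l1, l2, l3⟩ := k'
  apply h.eq_of_le_zero
  have e1 := h.symm b m
  have e2 := h.symm b m'
  rcases h.split _ _ _ k1 m' with s | s <;> (unfold MBtw at *; linarith)

theorem med_rotate {m a b c : V} (k : IsMed D m a b c) : IsMed D m b c a :=
  ⟨k.2.2, h.btw_symm k.1, h.btw_symm k.2.1⟩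

theorem med_swap {m a b c : V} (k : IsMed D m a b c) : IsMed D m b a c :=
  ⟨h.btw_symm k.1, k.2.2, k.2.1⟩

/-- Two points between `a` and `b` are in one of the two orders. -/
theorem btw_total {a b x y : V} (kx : MBtw D a x b) (ky : MBtw D a y b) :
    MBtw D a x y ∨ MBtw D a y x := by
  rcases h.split _ _ _ kx y with s | s
  · exact Or.inl s
  · right
    have := h.symm b x
    have := h.symm b y
    have := h.symm y x
    unfold MBtw at *
    linarith

end IsTreeMetric

/-- The medians of the triples of members of `Q`. -/
def medClosure (D : V → V → ℝ) (Q : Set V) : Set V :=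
  {m | ∃ a ∈ Q, ∃ b ∈ Q, ∃ c ∈ Q, IsMed D m a b c}

/-- `S` contains all medians of its triples. -/
def MedClosed (D : V → V → ℝ) (S : Set V) : Prop :=
  ∀ a ∈ S, ∀ b ∈ S, ∀ c ∈ S, ∀ m, IsMed D m a b c → m ∈ S

/-- The graph on `S` in which two points are adjacent if no third point of `S` is between them. -/
def skel (D : V → V → ℝ) (S : Set V) : SimpleGraph V where
  Adj a b := a ∈ S ∧ b ∈ S ∧ a ≠ b ∧ ∀ c ∈ S, MBtw D a c b ∨ MBtw D b c a → c = a ∨ c = b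
  symm := ⟨fun _ _ ⟨h1, h2, h3, h4⟩ => ⟨h2, h1, h3.symm, fun c hc k => (h4 c hc k.symm).symm⟩⟩
  loopless := ⟨fun _ k => k.2.2.1 rfl⟩

namespace IsTreeMetric

variable {D : V → V → ℝ} (h : IsTreeMetric D)
include h

/-- The disjunction in `skel` makes the relation symmetric for an arbitrary `D`; for a tree metric
one half of it is enough. -/
theorem skel_adj {S : Set V} {a b : V} :
    (skel D S).Adj a b ↔ a ∈ S ∧ b ∈ S ∧ a ≠ b ∧ ∀ c ∈ S, MBtw D a c b → c = a ∨ c = b :=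
  ⟨fun ⟨h1, h2, h3, h4⟩ => ⟨h1, h2, h3, fun c hc k => h4 c hc (Or.inl k)⟩,
   fun ⟨h1, h2, h3, h4⟩ => ⟨h1, h2, h3, fun c hc k => h4 c hc (k.elim id h.btw_symm)⟩⟩

theorem subset_medClosure (Q : Set V) : Q ⊆ medClosure D Q := fun a ha =>
  ⟨a, ha, a, ha, a, ha, h.btw_left _ _, h.btw_left _ _, h.btw_left _ _⟩

/-- Beyond every point of the closure, seen from anywhere, there is a point of `Q`. -/
theorem exists_beyond {Q : Set V} {p : V} (hp : p ∈ medClosure D Q) (x : V) :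
    ∃ a ∈ Q, MBtw D x p a := by
  obtain ⟨a, ha, b, hb, c, hc, k, -, -⟩ := hp
  rcases h.split _ _ _ k x with s | s
  · exact ⟨a, ha, h.btw_symm s⟩
  · exact ⟨b, hb, h.btw_symm s⟩

/-- Taking medians once is enough: if `x` is a median of `p`, `q`, `r` and different from them, the
three legs can be prolonged beyond `p`, `q`, `r` to members of `Q`, and `x` is still the median of
these. -/
theorem medClosed_medClosure (Q : Set V) : MedClosed D (medClosure D Q) := by
  intro p hp q hq r hr x ⟨k1, k2, k3⟩
  by_cases ep : x = p
  · exact ep ▸ hp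
  by_cases eq : x = q
  · exact eq ▸ hq
  by_cases er : x = r
  · exact er ▸ hr
  obtain ⟨a, ha, ka⟩ := h.exists_beyond hp x
  obtain ⟨b, hb, kb⟩ := h.exists_beyond hq x
  obtain ⟨c, hc, kc⟩ := h.exists_beyond hr x
  have key : ∀ {p q a b : V}, MBtw D p x q → MBtw D x p a → MBtw D x q b → x ≠ p → x ≠ q →
      MBtw D a x b := by
    intro p q a b k ka kb e1 e2
    have s1 : MBtw D p x b := h.btw_chain k kb e2
    have s2 : MBtw D b x a := h.btw_chain (h.btw_symm s1) ka e1
    exact h.btw_symm s2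
  exact ⟨a, ha, b, hb, c, hc, key k1 ka kb ep eq, key k2 ka kc ep er, key k3 kb kc eq er⟩

/-- In the graph on a median closed set the two ends of an edge separate the set. -/
theorem btw_or_btw_of_skel_adj {S : Set V} (hS : MedClosed D S) {a b : V}
    (k : (skel D S).Adj a b) {c : V} (hc : c ∈ S) : MBtw D b a c ∨ MBtw D a b c := by
  obtain ⟨ha, hb, -, k⟩ := h.skel_adj.1 k
  obtain ⟨m, h1, h2, h3⟩ := h.median a b c
  rcases k m (hS a ha b hb c hc m ⟨h1, h2, h3⟩) h1 with rfl | rfl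
  · exact Or.inl h3
  · exact Or.inr h2

theorem not_btw_and_btw {a b c : V} (hne : a ≠ b) (k : MBtw D b a c) (k' : MBtw D a b c) : False :=
  hne (h.btw_antisymm (h.btw_symm k) (h.btw_symm k'))

/-- A step between adjacent points that crosses the edge `ab` is that edge. -/
theorem eq_of_crossing {S : Set V} {a b p q : V} (ha : a ∈ S) (hb : b ∈ S)
    (hne : a ≠ b) (k : (skel D S).Adj p q) (hp : MBtw D b a p) (hq : MBtw D a b q) :
    p = a ∧ q = b := by
  obtain ⟨-, -, -, k⟩ := h.skel_adj.1 k
  have h1 : MBtw D p a q := h.btw_chain (h.btw_symm hp) hq hne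
  have h2 : MBtw D p b q := h.btw_symm (h.btw_chain (h.btw_symm hq) hp hne.symm)
  rcases k a ha h1 with rfl | rfl
  · rcases k b hb h2 with rfl | rfl
    · exact absurd rfl hne
    · exact ⟨rfl, rfl⟩
  · exact absurd (h.btw_self hq).symm hne

end IsTreeMetric

/-- A graph is acyclic if every edge crosses a cut that no other edge crosses. -/
theorem isAcyclic_of_cuts {G : SimpleGraph V}
    (hG : ∀ p q, G.Adj p q → ∃ g : V → Prop, g p ∧ ¬ g q ∧
      ∀ a b, G.Adj a b → g a → ¬ g b → a = p ∧ b = q) : G.IsAcyclic := by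
  rw [SimpleGraph.isAcyclic_iff_forall_adj_isBridge]
  intro p q hpq
  obtain ⟨g, gp, gq, hg⟩ := hG p q hpq
  rw [SimpleGraph.isBridge_iff]
  rintro ⟨w⟩
  -- A walk from `p` to `q` that avoids the edge still has to cross the cut, and the only crossing
  -- edge is the deleted one.
  obtain ⟨d, hd, h1, h2⟩ := w.exists_boundary_dart {x | g x} gp gq
  have hadj := d.adj
  rw [SimpleGraph.deleteEdges_adj] at hadj
  obtain ⟨e1, e2⟩ := hg _ _ hadj.1 h1 h2
  apply hadj.2
  rw [e1, e2]; rfl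

/-- The cut that belongs to an edge `pq` consists of the points that are seen from `q` through `p`.
-/
theorem IsTreeMetric.skel_isAcyclic {D : V → V → ℝ} (h : IsTreeMetric D) {S : Set V}
    (hS : MedClosed D S) : (skel D S).IsAcyclic := by
  apply isAcyclic_of_cuts
  intro p q hpq
  have hp := hpq.1
  have hq := hpq.2.1
  have hne := hpq.ne
  refine ⟨fun c => MBtw D q p c, h.btw_right _ _, fun k => hne (h.btw_self k), ?_⟩
  intro a b hab ga gb
  exact h.eq_of_crossing hp hq hne hab ga
    ((h.btw_or_btw_of_skel_adj hS hpq hab.2.1).resolve_left gb)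

end TreeMetric

/-! ### Paths as lists of vertices -/

section Paths

variable {N V : Type*}

/-- The list `l` is the list of vertices of a path from `a` to `b`. -/
structure IsPathOf (G : SimpleGraph N) (l : List N) (a b : N) : Prop where
  chain : l.IsChain G.Adj
  nodup : l.Nodup
  head : l.head? = some a
  last : l.getLast? = some b

theorem IsPathOf.exists_walk {G : SimpleGraph N} {l : List N} {a b : N} (h : IsPathOf G l a b) :
    ∃ p : G.Walk a b, p.IsPath ∧ p.support = l := by
  obtain ⟨h1, h2, h3, h4⟩ := h
  induction l generalizing a with
  | nil => simp at h3
  | cons x t ih =>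
    obtain rfl : x = a := by simpa using h3
    cases t with
    | nil =>
      obtain rfl : x = b := by simpa using h4
      exact ⟨.nil, by simp, by simp⟩
    | cons y t =>
      rw [List.isChain_cons_cons] at h1
      obtain ⟨p, hp, hs⟩ := ih (a := y) h1.2 h2.of_cons rfl (by simpa using h4)
      refine ⟨.cons h1.1 p, ?_, by simp [hs]⟩
      rw [SimpleGraph.Walk.cons_isPath_iff, hs]
      exact ⟨hp, (List.nodup_cons.1 h2).1⟩

theorem isPathOf_support {G : SimpleGraph N} {a b : N} (p : G.Walk a b) (hp : p.IsPath) :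
    IsPathOf G p.support a b where
  chain := p.isChain_adj_support
  nodup := hp.support_nodup
  head := by cases p <;> rfl
  last := by
    rw [List.getLast?_eq_some_getLast p.support_ne_nil, p.getLast_support]

theorem isPathOf_pathList {G : SimpleGraph N} {a b : N} (h : G.Reachable a b) :
    IsPathOf G (pathList G a b) a b := by
  unfold pathList
  rw [dif_pos h]
  exact isPathOf_support _ h.exists_isPath.choose_spec

/-- `pathList` is an arbitrary choice. In an acyclic graph every explicit list that is a path has to
be the chosen one, and this is how paths are computed below. -/
theorem pathList_eq {G : SimpleGraph N} (hG : G.IsAcyclic) {l : List N} {a b : N}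
    (h : IsPathOf G l a b) : pathList G a b = l := by
  obtain ⟨p, hp, rfl⟩ := h.exists_walk
  have hr : G.Reachable a b := ⟨p⟩
  unfold pathList
  rw [dif_pos hr]
  have := (hG.subsingleton_path a b).elim ⟨_, hr.exists_isPath.choose_spec⟩ ⟨p, hp⟩
  exact congrArg (fun q : G.Path a b => q.1.support) this

theorem isPathOf_singleton (G : SimpleGraph N) (a : N) : IsPathOf G [a] a a :=
  ⟨by simp, by simp, rfl, rfl⟩

theorem IsPathOf.ne_nil {G : SimpleGraph N} {l : List N} {a b : N} (h : IsPathOf G l a b) :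
    l ≠ [] := by
  rintro rfl
  simpa using h.head

theorem IsPathOf.start_mem {G : SimpleGraph N} {l : List N} {a b : N} (h : IsPathOf G l a b) :
    a ∈ l := List.mem_of_mem_head? (by rw [h.head]; rfl)

theorem IsPathOf.end_mem {G : SimpleGraph N} {l : List N} {a b : N} (h : IsPathOf G l a b) :
    b ∈ l := List.mem_of_getLast? h.last

theorem IsPathOf.append {G : SimpleGraph N} {l r : List N} {a b c d : N} (hl : IsPathOf G l a b)
    (hr : IsPathOf G r c d) (hbc : G.Adj b c) (hd : ∀ x ∈ l, x ∉ r) : IsPathOf G (l ++ r) a d where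
  chain := by
    rw [List.isChain_append]
    refine ⟨hl.chain, hr.chain, ?_⟩
    intro x hx y hy
    rw [hl.last] at hx
    rw [hr.head] at hy
    obtain rfl : b = x := by simpa using hx
    obtain rfl : c = y := by simpa using hy
    exact hbc
  nodup := List.nodup_append.2 ⟨hl.nodup, hr.nodup, fun x hx y hy e => hd x hx (e ▸ hy)⟩
  head := by rw [List.head?_append, hl.head]; rfl
  last := by rw [List.getLast?_append, hr.last]; rfl

theorem IsPathOf.mono {G H : SimpleGraph N} {l : List N} {a b : N} (h : IsPathOf G l a b)
    (hGH : ∀ x ∈ l, ∀ y ∈ l, G.Adj x y → H.Adj x y) : IsPathOf H l a b :=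
  ⟨h.chain.imp_of_mem_imp fun _ _ hx hy k => hGH _ hx _ hy k, h.nodup, h.head, h.last⟩

theorem IsPathOf.map {G : SimpleGraph N} {H : SimpleGraph V} {l : List N} {a b : N} {f : N → V}
    (h : IsPathOf G l a b) (hGH : ∀ x ∈ l, ∀ y ∈ l, G.Adj x y → H.Adj (f x) (f y))
    (hf : Set.InjOn f {x | x ∈ l}) : IsPathOf H (l.map f) (f a) (f b) where
  chain := by
    rw [List.isChain_map]
    exact h.chain.imp_of_mem_imp fun _ _ hx hy k => hGH _ hx _ hy k
  nodup := List.Nodup.map_on (fun x hx y hy e => hf hx hy e) h.nodup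
  head := by rw [List.head?_map, h.head]; rfl
  last := by rw [List.getLast?_map, h.last]; rfl

/-! ### Consecutive vertices -/

theorem consecutive_symm {l : List N} {x y : N} (h : Consecutive l x y) : Consecutive l y x :=
  Or.symm h

theorem consecutive_cons_cons {l : List N} {a b x y : N} :
    Consecutive (a :: b :: l) x y ↔
      (x = a ∧ y = b) ∨ (x = b ∧ y = a) ∨ Consecutive (b :: l) x y := by
  simp only [Consecutive, List.tail_cons, List.zip_cons_cons, List.mem_cons, Prod.mk.injEq]
  tauto

theorem not_consecutive_singleton {a x y : N} : ¬ Consecutive [a] x y := by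
  simp [Consecutive]

theorem consecutive_append {l r : List N} {a b x y : N} (hl : l.getLast? = some a)
    (hr : r.head? = some b) : Consecutive (l ++ r) x y ↔
      Consecutive l x y ∨ Consecutive r x y ∨ (x = a ∧ y = b) ∨ (x = b ∧ y = a) := by
  induction l with
  | nil => simp at hl
  | cons c t ih =>
    cases t with
    | nil =>
      obtain rfl : c = a := by simpa using hl
      cases r with
      | nil => simp at hr
      | cons d r =>
        obtain rfl : d = b := by simpa using hr
        simp only [List.singleton_append, consecutive_cons_cons]
        have := @not_consecutive_singleton _ c x y
        tauto
    | cons d t =>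
      have := ih (by simpa using hl)
      simp only [List.cons_append, consecutive_cons_cons] at this ⊢
      tauto

theorem Consecutive.mem {l : List N} {x y : N} (h : Consecutive l x y) : x ∈ l ∧ y ∈ l := by
  rcases h with h | h
  · exact ⟨(List.of_mem_zip h).1, List.mem_of_mem_tail (List.of_mem_zip h).2⟩
  · exact ⟨List.mem_of_mem_tail (List.of_mem_zip h).2, (List.of_mem_zip h).1⟩

theorem Consecutive.adj {G : SimpleGraph N} {l : List N} {x y : N} (h : Consecutive l x y)
    (hl : l.IsChain G.Adj) : G.Adj x y := by
  induction l with
  | nil => simp [Consecutive] at h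
  | cons a t ih =>
    cases t with
    | nil => exact absurd h not_consecutive_singleton
    | cons b t =>
      rw [List.isChain_cons_cons] at hl
      rcases consecutive_cons_cons.1 h with ⟨rfl, rfl⟩ | ⟨rfl, rfl⟩ | k
      · exact hl.1
      · exact hl.1.symm
      · exact ih k hl.2

theorem consecutive_map {f : N → V} {l : List N} {x y : N} {s : Set N} (hf : Set.InjOn f s)
    (hl : ∀ z ∈ l, z ∈ s) (hx : x ∈ s) (hy : y ∈ s) :
    Consecutive (l.map f) (f x) (f y) ↔ Consecutive l x y := by
  induction l with
  | nil => simp [Consecutive]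
  | cons a t ih =>
    cases t with
    | nil => simp [not_consecutive_singleton]
    | cons b t =>
      have := ih fun z hz => hl z (List.mem_cons_of_mem _ hz)
      have ha := hl a (by simp)
      have hb := hl b (by simp)
      simp only [List.map_cons, consecutive_cons_cons] at this ⊢
      rw [this, hf.eq_iff hx ha, hf.eq_iff hx hb, hf.eq_iff hy ha, hf.eq_iff hy hb]

theorem unionPath_map (f : N → V) (p q : List N) :
    (unionPath p q).map f = unionPath (p.map f) (q.map f) := by
  simp [unionPath, List.map_dropLast, List.map_tail]

/-! ### Named graphs as models of graphs -/

/-- The renaming `f` turns `G` into the graph `H` on the set `S`. -/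
structure Models (f : N → V) (G : NamedGraph N) (S : Set V) (H : SimpleGraph V) : Prop where
  bij : Set.BijOn f G.verts S
  adj : ∀ a ∈ G.verts, ∀ b ∈ G.verts, G.graph.Adj a b ↔ H.Adj (f a) (f b)
  supp : ∀ a b, G.graph.Adj a b → a ∈ G.verts ∧ b ∈ G.verts

namespace Models

variable {f : N → V} {G : NamedGraph N} {S : Set V} {H : SimpleGraph V}

theorem mem_of_isPathOf (h : Models f G S H) {l : List N} {a b : N} (hl : IsPathOf G.graph l a b)
    (ha : a ∈ G.verts) : ∀ x ∈ l, x ∈ G.verts := by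
  obtain ⟨h1, -, h3, -⟩ := hl
  induction l generalizing a with
  | nil => simp
  | cons y t ih =>
    obtain rfl : y = a := by simpa using h3
    cases t with
    | nil => simpa using ha
    | cons z t =>
      rw [List.isChain_cons_cons] at h1
      intro x hx
      rcases List.mem_cons.1 hx with rfl | hx
      · exact ha
      · exact ih (h.supp _ _ h1.1).2 h1.2 rfl x hx

/-- Only `H` is known to be acyclic. The path in `H`, pulled back along the inverse of `f`, shows
that `b` can be reached from `a` in `G`, so that `pathList` is not the empty default. The chosen
path is then pushed forward and identified in `H`. -/
theorem pathList (h : Models f G S H) (hH : H.IsAcyclic) {a b : N} (ha : a ∈ G.verts)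
    (hb : b ∈ G.verts) {l : List V} (hl : IsPathOf H l (f a) (f b)) (hlS : ∀ x ∈ l, x ∈ S) :
    (pathList G.graph a b).map f = l ∧ IsPathOf G.graph (_root_.pathList G.graph a b) a b ∧
      ∀ x ∈ _root_.pathList G.graph a b, x ∈ G.verts := by
  have : Nonempty N := ⟨a⟩
  have hg : ∀ x ∈ S, Function.invFunOn f G.verts x ∈ G.verts ∧
      f (Function.invFunOn f G.verts x) = x := fun x hx =>
    ⟨Function.invFunOn_mem (h.bij.surjOn hx), Function.invFunOn_eq (h.bij.surjOn hx)⟩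
  have hfa : ∀ x ∈ G.verts, Function.invFunOn f G.verts (f x) = x := fun x hx =>
    h.bij.injOn.leftInvOn_invFunOn hx
  have h1 : IsPathOf G.graph (l.map (Function.invFunOn f G.verts)) a b := by
    have := hl.map (H := G.graph) (f := Function.invFunOn f G.verts)
      (fun x hx y hy k => by
        rw [h.adj _ (hg x (hlS x hx)).1 _ (hg y (hlS y hy)).1, (hg x (hlS x hx)).2,
          (hg y (hlS y hy)).2]
        exact k)
      (fun x hx y hy e => by
        rw [← (hg x (hlS x hx)).2, ← (hg y (hlS y hy)).2]; exact congrArg f e)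
    rwa [hfa a ha, hfa b hb] at this
  obtain ⟨w, -, -⟩ := h1.exists_walk
  have h2 := isPathOf_pathList (G := G.graph) ⟨w⟩
  have h3 := h.mem_of_isPathOf h2 ha
  refine ⟨?_, h2, h3⟩
  have h4 := h2.map (H := H) (f := f)
    (fun x hx y hy k => (h.adj _ (h3 x hx) _ (h3 y hy)).1 k)
    (fun x hx y hy e => h.bij.injOn (h3 x hx) (h3 y hy) e)
  rw [← pathList_eq hH h4, pathList_eq hH hl]

theorem congr {f' : N → V} (h : Models f G S H) (e : ∀ x ∈ G.verts, f' x = f x) :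
    Models f' G S H where
  bij := h.bij.congr fun x hx => (e x hx).symm
  adj a ha b hb := by rw [e a ha, e b hb]; exact h.adj a ha b hb
  supp := h.supp

theorem map_graph (h : Models f G S H) (hH : ∀ a b, H.Adj a b → a ∈ S ∧ b ∈ S) :
    (G.map f).graph = H := by
  ext a b
  simp only [NamedGraph.map, SimpleGraph.map_adj']
  constructor
  · rintro ⟨-, x, y, hxy, rfl, rfl⟩
    exact (h.adj x (h.supp _ _ hxy).1 y (h.supp _ _ hxy).2).1 hxy
  · intro hab
    obtain ⟨x, hx, rfl⟩ := h.bij.surjOn (hH a b hab).1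
    obtain ⟨y, hy, rfl⟩ := h.bij.surjOn (hH _ b hab).2
    exact ⟨hab.ne, x, y, (h.adj x hx y hy).2 hab, rfl, rfl⟩

theorem mem_map_verts (h : Models f G S H) {v : V} : v ∈ (G.map f).verts ↔ v ∈ S := by
  rw [← h.bij.image_eq]
  simp [NamedGraph.map]

end Models

/-! ### Paths between points of a tree metric -/

/-- In the graph on `S` there is a path from `a` to `c` through the points of `S` between them. -/
theorem IsTreeMetric.exists_isPathOf [Finite V] {D : V → V → ℝ} (h : IsTreeMetric D) {S : Set V}
    {a c : V} (ha : a ∈ S) (hc : c ∈ S) :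
    ∃ l, IsPathOf (skel D S) l a c ∧ ∀ x, x ∈ l ↔ x ∈ S ∧ MBtw D a x c := by
  generalize hn : {x | x ∈ S ∧ MBtw D a x c}.ncard = n
  induction n using Nat.strong_induction_on generalizing a with
  | _ n ih =>
  by_cases hac : a = c
  · subst hac
    refine ⟨[a], isPathOf_singleton _ _, fun x => ?_⟩
    simp only [List.mem_singleton]
    exact ⟨by rintro rfl; exact ⟨ha, h.btw_left _ _⟩, fun k => h.btw_self k.2⟩
  -- The second vertex of the path is the point of `S` nearest to `a` on the way to `c`: nothing in
  -- `S` lies between `a` and `b`, and fewer points of `S` lie between `b` and `c`.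
  obtain ⟨b, ⟨hbS, hba, hb⟩, hmin⟩ := Set.exists_min_image {x | x ∈ S ∧ x ≠ a ∧ MBtw D a x c}
    (fun x => D a x) (Set.toFinite _) ⟨c, hc, Ne.symm hac, h.btw_right _ _⟩
  have hadj : (skel D S).Adj a b := by
    rw [h.skel_adj]
    refine ⟨ha, hbS, hba.symm, fun x hx k => ?_⟩
    by_contra hne
    push Not at hne
    have := hmin x ⟨hx, hne.1, h.btw_trans k hb⟩
    have h2 := h.pos x b hne.2
    unfold MBtw at k
    linarith
  obtain ⟨l, hl, hl'⟩ := ih _ (by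
    rw [← hn]
    apply Set.ncard_lt_ncard
    · refine ⟨fun x hx => ⟨hx.1, h.btw_of_btw_right hb hx.2⟩, fun hsub => ?_⟩
      have := (hsub ⟨ha, h.btw_left a c⟩).2
      exact hba (h.btw_antisymm (h.btw_symm hb) (h.btw_symm this)) 
    · exact Set.toFinite _) hbS rfl
  refine ⟨[a] ++ l, (isPathOf_singleton _ a).append hl hadj ?_, fun x => ?_⟩
  · intro x hx hxl
    obtain rfl : x = a := by simpa using hx
    have := ((hl' x).1 hxl).2
    exact hba (h.btw_antisymm (h.btw_symm hb) (h.btw_symm this))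
  · simp only [List.singleton_append, List.mem_cons, hl']
    constructor
    · rintro (rfl | ⟨h1, h2⟩)
      · exact ⟨ha, h.btw_left _ _⟩
      · exact ⟨h1, h.btw_of_btw_right hb h2⟩
    · rintro ⟨h1, h2⟩
      by_cases hxa : x = a
      · exact Or.inl hxa
      refine Or.inr ⟨h1, ?_⟩
      rcases h.btw_total hb h2 with k | k
      · exact h.btw_trans' k h2
      · rcases (h.skel_adj.1 hadj).2.2.2 x h1 k with rfl | rfl
        · exact absurd rfl hxa
        · exact h.btw_left _ _

theorem IsTreeMetric.mem_pathList_skel [Finite V] {D : V → V → ℝ} (h : IsTreeMetric D) {S : Set V}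
    (hS : MedClosed D S) {a c x : V} (ha : a ∈ S) (hc : c ∈ S) :
    x ∈ pathList (skel D S) a c ↔ x ∈ S ∧ MBtw D a x c := by
  obtain ⟨l, hl, hl'⟩ := h.exists_isPathOf ha hc
  rw [pathList_eq (h.skel_isAcyclic hS) hl, hl']

end Paths

/-! ### The tree metric of an additive distance -/

section Additive

variable {V : Type*} {T : SimpleGraph V}

theorem mem_support_of_mem_pathList (hT : T.IsTree) {a b c : V} (h : b ∈ pathList T a c)
    (w : T.Walk a c) : b ∈ w.support := by
  rw [pathList_eq hT.isAcyclic (isPathOf_support w.bypass w.bypass_isPath)] at h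
  exact w.support_bypass_subset_support h

theorem exists_path_support (hT : T.IsTree) (a b : V) :
    ∃ p : T.Walk a b, p.IsPath ∧ p.support = pathList T a b :=
  (isPathOf_pathList (hT.connected a b)).exists_walk

theorem mem_pathList_symm (hT : T.IsTree) {a b c : V} (h : b ∈ pathList T a c) :
    b ∈ pathList T c a := by
  obtain ⟨p, -, hp⟩ := exists_path_support hT c a
  have := mem_support_of_mem_pathList hT h p.reverse
  rwa [SimpleGraph.Walk.support_reverse, List.mem_reverse, hp] at this

theorem mem_pathList_or (hT : T.IsTree) {a b c : V} (h : b ∈ pathList T a c) (x : V) :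
    b ∈ pathList T a x ∨ b ∈ pathList T c x := by
  obtain ⟨p, -, hp⟩ := exists_path_support hT a x
  obtain ⟨q, -, hq⟩ := exists_path_support hT c x
  have := mem_support_of_mem_pathList hT h (p.append q.reverse)
  rw [SimpleGraph.Walk.mem_support_append_iff, SimpleGraph.Walk.support_reverse, List.mem_reverse,
    hp, hq] at this
  exact this

theorem pathList_subset (hT : T.IsTree) {a b c x : V} (h : b ∈ pathList T a c)
    (hx : x ∈ pathList T a b) : x ∈ pathList T a c := by
  obtain ⟨p, -, hp⟩ := exists_path_support hT a c
  rw [← hp] at h ⊢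
  exact p.support_takeUntil_subset_support h
    (mem_support_of_mem_pathList hT hx (p.takeUntil b h))

theorem start_mem_pathList (hT : T.IsTree) (a b : V) : a ∈ pathList T a b :=
  (isPathOf_pathList (hT.connected a b)).start_mem

theorem end_mem_pathList (hT : T.IsTree) (a b : V) : b ∈ pathList T a b :=
  (isPathOf_pathList (hT.connected a b)).end_mem

theorem pathList_cons (hT : T.IsTree) {a a' b : V} (h : T.Adj a a') {p : T.Walk a' b}
    (hp : (SimpleGraph.Walk.cons h p).IsPath) :
    pathList T a b = a :: pathList T a' b ∧ a ∉ pathList T a' b := by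
  rw [pathList_eq hT.isAcyclic (isPathOf_support _ hp)]
  rw [SimpleGraph.Walk.cons_isPath_iff] at hp
  rw [pathList_eq hT.isAcyclic (isPathOf_support _ hp.1)]
  exact ⟨by simp, hp.2⟩

/-- Let `a` move one step towards `b`. Either `a` lies on the path from `b` to `c` and is itself a
median, or a median for the new starting point still serves. -/
theorem exists_median (hT : T.IsTree) (a b c : V) :
    ∃ m, m ∈ pathList T a b ∧ m ∈ pathList T a c ∧ m ∈ pathList T b c := by
  obtain ⟨p, hp, -⟩ := exists_path_support hT a b
  induction p with
  | nil => exact ⟨_, start_mem_pathList hT _ _, start_mem_pathList hT _ _, start_mem_pathList hT _ _⟩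
  | @cons a a' b hadj p ih =>
    obtain ⟨e, hna⟩ := pathList_cons hT hadj hp
    obtain ⟨m, h1, h2, h3⟩ := ih hp.of_cons
    by_cases ha : a ∈ pathList T b c
    · exact ⟨a, start_mem_pathList hT _ _, start_mem_pathList hT _ _, ha⟩
    refine ⟨m, by rw [e]; exact List.mem_cons_of_mem _ h1, ?_, h3⟩
    have ha' : a' ∈ pathList T a b := by
      rw [e]; exact List.mem_cons_of_mem _ (start_mem_pathList hT _ _)
    have hac : a' ∈ pathList T a c := by
      rcases mem_pathList_or hT ha' c with k | k
      · exact k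
      by_contra hn
      obtain ⟨q, hq, hq'⟩ := exists_path_support hT a c
      have hcons : (SimpleGraph.Walk.cons hadj.symm q).IsPath :=
        (SimpleGraph.Walk.cons_isPath_iff _ _).2 ⟨hq, hq' ▸ hn⟩
      have h5 : a ∈ pathList T a' c := by
        rw [(pathList_cons hT hadj.symm hcons).1]
        exact List.mem_cons_of_mem _ (start_mem_pathList hT _ _)
      exact ha (mem_pathList_symm hT
        (pathList_subset hT (mem_pathList_symm hT k) (mem_pathList_symm hT h5)))
    exact mem_pathList_symm hT
      (pathList_subset hT (mem_pathList_symm hT hac) (mem_pathList_symm hT h2))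

/-- The distance `dist`, set to zero on the diagonal. -/
noncomputable def offDiag (dist : V → V → ℝ) (a b : V) : ℝ := if a = b then 0 else dist a b

theorem offDiag_self (dist : V → V → ℝ) (a : V) : offDiag dist a a = 0 := if_pos rfl

theorem offDiag_of_ne {dist : V → V → ℝ} {a b : V} (h : a ≠ b) : offDiag dist a b = dist a b :=
  if_neg h

namespace IsAdditiveDistance

variable {dist : V → V → ℝ} (h : IsAdditiveDistance T dist) (hT : T.IsTree)
include h hT

theorem dist_pos {a b : V} (hne : a ≠ b) : 0 < dist a b := by
  obtain ⟨p, hp, -⟩ := exists_path_support hT a b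
  induction p with
  | nil => exact absurd rfl hne
  | @cons a a' b hadj p ih =>
    obtain ⟨e, hna⟩ := pathList_cons hT hadj hp
    by_cases hb : a' = b
    · subst hb
      exact h.pos _ _ hadj
    · rw [h.add a a' b (by rw [e]; exact List.mem_cons_of_mem _ (start_mem_pathList hT _ _))
        hadj.ne' hb]
      exact add_pos (h.pos _ _ hadj) (ih hb hp.of_cons)

theorem btw_of_mem {a b c : V} (hb : b ∈ pathList T a c) : MBtw (offDiag dist) a b c := by
  unfold MBtw
  by_cases hba : b = a
  · subst hba; simp [offDiag_self]
  by_cases hbc : b = c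
  · subst hbc; simp [offDiag_self]
  have hac : a ≠ c := by
    rintro rfl
    rw [pathList_eq hT.isAcyclic (isPathOf_singleton T a)] at hb
    simp_all
  rw [offDiag_of_ne hac, offDiag_of_ne (Ne.symm hba), offDiag_of_ne hbc]
  exact h.add a b c hb hba hbc

/-- For the converse, let `m` be the point where `b` branches off the path from `a` to `c`. The way
from `a` to `c` through `b` has an excess of twice the distance from `m` to `b`, which is positive
unless `b = m`. -/
theorem mem_pathList_iff {a b c : V} : b ∈ pathList T a c ↔ MBtw (offDiag dist) a b c := by
  refine ⟨h.btw_of_mem hT, fun k => ?_⟩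
  obtain ⟨m, h1, h2, h3⟩ := exists_median hT a c b
  by_cases hmb : b = m
  · exact hmb ▸ h1
  have k1 := h.btw_of_mem hT h1
  have k2 := h.btw_of_mem hT h2
  have k3 := h.btw_of_mem hT h3
  have k4 : 0 < offDiag dist m b := by
    rw [offDiag_of_ne (Ne.symm hmb)]; exact h.dist_pos hT (Ne.symm hmb)
  have symm : ∀ x y, offDiag dist x y = offDiag dist y x := fun x y => by
    by_cases e : x = y
    · rw [e]
    · rw [offDiag_of_ne e, offDiag_of_ne (Ne.symm e), h.symm]
  have := symm c b
  have := symm c m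
  unfold MBtw at *
  linarith

theorem isTreeMetric : IsTreeMetric (offDiag dist) where
  self := offDiag_self dist
  symm x y := by
    by_cases e : x = y
    · rw [e]
    · rw [offDiag_of_ne e, offDiag_of_ne (Ne.symm e), h.symm]
  pos a b hab := by rw [offDiag_of_ne hab]; exact h.dist_pos hT hab
  median a b c := by
    obtain ⟨m, h1, h2, h3⟩ := exists_median hT a b c
    exact ⟨m, h.btw_of_mem hT h1, h.btw_of_mem hT h2, h.btw_of_mem hT h3⟩
  split a m c k x := by
    rw [← h.mem_pathList_iff hT] at k ⊢
    rw [← h.mem_pathList_iff hT]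
    exact mem_pathList_or hT k x

theorem eq_skel : T = skel (offDiag dist) Set.univ := by
  have hD := h.isTreeMetric hT
  ext a b
  rw [hD.skel_adj]
  constructor
  · intro hab
    refine ⟨trivial, trivial, hab.ne, fun c _ hc => ?_⟩
    rw [← h.mem_pathList_iff hT] at hc
    simpa using mem_support_of_mem_pathList hT hc (.cons hab .nil)
  · rintro ⟨-, -, hne, k⟩
    obtain ⟨p, hp, -⟩ := exists_path_support hT a b
    cases p with
    | nil => exact absurd rfl hne
    | @cons _ a' _ hadj p =>
      have : a' ∈ pathList T a b := by
        rw [(pathList_cons hT hadj hp).1]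
        exact List.mem_cons_of_mem _ (start_mem_pathList hT _ _)
      rcases k a' trivial ((h.mem_pathList_iff hT).1 this) with rfl | rfl
      · exact absurd rfl hadj.ne
      · exact hadj

end IsAdditiveDistance

end Additive

/-! ### Removing the leaves of a set of points -/

section Stems

variable {V : Type*}

/-- Seen from `a` and `b`, all other points of `Q` branch off at `m`. -/
def Cherry (D : V → V → ℝ) (Q : Set V) (a b m : V) : Prop :=
  a ∈ Q ∧ b ∈ Q ∧ a ≠ b ∧ ∀ c ∈ Q, c ≠ a → c ≠ b → IsMed D m a b c

/-- The point at which `a` is attached together with another point of `Q`; the point `a` itself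
if there is no such point. -/
noncomputable def stem (D : V → V → ℝ) (Q : Set V) (a : V) : V :=
  if h : ∃ m b, Cherry D Q a b m then h.choose else a

namespace IsTreeMetric

variable {D : V → V → ℝ} (h : IsTreeMetric D) {Q : Set V}
include h

theorem cherry_symm {a b m : V} (k : Cherry D Q a b m) : Cherry D Q b a m :=
  ⟨k.2.1, k.1, k.2.2.1.symm, fun c hc h1 h2 => h.med_swap (k.2.2.2 c hc h2 h1)⟩

/-- A point between `c₁` and `c₂` that is separated from both by `s` is `s`. -/
theorem eq_of_btw_of_btw {x s p q : V} (k : MBtw D p x q) (kp : MBtw D x s p)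
    (kq : MBtw D x s q) : s = x := by
  apply h.eq_of_le_zero
  have e1 := h.symm p x
  have e2 := h.symm s p
  have e3 := h.symm s x
  have := h.tri p s q
  unfold MBtw at *
  linarith

-- In other words `Q` has at least three points. With fewer, every point would satisfy the condition
-- in `Cherry` vacuously.
variable (hQ : ∀ a b, ∃ c ∈ Q, c ≠ a ∧ c ≠ b)
include hQ

/-- If the partners `b` and `b'` differ, each is an outside point for the other, so that `m` and
`m'` are both medians of `a`, `b`, `b'`. If they agree, a third point of `Q` determines the median.
-/
theorem cherry_unique {a b b' m m' : V} (k : Cherry D Q a b m) (k' : Cherry D Q a b' m') :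
    m = m' := by
  obtain ⟨ha, hb, hab, k⟩ := k
  obtain ⟨-, hb', hab', k'⟩ := k'
  by_cases e : b = b'
  · subst e
    obtain ⟨c, hc, h1, h2⟩ := hQ a b
    exact h.med_unique (k c hc h1 h2) (k' c hc h1 h2)
  · have h1 := k b' hb' hab'.symm (Ne.symm e)
    have h2 := k' b hb hab.symm e
    exact h.med_unique h1 (h.med_swap (h.med_rotate (h.med_rotate h2)))

theorem stem_eq {a b m : V} (k : Cherry D Q a b m) : stem D Q a = m := by
  have hex : ∃ m b, Cherry D Q a b m := ⟨m, b, k⟩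
  unfold stem
  rw [dif_pos hex]
  obtain ⟨b', hb'⟩ := hex.choose_spec
  exact h.cherry_unique hQ hb' k

omit h hQ in
theorem exists_cherry_of_stem_ne {a : V} (k : stem D Q a ≠ a) :
    ∃ b, Cherry D Q a b (stem D Q a) := by
  by_cases hex : ∃ m b, Cherry D Q a b m
  · have := hex.choose_spec
    unfold stem
    rwa [dif_pos hex]
  · exact absurd (dif_neg hex) k

theorem stem_btw {a c : V} (hc : c ∈ Q) (hca : c ≠ a) : MBtw D a (stem D Q a) c := by
  by_cases k : stem D Q a = a
  · rw [k]; exact h.btw_left _ _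
  obtain ⟨b, -, hb, hab, kb⟩ := exists_cherry_of_stem_ne k
  by_cases hcb : c = b
  · subst hcb
    obtain ⟨d, hd, h1, h2⟩ := hQ a c
    exact (kb d hd h1 h2).1
  · exact (kb c hc hca hcb).2.1

theorem stem_mem {a : V} (ha : a ∈ Q) : stem D Q a ∈ medClosure D Q := by
  by_cases k : stem D Q a = a
  · rw [k]; exact h.subset_medClosure Q ha
  obtain ⟨b, -, hb, hab, kb⟩ := exists_cherry_of_stem_ne k
  obtain ⟨d, hd, h1, h2⟩ := hQ a b
  exact ⟨a, ha, b, hb, d, hd, kb d hd h1 h2⟩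

theorem cherry_of_stem_eq {a b : V} (ha : a ∈ Q) (hb : b ∈ Q) (hab : a ≠ b)
    (k : stem D Q a = stem D Q b) : Cherry D Q a b (stem D Q a) := by
  refine ⟨ha, hb, hab, fun c hc h1 h2 => ⟨h.stem_btw hQ hb hab.symm, h.stem_btw hQ hc h1, ?_⟩⟩
  rw [k]
  exact h.stem_btw hQ hc h2

/-- Hence belonging to a common cherry is an equivalence relation with the fibres of `stem` as
classes; this is why families form a partition. -/
theorem stem_eq_iff {a b : V} (ha : a ∈ Q) (hb : b ∈ Q) (hab : a ≠ b) :
    stem D Q a = stem D Q b ↔ ∃ m, Cherry D Q a b m :=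
  ⟨fun k => ⟨_, h.cherry_of_stem_eq hQ ha hb hab k⟩, fun ⟨m, k⟩ => by
    rw [h.stem_eq hQ k, h.stem_eq hQ (h.cherry_symm k)]⟩

/-- A point that is not its own stem is a leaf. As the stem of `b` it would lie between `b` and a
third point, although its own stem separates it from both. -/
theorem stem_ne {a b : V} (hb : b ∈ Q) (k : stem D Q a ≠ a) : stem D Q b ≠ a := by
  by_cases hab : b = a
  · rwa [hab]
  intro e
  obtain ⟨c, hc, h1, h2⟩ := hQ a b
  have k1 := h.stem_btw hQ hc h2
  rw [e] at k1
  exact k (h.eq_of_btw_of_btw k1 (h.stem_btw hQ hb hab) (h.stem_btw hQ hc h1))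

/-- It justifies the distances of the next round: the distance of two heads is the distance of two
members minus their distances to the heads. -/
theorem dist_stem {a b : V} (ha : a ∈ Q) (hb : b ∈ Q) (k : stem D Q a ≠ stem D Q b) :
    D a b = D a (stem D Q a) + D (stem D Q a) (stem D Q b) + D b (stem D Q b) := by
  have hab : a ≠ b := fun e => k (by rw [e])
  obtain ⟨c, hc, h1, h2⟩ := hQ a b
  have k1 := h.stem_btw hQ hb hab.symm
  have k2 := h.stem_btw hQ hc h1
  have k3 := h.stem_btw hQ ha hab
  have k4 := h.stem_btw hQ hc h2
  generalize stem D Q a = m at *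
  generalize stem D Q b = n at *
  have e1 := h.symm b n
  have e2 := h.symm b m
  have e3 := h.symm b a
  have e4 := h.symm n a
  rcases h.split _ _ _ k1 n with s | s
  · unfold MBtw at *
    linarith
  -- Here the two stems would come in the wrong order on the way from `a` to `b`. A third point
  -- branches off at `m` as seen from `a` and at `n` as seen from `b`, which forces `m = n`.
  · exfalso
    apply k
    apply h.eq_of_le_zero
    have := h.tri a n c
    have := h.tri b m c
    unfold MBtw at *
    linarith

omit hQ in
theorem exists_btw_of_mem {x a : V} (hx : x ∈ medClosure D Q) (hxa : x ≠ a) :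
    ∃ p ∈ Q, ∃ q ∈ Q, p ≠ a ∧ q ≠ a ∧ MBtw D p x q := by
  obtain ⟨p, hp, q, hq, r, hr, k1, k2, k3⟩ := hx
  by_cases ep : p = a
  · subst ep
    exact ⟨q, hq, r, hr, fun e => hxa (h.btw_self (e ▸ k1)),
      fun e => hxa (h.btw_self (e ▸ k2)), k3⟩
  by_cases eq : q = a
  · subst eq
    exact ⟨p, hp, r, hr, ep, fun e => hxa (h.btw_self (e ▸ k3)), k2⟩
  · exact ⟨p, hp, q, hq, ep, eq, k1⟩

theorem stem_btw_of_mem {a x : V} (hx : x ∈ medClosure D Q) (hxa : x ≠ a) :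
    MBtw D a (stem D Q a) x := by
  obtain ⟨p, hp, q, hq, hpa, hqa, k⟩ := h.exists_btw_of_mem hx hxa
  have kp := h.stem_btw hQ hp hpa
  have kq := h.stem_btw hQ hq hqa
  rcases h.split _ _ _ kp x with s1 | s1
  · exact s1
  rcases h.split _ _ _ kq x with s2 | s2
  · exact s2
  rw [h.eq_of_btw_of_btw k (h.btw_symm s1) (h.btw_symm s2)]
  exact h.btw_right _ _

theorem medClosure_image_stem_subset : medClosure D (stem D Q '' Q) ⊆ medClosure D Q := by
  have hC : ∀ x ∈ stem D Q '' Q, x ∈ medClosure D Q := by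
    rintro _ ⟨a, ha, rfl⟩
    exact h.stem_mem hQ ha
  rintro x ⟨a, ha, b, hb, c, hc, k⟩
  exact h.medClosed_medClosure Q a (hC a ha) b (hC b hb) c (hC c hc) x k

theorem notMem_of_stem_ne {a : V} (k : stem D Q a ≠ a) :
    a ∉ medClosure D (stem D Q '' Q) := by
  rintro ⟨_, ⟨b, hb, rfl⟩, _, ⟨c, hc, rfl⟩, _, -, kb, -, -⟩
  exact k (h.eq_of_btw_of_btw kb
    (h.stem_btw_of_mem hQ (h.stem_mem hQ hb) (h.stem_ne hQ hb k))
    (h.stem_btw_of_mem hQ (h.stem_mem hQ hc) (h.stem_ne hQ hc k)))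

/-- No median outside `Q` is lost when the legs are cut back to the stems, since on the way from `a`
to any other point of the closure the stem of `a` comes first. -/
theorem medClosure_stem : medClosure D Q = Q ∪ medClosure D (stem D Q '' Q) := by
  apply Set.Subset.antisymm
  · intro x hx
    by_cases hxQ : x ∈ Q
    · exact Or.inl hxQ
    right
    have key : ∀ a ∈ Q, ∀ b ∈ Q, MBtw D a x b → MBtw D (stem D Q a) x (stem D Q b) := by
      intro a ha b hb k
      have ka := h.stem_btw_of_mem (a := a) hQ hx (fun e => hxQ (e ▸ ha))
      have kb := h.stem_btw_of_mem (a := b) hQ hx (fun e => hxQ (e ▸ hb))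
      exact h.btw_symm (h.btw_trans' kb (h.btw_symm (h.btw_trans' ka k)))
    obtain ⟨a, ha, b, hb, c, hc, k1, k2, k3⟩ := hx
    exact ⟨_, ⟨a, ha, rfl⟩, _, ⟨b, hb, rfl⟩, _, ⟨c, hc, rfl⟩, key a ha b hb k1,
      key a ha c hc k2, key b hb c hc k3⟩
  · exact Set.union_subset (h.subset_medClosure Q) (h.medClosure_image_stem_subset hQ)

theorem mem_medClosure_image_stem {x : V} (hx : x ∈ medClosure D Q)
    (k : x ∈ Q → stem D Q x = x) : x ∈ medClosure D (stem D Q '' Q) := by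
  rw [h.medClosure_stem hQ] at hx
  rcases hx with hx | hx
  · exact h.subset_medClosure _ ⟨x, hx, k hx⟩
  · exact hx

/-- The points that are dropped are leaves of the skeleton, joined only to their stems. They lie
between no two remaining points, so the other edges are unchanged. -/
theorem skel_stem {a b : V} : (skel D (medClosure D Q)).Adj a b ↔
    (skel D (medClosure D (stem D Q '' Q))).Adj a b ∨
      (a ∈ Q ∧ stem D Q a ≠ a ∧ b = stem D Q a) ∨ (b ∈ Q ∧ stem D Q b ≠ b ∧ a = stem D Q b) := by
  have aux : ∀ a b, a ∈ Q → stem D Q a ≠ a → (skel D (medClosure D Q)).Adj a b →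
      b = stem D Q a := by
    intro a b ha k hab
    obtain ⟨-, h2, h3, h4⟩ := h.skel_adj.1 hab
    rcases h4 _ (h.stem_mem hQ ha) (h.stem_btw_of_mem hQ h2 h3.symm) with e | e
    · exact absurd e k
    · exact e.symm
  have aux' : ∀ a, a ∈ Q → stem D Q a ≠ a → (skel D (medClosure D Q)).Adj a (stem D Q a) := by
    intro a ha k
    rw [h.skel_adj]
    refine ⟨h.subset_medClosure _ ha, h.stem_mem hQ ha, k.symm, fun x hx kx => ?_⟩
    by_cases hxa : x = a
    · exact Or.inl hxa
    · exact Or.inr (h.btw_antisymm kx (h.stem_btw_of_mem hQ hx hxa))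
  constructor
  · intro hab
    by_cases ka : a ∈ Q ∧ stem D Q a ≠ a
    · exact Or.inr (Or.inl ⟨ka.1, ka.2, aux a b ka.1 ka.2 hab⟩)
    by_cases kb : b ∈ Q ∧ stem D Q b ≠ b
    · exact Or.inr (Or.inr ⟨kb.1, kb.2, aux b a kb.1 kb.2 hab.symm⟩)
    obtain ⟨h1, h2, h3, h4⟩ := h.skel_adj.1 hab
    left
    rw [h.skel_adj]
    push Not at ka kb
    exact ⟨h.mem_medClosure_image_stem hQ h1 ka, h.mem_medClosure_image_stem hQ h2 kb, h3,
      fun c hc => h4 c (h.medClosure_image_stem_subset hQ hc)⟩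
  · rintro (hab | ⟨h1, h2, rfl⟩ | ⟨h1, h2, rfl⟩)
    · obtain ⟨h1, h2, h3, h4⟩ := h.skel_adj.1 hab
      rw [h.skel_adj]
      refine ⟨h.medClosure_image_stem_subset hQ h1, h.medClosure_image_stem_subset hQ h2, h3,
        fun c hc kc => ?_⟩
      by_cases k : c ∈ Q → stem D Q c = c
      · exact h4 c (h.mem_medClosure_image_stem hQ hc k) kc
      push Not at k
      have hn := h.notMem_of_stem_ne hQ k.2
      exact absurd (h.eq_of_btw_of_btw kc
        (h.stem_btw_of_mem hQ (h.medClosure_image_stem_subset hQ h1) fun e => hn (e ▸ h1))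
        (h.stem_btw_of_mem hQ (h.medClosure_image_stem_subset hQ h2) fun e => hn (e ▸ h2))) k.2
    · exact aux' a h1 h2
    · exact (aux' b h1 h2).symm

/-- Root the tree at a point `o` of `Q` and choose `a`, `b` with the deepest branching point `m`;
the maximized quantity is twice the distance from `o` to `m`. Any other point branches off from `a`
and from `b` no deeper than `m`, so `a` and `b` form a cherry at `m`. This makes every round shrink
the active set. -/
theorem exists_stem_eq [Finite V] (hne : Q.Nonempty) :
    ∃ a ∈ Q, ∃ b ∈ Q, a ≠ b ∧ stem D Q a = stem D Q b := by
  obtain ⟨o, ho⟩ := hne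
  obtain ⟨a₀, ha₀, h1, -⟩ := hQ o o
  obtain ⟨b₀, hb₀, h2, h3⟩ := hQ o a₀
  obtain ⟨⟨a, b⟩, ⟨ha, hb, hab, hao, hbo⟩, hmax⟩ := Set.exists_max_image
    {p : V × V | p.1 ∈ Q ∧ p.2 ∈ Q ∧ p.1 ≠ p.2 ∧ p.1 ≠ o ∧ p.2 ≠ o}
    (fun p => D o p.1 + D o p.2 - D p.1 p.2) (Set.toFinite _)
    ⟨(a₀, b₀), ha₀, hb₀, h3.symm, h1, h2⟩
  obtain ⟨m, hm⟩ := h.median o a b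
  have key : ∀ a b, IsMed D m o a b → ∀ c, D o a + D o c - D a c ≤ D o a + D o b - D a b →
      MBtw D a m c := by
    intro a b hm c hc
    obtain ⟨p, hp⟩ := h.median o a c
    have e1 := h.symm m a
    have e2 := h.symm p a
    have k : MBtw D o p m := by
      rcases h.btw_total hp.1 hm.1 with k | k
      · exact k
      · have : m = p := by
          apply h.eq_of_le_zero
          obtain ⟨k1, k2, k3⟩ := hm
          obtain ⟨l1, l2, l3⟩ := hp
          unfold MBtw at *
          linarith
        rw [this]; exact h.btw_right _ _
    exact h.btw_trans (h.btw_symm (h.btw_trans' k hm.1)) hp.2.2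
  refine ⟨a, ha, b, hb, hab, (h.stem_eq_iff hQ ha hb hab).2 ⟨m, ha, hb, hab, fun c hc hca hcb => ?_⟩⟩
  by_cases hco : c = o
  · subst hco
    exact h.med_rotate hm
  have s := h.symm a b
  have hm' : IsMed D m o b a := h.med_swap (h.med_rotate (h.med_rotate hm))
  refine ⟨hm.2.2, key a b hm c ?_, key b a hm' c ?_⟩
  · exact hmax (a, c) ⟨ha, hc, hca.symm, hao, hco⟩
  · have := hmax (b, c) ⟨hb, hc, hcb.symm, hbo, hco⟩
    simp only at this
    linarith

end IsTreeMetric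

end Stems

/-! ### One round of recursive grouping -/

section Rounds

variable {V N : Type*}

theorem pick_mem [Nonempty N] {s : Finset N} (hs : s.Nonempty) : pick s ∈ s :=
  Classical.epsilon_spec (p := fun a => a ∈ s) hs

/-- The members of `A` are placed in `V` by `φ`, and `d` gives the distances between them. -/
structure IsPlaced (D : V → V → ℝ) (A : Finset N) (d : N → N → ℝ) (φ : N → V) : Prop where
  metric : IsTreeMetric D
  inj : Set.InjOn φ A
  dist : ∀ a ∈ A, ∀ b ∈ A, a ≠ b → d a b = D (φ a) (φ b)
  card : 2 < A.card

namespace IsPlaced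

variable {D : V → V → ℝ} {A : Finset N} {d : N → N → ℝ} {φ : N → V} (h : IsPlaced D A d φ)
include h

theorem exists_ne (x y : V) : ∃ c ∈ φ '' A, c ≠ x ∧ c ≠ y := by
  have h1 : ({x, y} : Finset V).card < (A.image φ).card := by
    rw [Finset.card_image_of_injOn h.inj]
    exact lt_of_le_of_lt Finset.card_le_two h.card
  obtain ⟨c, hc, hn⟩ := Finset.exists_mem_notMem_of_card_lt_card h1
  simp only [Finset.mem_insert, Finset.mem_singleton, not_or] at hn
  exact ⟨c, by simpa using hc, hn⟩

theorem ne {a b : N} (ha : a ∈ A) (hb : b ∈ A) (hab : a ≠ b) : φ a ≠ φ b :=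
  fun e => hab (h.inj ha hb e)

/-- The test `Φ(a, b; c) = dist(a, b)` says that `b` lies between `a` and `c`. -/
theorem isChildOf_iff {a b : N} :
    IsChildOf A d a b ↔ a ∈ A ∧ b ∈ A ∧ Cherry D (φ '' A) (φ a) (φ b) (φ b) := by
  constructor
  · rintro ⟨ha, hb, hab, k⟩
    refine ⟨ha, hb, ⟨a, ha, rfl⟩, ⟨b, hb, rfl⟩, h.ne ha hb hab, ?_⟩
    rintro _ ⟨c, hc, rfl⟩ hca hcb
    have hca' : c ≠ a := fun e => hca (by rw [e])
    have hcb' : c ≠ b := fun e => hcb (by rw [e])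
    have := k c hc hca' hcb'
    unfold Phi at this
    rw [h.dist a ha c hc hca'.symm, h.dist b hb c hc hcb'.symm, h.dist a ha b hb hab] at this
    refine ⟨h.metric.btw_right _ _, ?_, h.metric.btw_left _ _⟩
    unfold MBtw
    linarith
  · rintro ⟨ha, hb, -, -, hab, k⟩
    have hab' : a ≠ b := fun e => hab (by rw [e])
    refine ⟨ha, hb, hab', fun c hc hca hcb => ?_⟩
    have := (k (φ c) ⟨c, hc, rfl⟩ (h.ne hc ha hca) (h.ne hc hb hcb)).2.1
    unfold Phi
    rw [h.dist a ha c hc hca.symm, h.dist b hb c hc hcb.symm, h.dist a ha b hb hab']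
    unfold MBtw at this
    linarith

/-- If `m` is the median of `a`, `b`, `c`, then `Φ(a, b; c)` is the distance from `a` to `m` minus
that from `b` to `m`. It therefore gives the position of `m` between `a` and `b`: the strict bounds
exclude the two ends, and constancy in `c` means that all `c` branch off at the same point. -/
theorem areSiblings_iff {a b : N} : AreSiblings A d a b ↔
    a ∈ A ∧ b ∈ A ∧ ∃ m, m ≠ φ a ∧ m ≠ φ b ∧ Cherry D (φ '' A) (φ a) (φ b) m := by
  have hD := h.metric
  have hs := hD.symm
  constructor
  · rintro ⟨ha, hb, hab, k⟩
    obtain ⟨_, ⟨c, hc, rfl⟩, hca, hcb⟩ := h.exists_ne (φ a) (φ b)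
    have hca' : c ≠ a := fun e => hca (by rw [e])
    have hcb' : c ≠ b := fun e => hcb (by rw [e])
    obtain ⟨m, hm⟩ := hD.median (φ a) (φ b) (φ c)
    have k1 := k c hc hca' hcb' c hc hca' hcb'
    unfold Phi at k1
    rw [h.dist a ha c hc hca'.symm, h.dist b hb c hc hcb'.symm, h.dist a ha b hb hab] at k1
    refine ⟨ha, hb, m, ?_, ?_, ⟨a, ha, rfl⟩, ⟨b, hb, rfl⟩, h.ne ha hb hab, ?_⟩
    · rintro rfl
      obtain ⟨m1, m2, m3⟩ := hm
      have := hs (φ a) (φ b)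
      unfold MBtw at *
      linarith
    · rintro rfl
      obtain ⟨m1, m2, m3⟩ := hm
      unfold MBtw at *
      linarith
    · rintro _ ⟨c', hc', rfl⟩ hca2 hcb2
      have hca3 : c' ≠ a := fun e => hca2 (by rw [e])
      have hcb3 : c' ≠ b := fun e => hcb2 (by rw [e])
      obtain ⟨m', hm'⟩ := hD.median (φ a) (φ b) (φ c')
      have k2 := (k c hc hca' hcb' c' hc' hca3 hcb3).2.1
      unfold Phi at k2
      rw [h.dist a ha c hc hca'.symm, h.dist b hb c hc hcb'.symm, h.dist a ha c' hc' hca3.symm,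
        h.dist b hb c' hc' hcb3.symm] at k2
      have e : m = m' := by
        obtain ⟨m1, m2, m3⟩ := hm
        obtain ⟨n1, n2, n3⟩ := hm'
        have e1 := hs m (φ b)
        have e2 := hs m' (φ b)
        have e3 := hs m m'
        apply hD.eq_of_le_zero
        rcases hD.btw_total m1 n1 with t | t
        all_goals
          unfold MBtw at *
          linarith
      rw [e]
      exact hm'
  · rintro ⟨ha, hb, m, hma, hmb, -, -, hab, k⟩
    have hab' : a ≠ b := fun e => hab (by rw [e])
    refine ⟨ha, hb, hab', fun c hc hca hcb c' hc' hca' hcb' => ?_⟩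
    obtain ⟨m1, m2, m3⟩ := k (φ c) ⟨c, hc, rfl⟩ (h.ne hc ha hca) (h.ne hc hb hcb)
    obtain ⟨n1, n2, n3⟩ := k (φ c') ⟨c', hc', rfl⟩ (h.ne hc' ha hca') (h.ne hc' hb hcb')
    unfold Phi
    rw [h.dist a ha c hc hca.symm, h.dist b hb c hc hcb.symm, h.dist a ha c' hc' hca'.symm,
      h.dist b hb c' hc' hcb'.symm, h.dist a ha b hb hab']
    have := hD.pos _ _ hma
    have := hD.pos _ _ hmb
    have := hs m (φ a)
    have := hs m (φ b)
    unfold MBtw at *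
    refine ⟨by linarith, by linarith, by linarith⟩

/-- The relations that define a family are the possible positions of the common branching point of
`a` and `b`: at `b`, at `a`, or strictly between them. -/
theorem mem_family_iff {a b : N} (ha : a ∈ A) : b ∈ family A d a ↔
    b ∈ A ∧ stem D (φ '' A) (φ b) = stem D (φ '' A) (φ a) := by
  unfold family
  rw [Finset.mem_filter]
  apply and_congr_right
  intro hb
  by_cases hab : b = a
  · simp [hab]
  have hne := h.ne ha hb (Ne.symm hab)
  rw [eq_comm (b := stem D (φ '' A) (φ a)),
    h.metric.stem_eq_iff h.exists_ne ⟨a, ha, rfl⟩ ⟨b, hb, rfl⟩ hne, h.isChildOf_iff,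
    h.isChildOf_iff, h.areSiblings_iff]
  constructor
  · rintro (k | ⟨-, -, k⟩ | ⟨-, -, k⟩ | ⟨-, -, m, -, -, k⟩)
    · exact absurd k hab
    · exact ⟨_, k⟩
    · exact ⟨_, h.metric.cherry_symm k⟩
    · exact ⟨m, k⟩
  · rintro ⟨m, k⟩
    by_cases h1 : m = φ b
    · exact Or.inr (Or.inl ⟨ha, hb, h1 ▸ k⟩)
    by_cases h2 : m = φ a
    · exact Or.inr (Or.inr (Or.inl ⟨hb, ha, h.metric.cherry_symm (h2 ▸ k)⟩))
    · exact Or.inr (Or.inr (Or.inr ⟨ha, hb, m, h2, h1, k⟩))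

theorem self_mem_family {a : N} (ha : a ∈ A) : a ∈ family A d a :=
  (h.mem_family_iff ha).2 ⟨ha, rfl⟩

theorem family_eq {a b : N} (ha : a ∈ A) (hb : b ∈ A)
    (k : stem D (φ '' A) (φ a) = stem D (φ '' A) (φ b)) : family A d a = family A d b := by
  ext c
  rw [h.mem_family_iff ha, h.mem_family_iff hb, k]

/-- The bound on the cardinality is needed because the only member of a family is its own stem
without being anybody's parent. -/
theorem isParentIn_iff {a u : N} (ha : a ∈ A) : IsParentIn A d (family A d a) u ↔
    u ∈ A ∧ φ u = stem D (φ '' A) (φ a) ∧ 2 ≤ (family A d a).card := by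
  unfold IsParentIn
  rw [h.mem_family_iff ha]
  constructor
  · rintro ⟨⟨hu, e⟩, b, hb, k⟩
    have hbu := k.2.2.1
    rw [h.isChildOf_iff] at k
    have := h.metric.stem_eq h.exists_ne (h.metric.cherry_symm k.2.2)
    refine ⟨hu, by rw [← e, this], ?_⟩
    exact Finset.one_lt_card.2 ⟨b, hb, u, (h.mem_family_iff ha).2 ⟨hu, e⟩, hbu⟩
  · rintro ⟨hu, e, hcard⟩
    have hs : stem D (φ '' A) (φ u) = φ u := by
      by_contra hne
      exact h.metric.stem_ne h.exists_ne ⟨a, ha, rfl⟩ hne e.symm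
    refine ⟨⟨hu, by rw [hs, e]⟩, ?_⟩
    obtain ⟨b, hb, hbu⟩ := Finset.exists_mem_ne hcard u
    refine ⟨b, hb, ?_⟩
    rw [h.isChildOf_iff]
    rw [h.mem_family_iff ha] at hb
    refine ⟨hb.1, hu, ?_⟩
    have := h.metric.cherry_of_stem_eq h.exists_ne ⟨b, hb.1, rfl⟩ ⟨u, hu, rfl⟩
      (h.ne hb.1 hu hbu) (by rw [hb.2, hs, e])
    rwa [hb.2, ← e] at this

variable [Nonempty N]

theorem rep_mem {a : N} (ha : a ∈ A) : rep A d (family A d a) ∈ family A d a := by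
  unfold rep
  split_ifs with k
  · exact (Classical.epsilon_spec k).1
  · exact pick_mem ⟨a, h.self_mem_family ha⟩

theorem rep_mem' {a : N} (ha : a ∈ A) : rep A d (family A d a) ∈ A :=
  ((h.mem_family_iff ha).1 (h.rep_mem ha)).1

theorem stem_rep {a : N} (ha : a ∈ A) :
    stem D (φ '' A) (φ (rep A d (family A d a))) = stem D (φ '' A) (φ a) :=
  ((h.mem_family_iff ha).1 (h.rep_mem ha)).2

theorem map_rep {a : N} (ha : a ∈ A) (k : ¬ NeedsHidden A d (family A d a)) :
    φ (rep A d (family A d a)) = stem D (φ '' A) (φ a) := by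
  by_cases hp : ∃ u, IsParentIn A d (family A d a) u
  · unfold rep
    rw [if_pos hp]
    exact ((h.isParentIn_iff ha).1 (Classical.epsilon_spec hp)).2.1
  · have hcard : (family A d a).card < 2 := by
      by_contra hc
      exact k ⟨not_lt.1 hc, hp⟩
    have h1 : rep A d (family A d a) = a := by
      by_contra hne
      exact absurd (Finset.one_lt_card.2 ⟨_, h.rep_mem ha, a, h.self_mem_family ha, hne⟩)
        (not_lt.2 (Nat.le_of_lt_succ hcard))
    rw [h1]
    by_contra hne
    obtain ⟨_, kb⟩ := IsTreeMetric.exists_cherry_of_stem_ne (Ne.symm hne)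
    obtain ⟨b, hb, rfl⟩ := kb.2.1
    have hba : b ≠ a := fun e => kb.2.2.1 (by rw [e])
    have hbf : b ∈ family A d a := (h.mem_family_iff ha).2 ⟨hb,
      h.metric.stem_eq h.exists_ne (h.metric.cherry_symm kb)⟩
    exact absurd (Finset.one_lt_card.2 ⟨_, hbf, a, h.self_mem_family ha, hba⟩)
        (not_lt.2 (Nat.le_of_lt_succ hcard))

/-- Half of `d a j + d a k - d j k` is the distance from `a` to the median of `a`, `j`, `k`, and for
a sibling `j` this median is the stem, whichever `k` has been picked. -/
theorem distToHead_self {a : N} (ha : a ∈ A) :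
    distToHead A d (family A d a) a = D (φ a) (stem D (φ '' A) (φ a)) := by
  have hD := h.metric
  unfold distToHead
  split_ifs with k e
  · obtain ⟨hcard, -⟩ := k
    have hj : pick ((family A d a).erase a) ∈ (family A d a).erase a := by
      apply pick_mem
      rw [← Finset.card_pos, Finset.card_erase_of_mem (h.self_mem_family ha)]
      omega
    generalize pick ((family A d a).erase a) = j at hj ⊢
    rw [Finset.mem_erase, h.mem_family_iff ha] at hj
    obtain ⟨hja, hj, hs⟩ := hj
    have hk : pick ((A.erase a).erase j) ∈ (A.erase a).erase j := by
      apply pick_mem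
      rw [← Finset.card_pos, Finset.card_erase_of_mem (Finset.mem_erase.2 ⟨hja, hj⟩),
        Finset.card_erase_of_mem ha]
      have := h.card
      omega
    generalize pick ((A.erase a).erase j) = k at hk ⊢
    simp only [Finset.mem_erase] at hk
    obtain ⟨hkj, hka, hk⟩ := hk
    obtain ⟨m1, m2, m3⟩ := (hD.cherry_of_stem_eq h.exists_ne ⟨a, ha, rfl⟩ ⟨j, hj, rfl⟩
      (h.ne ha hj hja.symm) hs.symm).2.2.2 (φ k) ⟨k, hk, rfl⟩ (h.ne hk ha hka) (h.ne hk hj hkj)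
    unfold Phi
    rw [h.dist a ha j hj hja.symm, h.dist a ha k hk hka.symm, h.dist j hj k hk hkj.symm]
    have := hD.symm (φ j) (stem D (φ '' A) (φ a))
    unfold MBtw at *
    linarith
  · have := h.map_rep ha k
    rw [← e] at this
    rw [← this, hD.self]
  · rw [h.dist a ha _ (h.rep_mem' ha) e, h.map_rep ha k]

end IsPlaced

/-- The placement after one round: a new hidden node is placed where its children are attached. -/
noncomputable def placeHidden (fresh : N → N) (D : V → V → ℝ) (A : Finset N) (φ : N → V) (p : N) :
    V :=
  if h : ∃ a ∈ A, fresh a = p then stem D (φ '' A) (φ h.choose) else φ p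

namespace IsPlaced

variable {D : V → V → ℝ} {A : Finset N} {d : N → N → ℝ} {φ : N → V} (h : IsPlaced D A d φ)
  {fresh : N → N} (hf : Function.Injective fresh) (hA : ∀ a ∈ A, fresh a ∉ A)

omit h in
include hf in
theorem placeHidden_fresh {a : N} (ha : a ∈ A) :
    placeHidden fresh D A φ (fresh a) = stem D (φ '' A) (φ a) := by
  have hex : ∃ b ∈ A, fresh b = fresh a := ⟨a, ha, rfl⟩
  unfold placeHidden
  rw [dif_pos hex, hf hex.choose_spec.2]

omit h in
theorem placeHidden_of_forall {p : N} (hp : ∀ a ∈ A, fresh a ≠ p) :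
    placeHidden fresh D A φ p = φ p := by
  unfold placeHidden
  rw [dif_neg]
  rintro ⟨a, ha, e⟩
  exact hp a ha e

variable [Nonempty N]

include h hf hA

theorem placeHidden_head {a : N} (ha : a ∈ A) :
    placeHidden fresh D A φ (head fresh A d (family A d a)) = stem D (φ '' A) (φ a) := by
  unfold head
  split_ifs with k
  · rw [placeHidden_fresh hf (h.rep_mem' ha), h.stem_rep ha]
  · rw [placeHidden_of_forall, h.map_rep ha k]
    intro b hb e
    exact hA b hb (e ▸ h.rep_mem' ha)

theorem head_eq_iff {a b : N} (ha : a ∈ A) (hb : b ∈ A) :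
    head fresh A d (family A d a) = head fresh A d (family A d b) ↔
      stem D (φ '' A) (φ a) = stem D (φ '' A) (φ b) := by
  constructor
  · intro e
    rw [← h.placeHidden_head hf hA ha, ← h.placeHidden_head hf hA hb, e]
  · intro e
    rw [h.family_eq ha hb e]

theorem familyOfHead_head {a : N} (ha : a ∈ A) :
    familyOfHead fresh A d (head fresh A d (family A d a)) = family A d a := by
  unfold familyOfHead
  have hp := pick_mem (s := A.filter fun b =>
    head fresh A d (family A d b) = head fresh A d (family A d a)) ⟨a, by simp [ha]⟩
  generalize pick (A.filter fun b =>
    head fresh A d (family A d b) = head fresh A d (family A d a)) = b at hp ⊢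
  rw [Finset.mem_filter] at hp
  exact h.family_eq hp.1 ha ((h.head_eq_iff hf hA hp.1 ha).1 hp.2)

end IsPlaced

end Rounds

/-! ### Correctness of recursive grouping -/

section Correctness

variable {V N : Type*} [Nonempty N]

/-- The invariant of recursive grouping: the part of the tree over `R` that has been built and the
tree over the active nodes make up the tree over `R`. -/
structure RGInvariant (D : V → V → ℝ) (R : Set V) (fresh : N → N) (φ : N → V) (s : RGState N) :
    Prop where
  nonempty : s.active.Nonempty
  sub : s.active ⊆ s.tree.verts
  inj : Set.InjOn φ s.tree.verts
  unused : ∀ r, fresh r ∈ s.tree.verts → r ∈ s.tree.verts ∧ r ∉ s.active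
  dist : ∀ a ∈ s.active, ∀ b ∈ s.active, a ≠ b → s.dist a b = D (φ a) (φ b)
  cover : R = φ '' s.tree.verts ∪ medClosure D (φ '' s.active)
  inter : ∀ w ∈ s.tree.verts, φ w ∈ medClosure D (φ '' s.active) → w ∈ s.active
  supp : ∀ a b, s.tree.graph.Adj a b → a ∈ s.tree.verts ∧ b ∈ s.tree.verts
  adj : ∀ a b, (skel D R).Adj a b ↔
    (∃ a' b', s.tree.graph.Adj a' b' ∧ φ a' = a ∧ φ b' = b) ∨
      (skel D (medClosure D (φ '' s.active))).Adj a b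
  len : ∀ a b, s.tree.graph.Adj a b → s.len a b = D (φ a) (φ b)

namespace RGInvariant

variable {D : V → V → ℝ} (hD : IsTreeMetric D) {R : Set V} {fresh : N → N}
  (hf : Function.Injective fresh) {φ : N → V} {s : RGState N}

include hD hf

/-- On the side of `V` the round replaces the active points by their stems. The cover, the edges and
the distances of the invariant come from `medClosure_stem`, `skel_stem` and `dist_stem`, and the
decrease from `exists_stem_eq`. The placement changes only at names that are not yet in use. -/
theorem round [Finite V] (h : RGInvariant D R fresh φ s) (hcard : 2 < s.active.card) :
    ∃ φ', Set.EqOn φ' φ s.tree.verts ∧ RGInvariant D R fresh φ' (rgRound fresh s) ∧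
      s.tree.verts ⊆ (rgRound fresh s).tree.verts ∧
      (∀ p ∈ (rgRound fresh s).tree.verts, p ∈ s.tree.verts ∨ ∃ r, p = fresh r) ∧
      (rgRound fresh s).active.card < s.active.card := by
  have hp : IsPlaced D s.active s.dist φ :=
    ⟨hD, h.inj.mono (Finset.coe_subset.2 h.sub), h.dist, hcard⟩
  have hA : ∀ a ∈ s.active, fresh a ∉ s.tree.verts := fun a ha k => (h.unused a k).2 ha
  have hA' : ∀ a ∈ s.active, fresh a ∉ s.active := fun a ha k => hA a ha (h.sub k)
  obtain ⟨A, d, ⟨W, G⟩, len⟩ := s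
  simp only at hp hA hA' hcard
  have hsub : A ⊆ W := h.sub
  have hQ := hp.exists_ne
  have hne : (φ '' (A : Set N)).Nonempty := by
    obtain ⟨a, ha⟩ := h.nonempty
    exact ⟨φ a, a, ha, rfl⟩
  set hd : N → N := fun a => head fresh A d (family A d a) with hhd
  set φ' := placeHidden fresh D A φ with hφ'
  have hφhd : ∀ a ∈ A, φ' (hd a) = stem D (φ '' A) (φ a) := fun a ha =>
    hp.placeHidden_head hf hA' ha
  have hφW : ∀ p ∈ W, φ' p = φ p := fun p hpW =>
    IsPlaced.placeHidden_of_forall fun a ha e => hA a ha (e ▸ hpW)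
  have hhdW : ∀ a ∈ A, hd a ∈ W → hd a ∈ A := by
    intro a ha hW
    apply h.inter _ hW
    rw [← hφW _ hW, hφhd a ha]
    exact hD.stem_mem hQ ⟨a, ha, rfl⟩
  have hhd_cases : ∀ a ∈ A, hd a ∈ A ∨ ∃ r ∈ A, hd a = fresh r ∧
      NeedsHidden A d (family A d a) ∧ r = rep A d (family A d a) := by
    intro a ha
    by_cases k : NeedsHidden A d (family A d a)
    · exact Or.inr ⟨_, hp.rep_mem' ha, by simp only [hhd, head, if_pos k], k, rfl⟩
    · left
      simp only [hhd, head, if_neg k]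
      exact hp.rep_mem' ha
  -- the chosen child of a new hidden node is not active in the next round
  have hrep_out : ∀ a ∈ A, NeedsHidden A d (family A d a) → ∀ b ∈ A,
      hd b ≠ rep A d (family A d a) := by
    intro a ha k b hb e
    have hr := hp.rep_mem' ha
    have k' : ¬ NeedsHidden A d (family A d b) := by
      intro k'
      simp only [hhd, head, if_pos k'] at e
      exact hA' _ (hp.rep_mem' hb) (e ▸ hr)
    have e2 : rep A d (family A d b) = rep A d (family A d a) := by
      simpa only [hhd, head, if_neg k'] using e
    have e3 : stem D (φ '' A) (φ b) = stem D (φ '' A) (φ a) := by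
      rw [← hp.stem_rep hb, e2, hp.stem_rep ha]
    rw [hp.family_eq hb ha e3] at k'
    exact k' k
  have himg : φ' '' (A.image hd : Finset N) = stem D (φ '' A) '' (φ '' A) := by
    ext v
    simp only [Finset.coe_image, Set.mem_image, Finset.mem_coe]
    constructor
    · rintro ⟨_, ⟨a, ha, rfl⟩, rfl⟩
      exact ⟨φ a, ⟨a, ha, rfl⟩, (hφhd a ha).symm⟩
    · rintro ⟨_, ⟨a, ha, rfl⟩, rfl⟩
      exact ⟨hd a, ⟨a, ha, rfl⟩, hφhd a ha⟩
  have hfam : ∀ a ∈ A, familyOfHead fresh A d (hd a) = family A d a := fun a ha =>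
    hp.familyOfHead_head hf hA' ha
  have hdth : ∀ a ∈ A, distToHead A d (family A d a) a = D (φ a) (stem D (φ '' A) (φ a)) :=
    fun a ha => hp.distToHead_self ha
  have hround : rgRound fresh ⟨A, d, ⟨W, G⟩, len⟩ =
      { active := A.image hd
        dist := fun q q' =>
          d (rep A d (familyOfHead fresh A d q)) (rep A d (familyOfHead fresh A d q'))
            - distToHead A d (familyOfHead fresh A d q) (rep A d (familyOfHead fresh A d q))
            - distToHead A d (familyOfHead fresh A d q') (rep A d (familyOfHead fresh A d q'))
        tree :=
          { verts := W ∪ A.image hd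
            graph := G ⊔ SimpleGraph.fromRel fun a q => a ∈ A ∧ q = hd a }
        len := fun a b =>
          if a ∈ A ∧ b = hd a then distToHead A d (family A d a) a
          else if b ∈ A ∧ a = hd b then distToHead A d (family A d b) b
          else len a b } := by
    unfold rgRound
    rw [if_neg (by simpa using hcard)]
  rw [hround]
  -- An old node at the place of a head is active and its own stem. It is thus the parent or the
  -- only member of its family, so the head is this node itself and no new name.
  have hinj : ∀ x ∈ W ∪ A.image hd, ∀ y ∈ A.image hd, φ' x = φ' y → x = y := by
    intro x hx y hy e
    obtain ⟨b, hb, rfl⟩ := Finset.mem_image.1 hy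
    rcases Finset.mem_union.1 hx with hx | hx
    · have hxA : x ∈ A := by
        apply h.inter x hx
        rw [← hφW x hx, e, hφhd b hb]
        exact hD.stem_mem hQ ⟨b, hb, rfl⟩
      rw [hφW x hx, hφhd b hb] at e
      have h1 : stem D (φ '' A) (φ x) = φ x := by
        by_contra hne
        exact hD.stem_ne hQ ⟨b, hb, rfl⟩ hne e.symm
      have h2 : hd x = hd b := (hp.head_eq_iff hf hA' hxA hb).2 (by rw [h1, e])
      rw [← h2]
      have k : ¬ NeedsHidden A d (family A d x) := by
        rintro ⟨k1, k2⟩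
        exact k2 ⟨x, (hp.isParentIn_iff hxA).2 ⟨hxA, h1.symm, k1⟩⟩
      have h3 := hp.map_rep hxA k
      rw [h1] at h3
      simp only [hhd, head, if_neg k]
      exact (hp.inj (hp.rep_mem' hxA) hxA h3).symm
    · obtain ⟨a, ha, rfl⟩ := Finset.mem_image.1 hx
      rw [hφhd a ha, hφhd b hb] at e
      exact (hp.head_eq_iff hf hA' ha hb).2 e
  refine ⟨φ', hφW, ?_, Finset.subset_union_left, ?_, ?_⟩
  · constructor
    · exact h.nonempty.image _
    · exact Finset.subset_union_right
    · intro x hx y hy e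
      simp only [Finset.mem_coe] at hx hy
      by_cases hy' : y ∈ A.image hd
      · exact hinj x hx y hy' e
      by_cases hx' : x ∈ A.image hd
      · exact (hinj y hy x hx' e.symm).symm
      have hxW := (Finset.mem_union.1 hx).resolve_right hx'
      have hyW := (Finset.mem_union.1 hy).resolve_right hy'
      rw [hφW x hxW, hφW y hyW] at e
      exact h.inj hxW hyW e
    · intro r hr
      simp only [Finset.mem_union, Finset.mem_image] at hr ⊢
      -- A representative whose name has been used for a hidden node never becomes active again, so
      -- no name is given twice.
      have hold : fresh r ∈ W → (r ∈ W ∨ ∃ a ∈ A, hd a = r) ∧ ¬ ∃ a ∈ A, hd a = r := by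
        intro k
        obtain ⟨k1, k2⟩ := h.unused r k
        exact ⟨Or.inl k1, fun ⟨a, ha, e⟩ => k2 (e ▸ hhdW a ha (e ▸ k1))⟩
      rcases hr with hr | ⟨a, ha, e⟩
      · exact hold hr
      · rcases hhd_cases a ha with k | ⟨r', hr', k, kn, kr⟩
        · exact hold (hsub (e ▸ k))
        · obtain rfl : r = r' := hf (e.symm.trans k)
          exact ⟨Or.inl (hsub hr'), fun ⟨b, hb, e'⟩ => hrep_out a ha kn b hb (e'.trans kr)⟩
    · intro q hq q' hq' hne
      obtain ⟨a, ha, rfl⟩ := Finset.mem_image.1 hq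
      obtain ⟨b, hb, rfl⟩ := Finset.mem_image.1 hq'
      simp only
      rw [hfam a ha, hfam b hb]
      have hne' : stem D (φ '' A) (φ a) ≠ stem D (φ '' A) (φ b) := fun e =>
        hne ((hp.head_eq_iff hf hA' ha hb).2 e)
      have hra := hp.rep_mem' ha
      have hrb := hp.rep_mem' hb
      have sa := hp.stem_rep ha
      have sb := hp.stem_rep hb
      have ea := hdth _ hra
      have eb := hdth _ hrb
      rw [hp.family_eq hra ha sa] at ea
      rw [hp.family_eq hrb hb sb] at eb
      rw [ea, eb, hφhd a ha, hφhd b hb, hp.dist _ hra _ hrb (by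
        intro e
        rw [e, sb] at sa
        exact hne' sa.symm)]
      have := hD.dist_stem hQ ⟨_, hra, rfl⟩ ⟨_, hrb, rfl⟩ (by rw [sa, sb]; exact hne')
      rw [this, sa, sb]
      ring
    · simp only
      rw [himg, h.cover, hD.medClosure_stem hQ, Finset.coe_union, Set.image_union, himg,
        Set.image_congr hφW, ← Set.union_assoc]
      ext v
      simp only [Set.mem_union]
      constructor
      · rintro ((k | ⟨a, ha, rfl⟩) | k)
        · exact Or.inl (Or.inl k)
        · exact Or.inl (Or.inl ⟨a, hsub ha, rfl⟩)
        · exact Or.inr k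
      · rintro ((k | k) | k)
        · exact Or.inl (Or.inl k)
        · exact Or.inr (hD.subset_medClosure _ k)
        · exact Or.inr k
    · simp only
      intro w hw k
      rw [himg] at k
      rcases Finset.mem_union.1 hw with hw | hw
      · rw [hφW w hw] at k
        have hwA : w ∈ A := h.inter w hw (hD.medClosure_image_stem_subset hQ k)
        have e : stem D (φ '' A) (φ w) = φ w := by
          by_contra hne
          exact hD.notMem_of_stem_ne hQ hne k
        have : w = hd w := hinj w (Finset.mem_union_left _ hw) _
          (Finset.mem_image_of_mem _ hwA) (by rw [hφW w hw, hφhd w hwA, e])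
        rw [this]
        exact Finset.mem_image_of_mem _ hwA
      · exact hw
    · intro a b hab
      simp only [SimpleGraph.sup_adj, SimpleGraph.fromRel_adj] at hab
      simp only [Finset.mem_union]
      rcases hab with hab | ⟨-, ⟨ha, rfl⟩ | ⟨hb, rfl⟩⟩
      · exact ⟨Or.inl (h.supp _ _ hab).1, Or.inl (h.supp _ _ hab).2⟩
      · exact ⟨Or.inl (hsub ha), Or.inr (Finset.mem_image_of_mem _ ha)⟩
      · exact ⟨Or.inr (Finset.mem_image_of_mem _ hb), Or.inl (hsub hb)⟩
    · intro a b
      simp only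
      rw [himg, h.adj, hD.skel_stem hQ]
      have hnew : ∀ x ∈ A, stem D (φ '' A) (φ x) ≠ φ x → x ≠ hd x := by
        intro x hx hne e
        apply hne
        rw [← hφhd x hx, ← e, hφW x (hsub hx)]
      constructor
      · rintro (⟨x, y, hxy, rfl, rfl⟩ | hab | ⟨⟨x, hx, rfl⟩, hne, rfl⟩ | ⟨⟨x, hx, rfl⟩, hne, rfl⟩)
        · exact Or.inl ⟨x, y, Or.inl hxy, hφW x (h.supp _ _ hxy).1, hφW y (h.supp _ _ hxy).2⟩
        · exact Or.inr hab
        · exact Or.inl ⟨x, hd x, Or.inr ⟨hnew x hx hne, Or.inl ⟨hx, rfl⟩⟩, hφW x (hsub hx), hφhd x hx⟩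
        · exact Or.inl ⟨hd x, x, Or.inr ⟨(hnew x hx hne).symm, Or.inr ⟨hx, rfl⟩⟩, hφhd x hx, hφW x (hsub hx)⟩
      · rintro (⟨x, y, hxy, rfl, rfl⟩ | hab)
        · simp only [SimpleGraph.sup_adj, SimpleGraph.fromRel_adj] at hxy
          rcases hxy with hxy | ⟨hne, ⟨hx, rfl⟩ | ⟨hy, rfl⟩⟩
          · exact Or.inl ⟨x, y, hxy, (hφW x (h.supp _ _ hxy).1).symm,
              (hφW y (h.supp _ _ hxy).2).symm⟩
          · refine Or.inr (Or.inr (Or.inl ?_))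
            rw [hφW x (hsub hx), hφhd x hx]
            refine ⟨⟨x, hx, rfl⟩, fun e => hne ?_, rfl⟩
            exact hinj x (Finset.mem_union_left _ (hsub hx)) _ (Finset.mem_image_of_mem _ hx)
              (by rw [hφW x (hsub hx), hφhd x hx, e])
          · refine Or.inr (Or.inr (Or.inr ?_))
            rw [hφW y (hsub hy), hφhd y hy]
            refine ⟨⟨y, hy, rfl⟩, fun e => hne ?_, rfl⟩
            exact (hinj y (Finset.mem_union_left _ (hsub hy)) _ (Finset.mem_image_of_mem _ hy)
              (by rw [hφW y (hsub hy), hφhd y hy, e])).symm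
        · exact Or.inr (Or.inl hab)
    · intro a b hab
      simp only [SimpleGraph.sup_adj, SimpleGraph.fromRel_adj] at hab
      simp only
      split_ifs with k1 k2
      · obtain ⟨ha, rfl⟩ := k1
        rw [hdth a ha, hφhd a ha, hφW a (hsub ha)]
      · obtain ⟨hb, rfl⟩ := k2
        rw [hdth b hb, hφhd b hb, hφW b (hsub hb), hD.symm]
      · rcases hab with hab | ⟨-, k | k⟩
        · rw [hφW a (h.supp _ _ hab).1, hφW b (h.supp _ _ hab).2]
          exact h.len a b hab
        · exact absurd k k1
        · exact absurd k k2
  · intro p hpm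
    rcases Finset.mem_union.1 hpm with hpm | hpm
    · exact Or.inl hpm
    · obtain ⟨a, ha, rfl⟩ := Finset.mem_image.1 hpm
      rcases hhd_cases a ha with k | ⟨r, -, k, -⟩
      · exact Or.inl (hsub k)
      · exact Or.inr ⟨r, k⟩
  · simp only
    obtain ⟨_, ⟨a, ha, rfl⟩, _, ⟨b, hb, rfl⟩, hab, e⟩ := hD.exists_stem_eq hQ hne
    refine lt_of_le_of_ne Finset.card_image_le fun hc => ?_
    rw [Finset.card_image_iff] at hc
    apply hab
    rw [hc ha hb ((hp.head_eq_iff hf hA' ha hb).2 e)]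

end RGInvariant

end Correctness

/-! ### A complete run of recursive grouping -/

section Correctness

variable {V N : Type*} [Nonempty N]

omit [Nonempty N] in
theorem card_le_two_cases {A : Finset N} (h : A.card ≤ 2) {a b c : N} (ha : a ∈ A) (hb : b ∈ A)
    (hc : c ∈ A) : a = b ∨ a = c ∨ b = c := by
  by_contra hn
  push Not at hn
  exact absurd (Finset.two_lt_card_iff.2 ⟨a, b, c, ha, hb, hc, hn⟩) (not_lt.2 h)

omit [Nonempty N] in
theorem IsTreeMetric.medClosure_image_of_card_le_two {D : V → V → ℝ} (hD : IsTreeMetric D)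
    {A : Finset N} (h : A.card ≤ 2) (φ : N → V) :
    medClosure D (φ '' A) = φ '' A := by
  apply Set.Subset.antisymm _ (hD.subset_medClosure _)
  rintro m ⟨_, ⟨a, ha, rfl⟩, _, ⟨b, hb, rfl⟩, _, ⟨c, hc, rfl⟩, k1, k2, k3⟩
  rcases card_le_two_cases h ha hb hc with rfl | rfl | rfl
  · exact hD.btw_self k1 ▸ ⟨a, ha, rfl⟩
  · exact hD.btw_self k2 ▸ ⟨a, ha, rfl⟩
  · exact hD.btw_self k3 ▸ ⟨b, hb, rfl⟩

/-- Recursive grouping on a set of nodes with the distances of a tree metric returns the tree over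
the median closure of this set, with its edge lengths. -/
theorem recursiveGrouping_spec [Finite V] {D : V → V → ℝ} (hD : IsTreeMetric D) {fresh : N → N}
    (hf : Function.Injective fresh) {φ₀ : N → V} {Ω : Finset N} {d : N → N → ℝ}
    (hne : Ω.Nonempty) (hinj : Set.InjOn φ₀ Ω)
    (hd : ∀ a ∈ Ω, ∀ b ∈ Ω, a ≠ b → d a b = D (φ₀ a) (φ₀ b)) (hΩ : ∀ r, fresh r ∉ Ω) :
    ∃ φ, Set.EqOn φ φ₀ Ω ∧
      Models φ (recursiveGrouping fresh Ω d).tree (medClosure D (φ₀ '' Ω))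
        (skel D (medClosure D (φ₀ '' Ω))) ∧
      Ω ⊆ (recursiveGrouping fresh Ω d).tree.verts ∧
      (∀ p ∈ (recursiveGrouping fresh Ω d).tree.verts, p ∈ Ω ∨ ∃ r, p = fresh r) ∧
      ∀ a b, (recursiveGrouping fresh Ω d).tree.graph.Adj a b →
        (recursiveGrouping fresh Ω d).len a b = D (φ a) (φ b) := by
  set R := medClosure D (φ₀ '' Ω) with hR
  set s₀ : RGState N :=
    { active := Ω, dist := d, tree := { verts := Ω, graph := ⊥ }, len := fun _ _ => 0 } with hs₀
  -- After `n` rounds either at most two nodes are active, and rounds have no effect any more, or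
  -- every round has removed a node. As the active set stays nonempty, `Ω.card` rounds lead to the
  -- first case.
  have hiter : ∀ n, ∃ φ, Set.EqOn φ φ₀ Ω ∧ RGInvariant D R fresh φ ((rgRound fresh)^[n] s₀) ∧
      Ω ⊆ ((rgRound fresh)^[n] s₀).tree.verts ∧
      (∀ p ∈ ((rgRound fresh)^[n] s₀).tree.verts, p ∈ Ω ∨ ∃ r, p = fresh r) ∧
      (((rgRound fresh)^[n] s₀).active.card ≤ 2 ∨
        ((rgRound fresh)^[n] s₀).active.card + n ≤ Ω.card) := by
    intro n
    induction n with
    | zero =>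
      refine ⟨φ₀, fun _ _ => rfl, ?_, subset_rfl, fun p hp => Or.inl hp, Or.inr le_rfl⟩
      exact
        { nonempty := hne
          sub := subset_rfl
          inj := hinj
          unused := fun r hr => absurd hr (hΩ r)
          dist := hd
          cover := (Set.union_eq_right.2 (hD.subset_medClosure _)).symm
          inter := fun w hw _ => hw
          supp := fun a b hab => absurd hab (by simp [s₀])
          adj := fun a b => by simp [s₀, hR]
          len := fun a b hab => absurd hab (by simp [s₀]) }
    | succ n ih =>
      obtain ⟨φ, h1, h2, h3, h4, h5⟩ := ih
      rw [Function.iterate_succ_apply']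
      generalize (rgRound fresh)^[n] s₀ = s at h2 h3 h4 h5 ⊢
      by_cases hcard : s.active.card ≤ 2
      · have : rgRound fresh s = s := if_pos hcard
        rw [this]
        exact ⟨φ, h1, h2, h3, h4, Or.inl hcard⟩
      · obtain ⟨φ', k1, k2, k3, k4, k5⟩ := h2.round hD hf (not_le.1 hcard)
        refine ⟨φ', fun x hx => (k1 (h3 hx)).trans (h1 hx), k2, h3.trans k3, fun p hp => ?_, ?_⟩
        · rcases k4 p hp with k | k
          · exact h4 p k
          · exact Or.inr k
        · right
          have := h5.resolve_left hcard
          omega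
  obtain ⟨φ, h1, h2, h3, h4, h5⟩ := hiter Ω.card
  have hcard : ((rgRound fresh)^[Ω.card] s₀).active.card ≤ 2 := by
    rcases h5 with h5 | h5
    · exact h5
    · have := Finset.card_pos.2 h2.nonempty
      omega
  unfold recursiveGrouping
  rw [← hs₀]
  generalize (rgRound fresh)^[Ω.card] s₀ = s at h2 h3 h4 hcard ⊢
  -- Two points have no medians but themselves, so the built nodes already cover `R`, and only the
  -- edge between the last two active nodes can be missing.
  have hmc := hD.medClosure_image_of_card_le_two hcard φ
  have hRv : R = φ '' s.tree.verts := by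
    rw [h2.cover, hmc]
    exact Set.union_eq_left.2 (Set.image_mono (Finset.coe_subset.2 h2.sub))
  have hfin : rgFinish s =
      { s with
        tree :=
          { verts := s.tree.verts
            graph := s.tree.graph ⊔ SimpleGraph.fromRel fun a b => a ∈ s.active ∧ b ∈ s.active }
        len := fun a b => if a ∈ s.active ∧ b ∈ s.active then s.dist a b else s.len a b } :=
    if_pos hcard
  rw [hfin]
  have hadj : ∀ a b, (s.tree.graph ⊔
      SimpleGraph.fromRel fun a b => a ∈ s.active ∧ b ∈ s.active).Adj a b ↔
      s.tree.graph.Adj a b ∨ (a ≠ b ∧ a ∈ s.active ∧ b ∈ s.active) := by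
    intro a b
    simp only [SimpleGraph.sup_adj, SimpleGraph.fromRel_adj]
    tauto
  refine ⟨φ, h1, ⟨?_, ?_, ?_⟩, h3, h4, ?_⟩
  · simp only
    rw [hRv]
    exact h2.inj.bijOn_image
  · intro a ha b hb
    simp only at ha hb ⊢
    rw [hadj, h2.adj, hmc, hD.skel_adj]
    constructor
    · rintro (k | ⟨k1, k2, k3⟩)
      · exact Or.inl ⟨a, b, k, rfl, rfl⟩
      · refine Or.inr ⟨⟨a, k2, rfl⟩, ⟨b, k3, rfl⟩, fun e => k1 (h2.inj ha hb e), ?_⟩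
        rintro _ ⟨c, hc, rfl⟩ -
        rcases card_le_two_cases hcard k2 k3 hc with e | rfl | rfl
        · exact absurd e k1
        · exact Or.inl rfl
        · exact Or.inr rfl
    · rintro (⟨a', b', k, ea, eb⟩ | ⟨⟨a', ka, ea⟩, ⟨b', kb, eb⟩, k, -⟩)
      · have := h2.supp _ _ k
        rw [← h2.inj this.1 ha ea, ← h2.inj this.2 hb eb]
        exact Or.inl k
      · rw [← h2.inj (h2.sub ka) ha ea, ← h2.inj (h2.sub kb) hb eb]
        refine Or.inr ⟨?_, ka, kb⟩
        rintro rfl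
        exact k (ea.symm.trans eb)
  · intro a b hab
    simp only at hab ⊢
    rw [hadj] at hab
    rcases hab with k | ⟨-, k1, k2⟩
    · exact h2.supp a b k
    · exact ⟨h2.sub k1, h2.sub k2⟩
  · intro a b hab
    simp only at hab ⊢
    have hne := hab.ne
    rw [hadj] at hab
    split_ifs with k
    · exact h2.dist a k.1 b k.2 hne
    · rcases hab with k' | ⟨-, k'⟩
      · exact h2.len a b k'
      · exact absurd k' k

end Correctness

/-! ### Surrogate nodes and the minimum spanning tree -/

section Surrogates

variable {V : Type*}

/-- The adjacency of the tree with tree metric `D`. -/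
abbrev TAdj (D : V → V → ℝ) (u v : V) : Prop := (skel D Set.univ).Adj u v

/-- `sg v` is the strict minimizer over the observed nodes of the distance to `v`. -/
structure IsSurrogateMap (D : V → V → ℝ) (obs : Finset V) (sg : V → obs) : Prop where
  metric : IsTreeMetric D
  min : ∀ (v : V) (x : obs), x ≠ sg v → D v (sg v) < D v x

namespace IsSurrogateMap

variable {D : V → V → ℝ} {obs : Finset V} {sg : V → obs} (h : IsSurrogateMap D obs sg)
include h

theorem sg_obs (x : obs) : sg x = x := by
  by_contra hne
  have := h.min x x (Ne.symm hne)
  rw [h.metric.self] at this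
  exact absurd (h.metric.nonneg _ _) (not_le.2 this)

theorem dist_le (v : V) (x : obs) : D v (sg v) ≤ D v x := by
  by_cases e : x = sg v
  · rw [e]
  · exact (h.min v x e).le

/-- An observed node nearer to `u` than `sg v` would also be nearer to `v`. -/
theorem sg_of_btw {u v : V} (k : MBtw D v u (sg v)) : sg u = sg v := by
  by_contra hne
  have h1 := h.min u (sg v) (Ne.symm hne)
  have h2 := h.dist_le v (sg u)
  have h3 := h.metric.tri v u (sg u)
  unfold MBtw at k
  linarith

/-- Groups are convex: `m` separates one of `u`, `w` from their common surrogate. -/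
theorem sg_of_btw_of_eq {u m w : V} (e : sg u = sg w) (k : MBtw D u m w) : sg m = sg u := by
  rcases h.metric.split _ _ _ k (sg u) with s | s
  · exact h.sg_of_btw s
  · rw [e] at s ⊢
    exact h.sg_of_btw s

theorem btw_or_btw {u v : V} (k : TAdj D u v) (x : V) : MBtw D v u x ∨ MBtw D u v x :=
  h.metric.btw_or_btw_of_skel_adj (fun _ _ _ _ _ _ _ _ => trivial) k trivial

/-- A point in the group of one end of an edge between groups is on the side of this end. -/
theorem btw_of_sg_eq {u v x : V} (k : TAdj D u v) (hne : sg u ≠ sg v) (e : sg x = sg u) :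
    MBtw D v u x :=
  (h.btw_or_btw k x).resolve_right fun k' => hne (h.sg_of_btw_of_eq e.symm k').symm

/-- By convexity the two groups lie on different sides of the edge `uv`, and no second edge joins
the two sides. -/
theorem crossing_unique {u v u' v' : V} (k : TAdj D u v) (k' : TAdj D u' v')
    (hne : sg u ≠ sg v) (eu : sg u' = sg u) (ev : sg v' = sg v) : u' = u ∧ v' = v :=
  h.metric.eq_of_crossing (S := Set.univ) trivial trivial k.ne k' (h.btw_of_sg_eq k hne eu)
    (h.btw_of_sg_eq k.symm hne.symm ev)

end IsSurrogateMap

theorem IsTreeMetric.connected [Finite V] [Nonempty V] {D : V → V → ℝ} (hD : IsTreeMetric D) :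
    (skel D Set.univ).Connected where
  preconnected u v := by
    obtain ⟨l, hl, -⟩ := hD.exists_isPathOf (S := Set.univ) (a := u) (c := v) trivial trivial
    obtain ⟨p, -⟩ := hl.exists_walk
    exact ⟨p⟩

/-- The graph of the groups of observed nodes. -/
def groupGraph (D : V → V → ℝ) {obs : Finset V} (sg : V → obs) : SimpleGraph obs where
  Adj x y := x ≠ y ∧ ∃ u v, TAdj D u v ∧ sg u = x ∧ sg v = y
  symm := ⟨fun _ _ ⟨h1, u, v, h2, h3, h4⟩ => ⟨h1.symm, v, u, h2.symm, h4, h3⟩⟩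
  loopless := ⟨fun _ k => k.1 rfl⟩

/-- The exchange of an edge `zw` for a shorter edge `xy`. As `totalLength` runs over ordered pairs,
the pointwise estimate has two correction terms for each of the two edges. -/
theorem totalLength_lt {X : Type*} [Fintype X] {d : X → X → ℝ} (hsymm : ∀ a b, a ≠ b → d a b = d b a)
    (hnn : ∀ a b, a ≠ b → 0 ≤ d a b) {M M' : SimpleGraph X} {x y z w : X} (hxy : x ≠ y)
    (hM : ∀ a b, M'.Adj a b → M.Adj a b ∨ s(a, b) = s(x, y)) (hzw : M.Adj z w)
    (hzw' : ¬ M'.Adj z w) (hlt : d x y < d z w) : totalLength d M' < totalLength d M := by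
  have hpt : ∀ a b, (if M'.Adj a b then d a b else 0) ≤ (if M.Adj a b then d a b else 0)
      + (if a = x then if b = y then d x y else 0 else 0)
      + (if a = y then if b = x then d x y else 0 else 0)
      - (if a = z then if b = w then d z w else 0 else 0)
      - (if a = w then if b = z then d z w else 0 else 0) := by
    intro a b
    have hxy0 := hnn x y hxy
    have hsw := hsymm z w hzw.ne
    have hsx := hsymm x y hxy
    have hne := hzw.ne
    by_cases h1 : a = z ∧ b = w
    · obtain ⟨rfl, rfl⟩ := h1
      rw [if_neg hzw', if_pos hzw]
      simp only [if_true, if_neg hne]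
      split_ifs <;> linarith
    by_cases h2 : a = w ∧ b = z
    · obtain ⟨rfl, rfl⟩ := h2
      rw [if_neg (fun k => hzw' k.symm), if_pos hzw.symm]
      simp only [if_true, if_neg hne.symm]
      split_ifs <;> linarith
    have e1 : (if a = z then if b = w then d z w else 0 else 0) = 0 := by
      rw [← ite_and, if_neg h1]
    have e2 : (if a = w then if b = z then d z w else 0 else 0) = 0 := by
      rw [← ite_and, if_neg h2]
    rw [e1, e2]
    by_cases h3 : M'.Adj a b
    · rw [if_pos h3]
      rcases hM a b h3 with k | k
      · rw [if_pos k]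
        split_ifs <;> linarith
      · have hab := hnn a b h3.ne
        rcases Sym2.eq_iff.1 k with ⟨rfl, rfl⟩ | ⟨rfl, rfl⟩
        · simp only [if_true]
          split_ifs <;> linarith
        · simp only [if_true]
          split_ifs <;> linarith
    · rw [if_neg h3]
      by_cases h4 : M.Adj a b
      · have := hnn a b h4.ne
        split_ifs <;> linarith
      · split_ifs <;> linarith
  have hle : totalLength d M' ≤ totalLength d M + d x y + d x y - d z w - d z w := by
    have := Finset.sum_le_sum fun a (_ : a ∈ Finset.univ) =>
      Finset.sum_le_sum fun b (_ : b ∈ Finset.univ) => hpt a b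
    unfold totalLength
    simpa only [Finset.sum_add_distrib, Finset.sum_sub_distrib, Finset.sum_ite_irrel,
      Finset.sum_const_zero, Finset.sum_ite_eq', Finset.mem_univ, if_true] using this
  linarith

/-! ### The minimum spanning tree is the tree of groups -/

namespace IsSurrogateMap

variable {D : V → V → ℝ} {obs : Finset V} {sg : V → obs} (h : IsSurrogateMap D obs sg)
include h

theorem groupGraph_connected [Finite V] [Nonempty V] : (groupGraph D sg).Connected := by
  have key : ∀ u v, (groupGraph D sg).Reachable (sg u) (sg v) := by
    intro u v
    obtain ⟨p⟩ := h.metric.connected.preconnected u v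
    induction p with
    | nil => exact .refl _
    | @cons u v w hadj p ih =>
      by_cases e : sg u = sg v
      · rw [e]; exact ih
      · exact (SimpleGraph.Adj.reachable (G := groupGraph D sg) ⟨e, u, v, hadj, rfl, rfl⟩).trans ih
  have : Nonempty obs := ⟨sg (Classical.arbitrary V)⟩
  exact ⟨fun x y => by simpa [h.sg_obs] using key x y⟩

/-- The minimum spanning tree joins the observed nodes whose groups are joined by an edge. -/
theorem mst_eq [Finite V] [Nonempty V] {d : obs → obs → ℝ} (hd : ∀ x y, x ≠ y → d x y = D x y)
    {M : SimpleGraph obs} (hM : IsMST d M) : M = groupGraph D sg := by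
  have hD := h.metric
  have hle : groupGraph D sg ≤ M := by
    rintro x y ⟨hxy, u, v, huv, rfl, rfl⟩
    -- Exchange argument: the path of `M` between the two surrogates crosses the cut of `T` at `uv`
    -- with some edge. The path in `T` between the ends of this edge runs through `u` and `v`, and
    -- no observed nodes are nearer to `u` and `v` than their surrogates, so the crossing edge is
    -- longer than the missing one.
    by_contra hn
    obtain ⟨p, hp⟩ := (hM.1.connected.preconnected (sg u) (sg v)).exists_isPath
    have hx : MBtw D v u (sg u) := h.btw_of_sg_eq huv hxy (h.sg_obs _)
    have hy : MBtw D u v (sg v) := h.btw_of_sg_eq huv.symm hxy.symm (h.sg_obs _)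
    obtain ⟨e, he, hz, hw⟩ := p.exists_boundary_dart {z : obs | MBtw D v u z} hx
      (fun k => hD.not_btw_and_btw huv.ne k hy)
    have hw' : MBtw D u v e.snd := (h.btw_or_btw huv e.snd).resolve_left hw
    have hzw : M.Adj e.fst e.snd := e.adj
    have hlt : d (sg u) (sg v) < d e.fst e.snd := by
      rw [hd _ _ hxy, hd _ _ hzw.ne]
      have hz' : MBtw D v u e.fst := hz
      have k1 : MBtw D e.fst u e.snd := hD.btw_chain (hD.btw_symm hz') hw' huv.ne
      have k2 : MBtw D (sg u) u (sg v) := hD.btw_chain (hD.btw_symm hx) hy huv.ne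
      have l1 := h.dist_le u e.fst
      have l2 := h.dist_le v e.snd
      have hsx := hD.symm (sg u) u
      have hsz := hD.symm e.fst u
      -- The crossing edge is in `M` and the edge between the surrogates is not, so one of its ends
      -- is not the surrogate; here uniqueness of the minimizer gives strict inequality.
      have hstrict : D u (sg u) < D u e.fst ∨ D v (sg v) < D v e.snd := by
        by_contra hcon
        push Not at hcon
        have e1 : e.fst = sg u := by
          by_contra hne
          exact absurd (h.min u _ hne) (not_lt.2 hcon.1)
        have e2 : e.snd = sg v := by
          by_contra hne
          exact absurd (h.min v _ hne) (not_lt.2 hcon.2)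
        exact hn (e1 ▸ e2 ▸ hzw)
      unfold MBtw at *
      rcases hstrict with hs | hs <;> linarith
    set M' := M ⊔ SimpleGraph.edge (sg u) (sg v) with hM'
    have hMM' : M ≤ M' := le_sup_left
    have hyx : M'.Adj (sg v) (sg u) := Or.inr (by
      rw [SimpleGraph.edge_adj]; exact ⟨Or.inr ⟨rfl, rfl⟩, hxy.symm⟩)
    have hcyc : (SimpleGraph.Walk.cons hyx (p.mapLe hMM')).IsCycle := by
      rw [SimpleGraph.Walk.cons_isCycle_iff]
      refine ⟨hp.mapLe hMM', fun k => ?_⟩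
      rw [SimpleGraph.Walk.edges_mapLe_eq_edges] at k
      exact hn (p.adj_of_mem_edges k).symm
    -- The crossing edge lies on the cycle closed by the new edge. It can be deleted without losing
    -- connectedness, and any spanning tree of what remains is shorter than `M`.
    have hnb : ¬ M'.IsBridge s(e.fst, e.snd) := by
      intro hb
      rw [SimpleGraph.isBridge_iff_forall_cycle_notMem
        ((SimpleGraph.mem_edgeSet _).2 (hMM' hzw))] at hb
      apply hb _ hcyc
      rw [SimpleGraph.Walk.edges_cons, SimpleGraph.Walk.edges_mapLe_eq_edges]
      exact List.mem_cons_of_mem _ (List.mem_map_of_mem he)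
    have hconn := (hM.1.connected.mono hMM').connected_delete_edge_of_not_isBridge hnb
    obtain ⟨M₂, hM₂, ht⟩ := hconn.exists_isTree_le
    refine absurd (hM.2 M₂ ht) (not_le.2 (totalLength_lt (x := sg u) (y := sg v) (z := e.fst)
      (w := e.snd) ?_ ?_ hxy ?_ hzw ?_ hlt))
    · intro a b hab
      rw [hd _ _ hab, hd _ _ hab.symm, hD.symm]
    · intro a b hab
      rw [hd _ _ hab]
      exact hD.nonneg _ _
    · intro a b hab
      have := hM₂ hab
      rw [SimpleGraph.deleteEdges_adj] at this
      rcases this.1 with k | k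
      · exact Or.inl k
      · rw [SimpleGraph.edge_adj] at k
        exact Or.inr (Sym2.eq_iff.2 k.1)
    · intro k
      have := hM₂ k
      rw [SimpleGraph.deleteEdges_adj] at this
      exact this.2 rfl
  -- A tree has no proper connected spanning subgraph.
  exact le_antisymm ((SimpleGraph.isTree_iff_minimal_connected.1 hM.1).le_of_le
    h.groupGraph_connected hle) hle

end IsSurrogateMap

end Surrogates

/-! ### Contracting groups of hidden nodes -/

section Contraction

variable {V : Type*}

/-- Hidden nodes whose group leader is not in `S` are moved to their leader. -/
noncomputable def retract {obs : Finset V} (sg : V → obs) (S : Set obs) (v : V) : V :=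
  if sg v ∈ S then v else sg v

/-- The nodes that stay where they are: observed nodes and nodes in the groups of `S`. -/
def keep {obs : Finset V} (sg : V → obs) (S : Set obs) : Set V := {v | sg v ∈ S ∨ (sg v : V) = v}

/-- The tree in which all groups of leaders outside of `S` are contracted to their leader. -/
def contr (D : V → V → ℝ) {obs : Finset V} (sg : V → obs) (S : Set obs) : SimpleGraph V where
  Adj p q := p ≠ q ∧ ∃ u v, TAdj D u v ∧ retract sg S u = p ∧ retract sg S v = q
  symm := ⟨fun _ _ ⟨h1, u, v, h2, h3, h4⟩ => ⟨h1.symm, v, u, h2.symm, h4, h3⟩⟩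
  loopless := ⟨fun _ k => k.1 rfl⟩

/-- The closed neighborhood of the leader `i` in the contracted tree. -/
def nbd (D : V → V → ℝ) {obs : Finset V} (sg : V → obs) (S : Set obs) (i : obs) : Set V :=
  {p | p = i ∨ (contr D sg S).Adj i p}

/-- The group of `i`, together with the closed neighborhood of `i` in the contracted tree. -/
def region (D : V → V → ℝ) {obs : Finset V} (sg : V → obs) (S : Set obs) (i : obs) : Set V :=
  {v | sg v = i} ∪ nbd D sg S i

namespace IsSurrogateMap

variable {D : V → V → ℝ} {obs : Finset V} {sg : V → obs} (h : IsSurrogateMap D obs sg)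
  {S : Set obs} {i : obs}
include h

theorem sg_retract (v : V) : sg (retract sg S v) = sg v := by
  unfold retract
  split_ifs
  · rfl
  · exact h.sg_obs _

theorem retract_mem_keep (v : V) : retract sg S v ∈ keep sg S := by
  unfold retract
  split_ifs with k
  · exact Or.inl k
  · exact Or.inr (congrArg _ (h.sg_obs _))

theorem obs_mem_keep (x : obs) : (x : V) ∈ keep sg S := Or.inr (congrArg _ (h.sg_obs _))

omit h in
theorem retract_of_mem {v : V} (hv : v ∈ keep sg S) : retract sg S v = v := by
  unfold retract
  split_ifs with k
  · rfl
  · exact hv.resolve_left k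

omit h in
theorem retract_of_notMem {v : V} (hv : sg v ∉ S) : retract sg S v = sg v := if_neg hv

omit h in
theorem retract_of_sg_mem {v : V} (hv : sg v ∈ S) : retract sg S v = v := if_pos hv

theorem contr_supp {p q : V} (k : (contr D sg S).Adj p q) : p ∈ keep sg S ∧ q ∈ keep sg S := by
  obtain ⟨-, u, v, -, rfl, rfl⟩ := k
  exact ⟨h.retract_mem_keep u, h.retract_mem_keep v⟩

/-- An edge of the contraction comes from an edge `uv` of `T`, and the cut of `T` at `uv` descends.
A contracted group with nodes on both sides would by convexity contain `u` and `v`, and the edge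
would have become a loop. -/
theorem contr_isAcyclic : (contr D sg S).IsAcyclic := by
  apply isAcyclic_of_cuts
  rintro p q ⟨hpq, u, v, huv, rfl, rfl⟩
  have hside : ∀ w, MBtw D v u (retract sg S w) ↔ MBtw D v u w := by
    intro w
    by_cases hw : sg w ∈ S
    · rw [retract_of_sg_mem hw]
    rw [retract_of_notMem hw]
    have key : ∀ a b : V, sg a = sg w → sg b = sg w → MBtw D v u a → MBtw D v u b := by
      intro a b ha hb k
      by_contra hn
      have k' := (h.btw_or_btw huv b).resolve_left hn
      have s1 := h.sg_of_btw_of_eq (ha.trans hb.symm) (h.metric.btw_chain (h.metric.btw_symm k) k' huv.ne)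
      have s2 := h.sg_of_btw_of_eq (hb.trans ha.symm)
        (h.metric.btw_chain (h.metric.btw_symm k') k huv.ne.symm)
      apply hpq
      rw [retract_of_notMem (by rw [s1, ha]; exact hw), retract_of_notMem (by rw [s2, hb]; exact hw),
        s1, s2, ha, hb]
    exact ⟨key _ _ (h.sg_obs _) rfl, key _ _ rfl (h.sg_obs _)⟩
  refine ⟨fun c => MBtw D v u c, (hside u).2 (h.metric.btw_right _ _),
    fun k => huv.ne (h.metric.btw_self ((hside v).1 k)), ?_⟩
  rintro a b ⟨-, u', v', huv', rfl, rfl⟩ ga gb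
  obtain ⟨rfl, rfl⟩ := h.metric.eq_of_crossing (S := Set.univ) trivial trivial huv.ne huv'
    ((hside u').1 ga) ((h.btw_or_btw huv v').resolve_left fun k => gb ((hside v').2 k))
  exact ⟨rfl, rfl⟩

omit h in
theorem contr_univ (hS : ∀ v, v ∈ keep sg S) : contr D sg S = skel D Set.univ := by
  have hr : ∀ v, retract sg S v = v := fun v => retract_of_mem (hS v)
  ext p q
  simp only [contr, hr]
  exact ⟨fun ⟨_, u, v, k, e1, e2⟩ => e1 ▸ e2 ▸ k, fun k => ⟨k.ne, p, q, k, rfl, rfl⟩⟩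

omit h in
theorem contr_empty_adj {x y : V} : (contr D sg ∅).Adj x y ↔
    ∃ a b : obs, (groupGraph D sg).Adj a b ∧ (a : V) = x ∧ (b : V) = y := by
  have hr : ∀ v, retract sg ∅ v = sg v := fun v => retract_of_notMem (Set.notMem_empty _)
  simp only [contr, hr]
  constructor
  · rintro ⟨hne, u, v, huv, rfl, rfl⟩
    exact ⟨sg u, sg v, ⟨fun e => hne (congrArg _ e), u, v, huv, rfl, rfl⟩, rfl, rfl⟩
  · rintro ⟨_, _, ⟨hne, u, v, huv, rfl, rfl⟩, rfl, rfl⟩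
    exact ⟨fun e => hne (Subtype.ext e), u, v, huv, rfl, rfl⟩

/-- The group of a neighbor `v'` of the group of `u` is on the side of `u` of the edge from `u` to
another group. -/
theorem btw_of_neighbor {u v u' v' x : V} (k : TAdj D u v) (hne : sg u ≠ sg v)
    (k' : TAdj D u' v') (eu : sg u' = sg u) (hv : sg v' ≠ sg v) (ex : sg x = sg v') :
    MBtw D v u x := by
  have h1 : MBtw D v u v' := by
    refine (h.btw_or_btw k v').resolve_right fun s => hv ?_
    rw [(h.metric.eq_of_crossing (S := Set.univ) trivial trivial k.ne k'
      (h.btw_of_sg_eq k hne eu) s).2]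
  refine (h.btw_or_btw k x).resolve_right fun s => hv ?_
  exact (h.sg_of_btw_of_eq ex.symm
    (h.metric.btw_symm (h.metric.btw_chain (h.metric.btw_symm s) h1 k.ne.symm))).symm

/-! ### Expanding the group of one more leader -/

section Local

variable (hi : i ∉ S)
include hi

theorem mem_nbd {p : V} : p ∈ nbd D sg S i ↔
    p = i ∨ ∃ u v, TAdj D u v ∧ sg u = i ∧ sg v ≠ i ∧ p = retract sg S v := by
  apply or_congr_right
  constructor
  · rintro ⟨hne, u, v, huv, eu, rfl⟩
    have e1 : sg u = i := by rw [← h.sg_retract (S := S) u, eu, h.sg_obs]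
    refine ⟨u, v, huv, e1, fun e => hne ?_, rfl⟩
    rw [retract_of_notMem (by rw [e]; exact hi), e]
  · rintro ⟨u, v, huv, rfl, hv, rfl⟩
    refine ⟨fun e => hv ?_, u, v, huv, retract_of_notMem hi, rfl⟩
    rw [← h.sg_retract (S := S) v, ← e, h.sg_obs]

theorem exists_of_mem_region {p : V} (hp : p ∈ region D sg S i) (hpi : sg p ≠ i) :
    ∃ u v, TAdj D u v ∧ sg u = i ∧ sg v ≠ i ∧ p = retract sg S v := by
  rcases hp with hp | hp
  · exact absurd hp hpi
  rcases (h.mem_nbd hi).1 hp with rfl | k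
  · exact absurd (h.sg_obs i) hpi
  · exact k

theorem region_unique {p q : V} (hp : p ∈ region D sg S i) (hq : q ∈ region D sg S i)
    (e : sg p = sg q) (hpi : sg p ≠ i) : p = q := by
  obtain ⟨u, v, huv, eu, ev, rfl⟩ := h.exists_of_mem_region hi hp hpi
  obtain ⟨u', v', huv', eu', ev', rfl⟩ := h.exists_of_mem_region hi hq (e ▸ hpi)
  rw [h.sg_retract, h.sg_retract] at e
  rw [(h.crossing_unique huv huv' (eu ▸ ev.symm) (eu'.trans eu.symm) e.symm).2]

/-- The region has at most one point in each group other than that of `i`, namely the retract of the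
outer end of the edge leading there. Nothing in the region can lie between the inner end of this
edge and that point, while points in two different outer groups are separated by the group of `i`.
-/
theorem skel_region_adj {p q : V} : (skel D (region D sg S i)).Adj p q ↔
    (TAdj D p q ∧ sg p = i ∧ sg q = i) ∨
    (∃ v, TAdj D p v ∧ sg p = i ∧ sg v ≠ i ∧ q = retract sg S v) ∨
    (∃ v, TAdj D q v ∧ sg q = i ∧ sg v ≠ i ∧ p = retract sg S v) := by
  have hD := h.metric
  have half : ∀ {p q}, (skel D (region D sg S i)).Adj p q → sg p = i → sg q ≠ i →
      ∃ v, TAdj D p v ∧ sg p = i ∧ sg v ≠ i ∧ q = retract sg S v := by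
    intro p q k hp hq
    obtain ⟨h1, h2, h3, h4⟩ := hD.skel_adj.1 k
    obtain ⟨u, v, huv, eu, ev, rfl⟩ := h.exists_of_mem_region hi h2 hq
    have hne : sg u ≠ sg v := eu ▸ ev.symm
    have k1 := h.btw_of_sg_eq huv hne (hp.trans eu.symm)
    have k2 := h.btw_of_sg_eq huv.symm hne.symm (h.sg_retract (S := S) v)
    rcases h4 u (Or.inl eu) (hD.btw_chain (hD.btw_symm k1) k2 huv.ne) with rfl | e
    · exact ⟨v, huv, hp, ev, rfl⟩
    · rw [← e] at hq
      exact absurd eu hq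
  have half' : ∀ {p v}, TAdj D p v → sg p = i → sg v ≠ i →
      (skel D (region D sg S i)).Adj p (retract sg S v) := by
    intro p v k hp hv
    have hne : sg p ≠ sg v := hp ▸ hv.symm
    have hrv : retract sg S v ∈ region D sg S i :=
      Or.inr ((h.mem_nbd hi).2 (Or.inr ⟨p, v, k, hp, hv, rfl⟩))
    rw [hD.skel_adj]
    refine ⟨Or.inl hp, hrv, fun e => hne ?_, fun c hc kc => ?_⟩
    · rw [e, h.sg_retract]
    have k2 := h.btw_of_sg_eq k.symm hne.symm (h.sg_retract (S := S) v)
    have main : sg c = sg v → c = retract sg S v := fun e =>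
      h.region_unique hi hc hrv (by rw [e, h.sg_retract]) (by rw [e]; exact hv)
    rcases hD.btw_total kc k2 with s | s
    · rcases (hD.skel_adj.1 k).2.2.2 c trivial s with rfl | rfl
      · exact Or.inl rfl
      · exact Or.inr (main rfl)
    · exact Or.inr (main (h.sg_of_btw_of_eq (h.sg_retract v).symm (hD.btw_trans' s kc)))
  constructor
  · intro k
    by_cases hp : sg p = i
    · by_cases hq : sg q = i
      · left
        refine ⟨?_, hp, hq⟩
        rw [TAdj, hD.skel_adj]
        exact ⟨trivial, trivial, k.ne, fun c _ kc => (hD.skel_adj.1 k).2.2.2 c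
          (Or.inl ((h.sg_of_btw_of_eq (hp.trans hq.symm) kc).trans hp)) kc⟩
      · exact Or.inr (Or.inl (half k hp hq))
    · by_cases hq : sg q = i
      · exact Or.inr (Or.inr (half k.symm hq hp))
      · exfalso
        obtain ⟨h1, h2, h3, h4⟩ := hD.skel_adj.1 k
        obtain ⟨u, v, huv, eu, ev, rfl⟩ := h.exists_of_mem_region hi h1 hp
        obtain ⟨u', v', huv', eu', ev', rfl⟩ := h.exists_of_mem_region hi h2 hq
        have hvv : sg v' ≠ sg v := fun e => h3 (h.region_unique hi h1 h2
          (by rw [h.sg_retract, h.sg_retract, e]) hp)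
        have hne : sg u ≠ sg v := eu ▸ ev.symm
        have k1 := h.btw_of_neighbor huv hne huv' (eu'.trans eu.symm) hvv (h.sg_retract (S := S) v')
        have k2 := h.btw_of_sg_eq huv.symm hne.symm (h.sg_retract (S := S) v)
        rcases h4 u (Or.inl eu) (hD.btw_symm
          (hD.btw_chain (hD.btw_symm k1) k2 huv.ne)) with e | e
        · rw [← e] at hp; exact hp eu
        · rw [← e] at hq; exact hq eu
  · rintro (⟨k, hp, hq⟩ | ⟨v, k, hp, hv, rfl⟩ | ⟨v, k, hp, hv, rfl⟩)
    · rw [hD.skel_adj]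
      exact ⟨Or.inl hp, Or.inl hq, k.ne, fun c _ kc => (hD.skel_adj.1 k).2.2.2 c trivial kc⟩
    · exact half' k hp hv
    · exact (half' k hp hv).symm

omit h hi in
theorem retract_insert {v : V} : retract sg (insert i S) v =
    if sg v = i then v else retract sg S v := by
  unfold retract
  simp only [Set.mem_insert_iff]
  split_ifs <;> tauto

/-- Expanding the group of `i` affects only the edges of `T` that meet this group, and these give
the skeleton of the region. This is the effect of one serial step. -/
theorem contr_insert_adj {p q : V} : (contr D sg (insert i S)).Adj p q ↔
    ((contr D sg S).Adj p q ∧ sg p ≠ i ∧ sg q ≠ i) ∨ (skel D (region D sg S i)).Adj p q := by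
  rw [h.skel_region_adj hi]
  constructor
  · rintro ⟨hne, u, v, huv, rfl, rfl⟩
    simp only [retract_insert]
    by_cases hu : sg u = i <;> by_cases hv : sg v = i
    · rw [if_pos hu, if_pos hv]
      exact Or.inr (Or.inl ⟨huv, hu, hv⟩)
    · rw [if_pos hu, if_neg hv]
      exact Or.inr (Or.inr (Or.inl ⟨v, huv, hu, hv, rfl⟩))
    · rw [if_neg hu, if_pos hv]
      exact Or.inr (Or.inr (Or.inr ⟨u, huv.symm, hv, hu, rfl⟩))
    · simp only [retract_insert] at hne
      rw [if_neg hu, if_neg hv] at hne ⊢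
      exact Or.inl ⟨⟨hne, u, v, huv, rfl, rfl⟩, by rwa [h.sg_retract], by rwa [h.sg_retract]⟩
  · rintro (⟨⟨hne, u, v, huv, rfl, rfl⟩, hp, hq⟩ | ⟨k, hp, hq⟩ | ⟨v, k, hp, hv, rfl⟩ |
      ⟨v, k, hp, hv, rfl⟩)
    · rw [h.sg_retract] at hp hq
      exact ⟨hne, u, v, huv, by rw [retract_insert, if_neg hp],
        by rw [retract_insert, if_neg hq]⟩
    · exact ⟨k.ne, p, q, k, by rw [retract_insert, if_pos hp],
        by rw [retract_insert, if_pos hq]⟩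
    · exact ⟨fun e => hv (by rw [← h.sg_retract (S := S) v, ← e, hp]), p, v, k,
        by rw [retract_insert, if_pos hp], by rw [retract_insert, if_neg hv]⟩
    · exact ⟨fun e => hv (by rw [← h.sg_retract (S := S) v, e, hp]), v, q, k.symm,
        by rw [retract_insert, if_neg hv], by rw [retract_insert, if_pos hp]⟩

/-- An edge of the contracted tree is at `i` if both ends are in the neighborhood of `i`. -/
theorem not_mem_nbd_iff {p q : V} (k : (contr D sg S).Adj p q) :
    ¬ (p ∈ nbd D sg S i ∧ q ∈ nbd D sg S i) ↔ sg p ≠ i ∧ sg q ≠ i := by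
  have hsg : ∀ x, x ∈ keep sg S → sg x = i → x = i := by
    rintro x (hx | hx) e
    · exact absurd (e ▸ hx) hi
    · rw [← e]; exact hx.symm
  constructor
  · intro hn
    constructor
    · intro e
      have ep := hsg p (h.contr_supp k).1 e
      exact hn ⟨Or.inl ep, Or.inr (ep ▸ k)⟩
    · intro e
      have eq := hsg q (h.contr_supp k).2 e
      exact hn ⟨Or.inr (eq ▸ k.symm), Or.inl eq⟩
  · rintro ⟨hp, hq⟩ ⟨kp, kq⟩
    obtain ⟨hne, a, b, hab, rfl, rfl⟩ := k
    obtain ⟨u, v, huv, eu, ev, e1⟩ := h.exists_of_mem_region hi (Or.inr kp) hp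
    obtain ⟨u', v', huv', eu', ev', e2⟩ := h.exists_of_mem_region hi (Or.inr kq) hq
    have ea : sg a = sg v := by rw [← h.sg_retract (S := S) a, e1, h.sg_retract]
    have eb : sg b = sg v' := by rw [← h.sg_retract (S := S) b, e2, h.sg_retract]
    have hvv : sg v' ≠ sg v := fun e => hne (h.region_unique hi (Or.inr kp) (Or.inr kq)
      (by rw [h.sg_retract, h.sg_retract, ea, eb, e]) hp)
    have hne' : sg u ≠ sg v := eu ▸ ev.symm
    have k1 := h.btw_of_neighbor huv hne' huv' (eu'.trans eu.symm) hvv eb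
    have k2 := h.btw_of_sg_eq huv.symm hne'.symm ea
    -- Two neighbors of `i` in different groups are not adjacent: the edge `ab` would cross the cut
    -- at `uv`, which only `uv` does.
    have := h.metric.eq_of_crossing (S := Set.univ) trivial trivial huv.ne hab.symm k1 k2
    rw [h.sg_retract] at hq
    rw [this.1] at hq
    exact hq eu

theorem sg_of_btw_region {x m b : V} (hx : sg x = i) (hb : b ∈ region D sg S i)
    (k : MBtw D x m b) : sg m = i ∨ sg m = sg b := by
  have hD := h.metric
  by_cases hbi : sg b = i
  · exact Or.inl ((h.sg_of_btw_of_eq (hx.trans hbi.symm) k).trans hx)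
  obtain ⟨u, v, huv, eu, ev, rfl⟩ := h.exists_of_mem_region hi hb hbi
  have hne : sg u ≠ sg v := eu ▸ ev.symm
  have k1 := h.btw_of_sg_eq huv hne (hx.trans eu.symm)
  have k2 := h.btw_of_sg_eq huv.symm hne.symm (h.sg_retract (S := S) v)
  have k3 := hD.btw_chain (hD.btw_symm k1) k2 huv.ne
  rcases hD.btw_total k k3 with s | s
  · exact Or.inl ((h.sg_of_btw_of_eq (hx.trans eu.symm) s).trans hx)
  have k4 := hD.btw_trans' s k
  rcases hD.btw_total k4 k2 with s | s
  · rcases (hD.skel_adj.1 huv).2.2.2 m trivial s with rfl | rfl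
    · exact Or.inl eu
    · exact Or.inr (h.sg_retract _).symm
  · right
    rw [h.sg_retract]
    exact h.sg_of_btw_of_eq (h.sg_retract v).symm (hD.btw_trans' s k4)

theorem sg_of_btw_region' {a m b : V} (ha : a ∈ region D sg S i) (hb : b ∈ region D sg S i)
    (k : MBtw D a m b) : sg m = i ∨ sg m = sg a ∨ sg m = sg b := by
  have hD := h.metric
  by_cases hai : sg a = i
  · exact (h.sg_of_btw_region hi hai hb k).imp_right Or.inr
  by_cases hbi : sg b = i
  · exact (h.sg_of_btw_region hi hbi ha (hD.btw_symm k)).imp_right Or.inl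
  by_cases hab : a = b
  · subst hab
    rw [hD.btw_self k]
    exact Or.inr (Or.inl rfl)
  obtain ⟨u, v, huv, eu, ev, rfl⟩ := h.exists_of_mem_region hi ha hai
  obtain ⟨u', v', huv', eu', ev', rfl⟩ := h.exists_of_mem_region hi hb hbi
  have hvv : sg v' ≠ sg v := fun e => hab (h.region_unique hi ha hb
    (by rw [h.sg_retract, h.sg_retract, e]) hai)
  have hne : sg u ≠ sg v := eu ▸ ev.symm
  have k1 := h.btw_of_neighbor huv hne huv' (eu'.trans eu.symm) hvv (h.sg_retract (S := S) v')
  have k2 := h.btw_of_sg_eq huv.symm hne.symm (h.sg_retract (S := S) v)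
  have k3 := hD.btw_symm (hD.btw_chain (hD.btw_symm k1) k2 huv.ne)
  rcases hD.btw_total k k3 with s | s
  · exact (h.sg_of_btw_region hi eu ha (hD.btw_symm s)).imp_right Or.inl
  · exact (h.sg_of_btw_region hi eu hb (hD.btw_trans' s k)).imp_right Or.inr

end Local

end IsSurrogateMap

end Contraction

/-! ### Neighborhoods of group leaders span the groups -/

section Regions

variable {V : Type*}

theorem exists_three_of_ncard {s : Set V} (hs : 3 ≤ s.ncard) :
    ∃ a ∈ s, ∃ b ∈ s, ∃ c ∈ s, a ≠ b ∧ a ≠ c ∧ b ≠ c := by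
  have hfin : s.Finite := Set.finite_of_ncard_pos (by omega)
  obtain ⟨a, b, c, ha, hb, hc, k⟩ := (Set.two_lt_ncard_iff hfin).1 hs
  exact ⟨a, ha, b, hb, c, hc, k⟩

namespace IsSurrogateMap

variable {D : V → V → ℝ} {obs : Finset V} {sg : V → obs} (h : IsSurrogateMap D obs sg)
  {S : Set obs} {i : obs} (hi : i ∉ S)
include h

theorem btw_of_adj_of_adj {v n₁ n₂ : V} (k₁ : TAdj D v n₁) (k₂ : TAdj D v n₂) (hne : n₁ ≠ n₂) :
    MBtw D n₁ v n₂ := by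
  refine (h.btw_or_btw k₁ n₂).resolve_right fun s => ?_
  rcases (h.metric.skel_adj.1 k₂).2.2.2 n₁ trivial s with e | e
  · exact k₁.ne' e
  · exact hne e

include hi

/-- If `n` is outside the group, its retract is the point. Otherwise take the farthest node `w` of
the group beyond `n`. If it is not `i`, it is hidden and has a neighbor pointing away from `v`,
since at most one neighbor points back; by the choice of `w` this neighbor has left the group. -/
theorem exists_nbd_beyond [Finite V]
    (hdeg : ∀ v, v ∉ obs → 3 ≤ ((skel D Set.univ).neighborSet v).ncard) {v n : V} (hv : sg v = i)
    (k : TAdj D v n) : ∃ q ∈ nbd D sg S i, MBtw D v n q := by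
  have hD := h.metric
  have out : ∀ w w', TAdj D w w' → sg w = i → sg w' ≠ i →
      retract sg S w' ∈ nbd D sg S i ∧ MBtw D w w' (retract sg S w') := fun w w' kw e e' =>
    ⟨(h.mem_nbd hi).2 (Or.inr ⟨w, w', kw, e, e', rfl⟩),
      h.btw_of_sg_eq kw.symm (by rw [e]; exact e') (h.sg_retract w')⟩
  by_cases hn : sg n = i
  · obtain ⟨w, ⟨hw, kw⟩, hmax⟩ := Set.exists_max_image {w | sg w = i ∧ MBtw D v n w}
      (fun w => D v w) (Set.toFinite _) ⟨n, hn, hD.btw_right _ _⟩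
    by_cases hwi : w = i
    · exact ⟨i, Or.inl rfl, hwi ▸ kw⟩
    have hwv : w ≠ v := by
      rintro rfl
      exact k.ne' (hD.btw_self kw)
    have hwo : w ∉ obs := by
      intro hwo
      apply hwi
      rw [← hw]
      exact (congrArg Subtype.val (h.sg_obs ⟨w, hwo⟩)).symm
    have hex : ∃ w', TAdj D w w' ∧ MBtw D w' w v := by
      obtain ⟨a, ha, b, hb, -, -, hab, -⟩ := exists_three_of_ncard (hdeg w hwo)
      have ha : TAdj D w a := ha
      have hb : TAdj D w b := hb
      rcases h.btw_or_btw ha v with s | s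
      · exact ⟨a, ha, s⟩
      rcases h.btw_or_btw hb v with s' | s'
      · exact ⟨b, hb, s'⟩
      exfalso
      rcases hD.btw_total s s' with t | t
      · rcases (hD.skel_adj.1 hb).2.2.2 a trivial t with e | e
        · exact ha.ne' e
        · exact hab e
      · rcases (hD.skel_adj.1 ha).2.2.2 b trivial t with e | e
        · exact hb.ne' e
        · exact hab e.symm
    obtain ⟨w', hww, hb⟩ := hex
    have hvw : MBtw D v w w' := hD.btw_symm hb
    have hw' : sg w' ≠ i := by
      intro e
      have h1 := hmax w' ⟨e, hD.btw_trans kw hvw⟩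
      have h2 := hD.pos w w' hww.ne
      unfold MBtw at hvw
      linarith
    obtain ⟨o1, o2⟩ := out w w' hww hw hw'
    exact ⟨_, o1, hD.btw_trans kw (hD.btw_trans hvw (hD.btw_chain hvw o2 hww.ne |> fun _ =>
      hD.btw_symm (hD.btw_chain (hD.btw_symm o2) (hD.btw_symm hvw) hww.ne')))⟩
  · obtain ⟨o1, o2⟩ := out v n k hv hn
    exact ⟨_, o1, o2⟩

/-- Minimality of `T` enters here: a hidden node has three branches, and each contains a point of
the neighborhood. -/
theorem exists_three_nbd [Finite V]
    (hdeg : ∀ v, v ∉ obs → 3 ≤ ((skel D Set.univ).neighborSet v).ncard) {v : V} (hv : sg v = i)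
    (hvo : v ∉ obs) : ∃ a ∈ nbd D sg S i, ∃ b ∈ nbd D sg S i, ∃ c ∈ nbd D sg S i,
      v ≠ a ∧ v ≠ b ∧ v ≠ c ∧ IsMed D v a b c := by
  have hD := h.metric
  obtain ⟨n₁, k₁, n₂, k₂, n₃, k₃, e₁₂, e₁₃, e₂₃⟩ := exists_three_of_ncard (hdeg v hvo)
  obtain ⟨a, ha, ka⟩ := h.exists_nbd_beyond hi hdeg hv k₁
  obtain ⟨b, hb, kb⟩ := h.exists_nbd_beyond hi hdeg hv k₂
  obtain ⟨c, hc, kc⟩ := h.exists_nbd_beyond hi hdeg hv k₃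
  have key : ∀ {n n' a b : V}, TAdj D v n → TAdj D v n' → n ≠ n' → MBtw D v n a → MBtw D v n' b →
      MBtw D a v b := by
    intro n n' a b k k' e ka kb
    have s1 := hD.btw_chain (h.btw_of_adj_of_adj k k' e) kb k'.ne
    exact hD.btw_symm (hD.btw_chain (hD.btw_symm s1) ka k.ne)
  have hne : ∀ {n a : V}, TAdj D v n → MBtw D v n a → v ≠ a := by
    rintro n a k ka rfl
    exact k.ne' (hD.btw_self ka)
  exact ⟨a, ha, b, hb, c, hc, hne k₁ ka, hne k₂ kb, hne k₃ kc, key k₁ k₂ e₁₂ ka kb,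
    key k₁ k₃ e₁₃ ka kc, key k₂ k₃ e₂₃ kb kc⟩

/-- The median closure of the neighborhood of a leader is its group with the neighborhood. -/
theorem medClosure_nbd [Finite V]
    (hdeg : ∀ v, v ∉ obs → 3 ≤ ((skel D Set.univ).neighborSet v).ncard) :
    medClosure D (nbd D sg S i) = region D sg S i := by
  have hD := h.metric
  apply Set.Subset.antisymm
  · rintro m ⟨a, ha, b, hb, c, hc, k1, k2, k3⟩
    by_cases hm : sg m = i
    · exact Or.inl hm
    right
    -- A median `m` outside the group of `i` lies on three paths, each of which stays in the group
    -- of `i` and the groups of its ends. So the group of `m` contains two of the three points,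
    -- which then coincide, and `m` is equal to them.
    have uniq : ∀ x y, x ∈ nbd D sg S i → y ∈ nbd D sg S i → sg m = sg x → sg m = sg y →
        x = y := fun x y hx hy ex ey =>
      h.region_unique hi (Or.inr hx) (Or.inr hy) (ex.symm.trans ey) (ex ▸ hm)
    have s1 := (h.sg_of_btw_region' hi (Or.inr ha) (Or.inr hb) k1).resolve_left hm
    have s2 := (h.sg_of_btw_region' hi (Or.inr ha) (Or.inr hc) k2).resolve_left hm
    have s3 := (h.sg_of_btw_region' hi (Or.inr hb) (Or.inr hc) k3).resolve_left hm
    rcases s1 with e1 | e1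
    · rcases s3 with e3 | e3
      · obtain rfl := uniq a b ha hb e1 e3
        exact hD.btw_self k1 ▸ ha
      · obtain rfl := uniq a c ha hc e1 e3
        exact hD.btw_self k2 ▸ ha
    · rcases s2 with e2 | e2
      · obtain rfl := uniq a b ha hb e2 e1
        exact hD.btw_self k1 ▸ ha
      · obtain rfl := uniq b c hb hc e1 e2
        exact hD.btw_self k3 ▸ hb
  · rintro v (hv | hv)
    · by_cases hvo : v ∈ obs
      · apply hD.subset_medClosure
        left
        have := congrArg Subtype.val (h.sg_obs ⟨v, hvo⟩)
        exact this.symm.trans (congrArg _ hv)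
      · obtain ⟨a, ha, b, hb, c, hc, -, -, -, hm⟩ := h.exists_three_nbd hi hdeg hv hvo
        exact ⟨a, ha, b, hb, c, hc, hm⟩
    · exact hD.subset_medClosure _ hv

omit hi in
-- Among three different points of the closed neighborhood of the leader at most one is the leader,
-- so it has two neighbors in the tree of groups.
theorem isInternal_sg [Finite V]
    (hdeg : ∀ v, v ∉ obs → 3 ≤ ((skel D Set.univ).neighborSet v).ncard) {v : V} (hvo : v ∉ obs) :
    IsInternal (groupGraph D sg) (sg v) := by
  obtain ⟨a, ha, b, hb, c, hc, ea, eb, ec, k1, k2, k3⟩ :=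
    h.exists_three_nbd (S := ∅) (Set.notMem_empty (sg v)) hdeg rfl hvo
  have key : ∀ x y, MBtw D x v y → v ≠ x → x ≠ y := by
    rintro x y k hne rfl
    exact hne (h.metric.btw_self k)
  have hnb : ∀ x ∈ nbd D sg ∅ (sg v), x = sg v ∨
      ∃ y : obs, y = x ∧ (groupGraph D sg).Adj (sg v) y := by
    rintro x (hx | hx)
    · exact Or.inl hx
    · obtain ⟨p, q, k, e1, e2⟩ := contr_empty_adj.1 hx
      obtain rfl : p = sg v := Subtype.ext e1
      exact Or.inr ⟨q, e2, k⟩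
  have two : ∀ x ∈ nbd D sg ∅ (sg v), ∀ y ∈ nbd D sg ∅ (sg v), x ≠ y → x ≠ sg v → y ≠ sg v →
      IsInternal (groupGraph D sg) (sg v) := by
    intro x hx y hy hxy hxv hyv
    obtain ⟨x', rfl, kx⟩ := (hnb x hx).resolve_left hxv
    obtain ⟨y', rfl, ky⟩ := (hnb y hy).resolve_left hyv
    exact (Set.one_lt_ncard (Set.toFinite _)).2 ⟨x', kx, y', ky, fun e => hxy (congrArg _ e)⟩
  have hab := key a b k1 ea
  have hac := key a c k2 ea
  have hbc := key b c k3 eb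
  by_cases h1 : a = sg v
  · exact two b hb c hc hbc (fun e => hab (h1.trans e.symm)) (fun e => hac (h1.trans e.symm))
  by_cases h2 : b = sg v
  · exact two a ha c hc hac h1 (fun e => hbc (h2.trans e.symm))
  · exact two a ha b hb hab h1 h2

omit hi in
theorem keep_insert : keep sg (insert i S) = keep sg S ∪ region D sg S i := by
  ext v
  constructor
  · rintro (hv | hv)
    · rcases hv with hv | hv
      · exact Or.inr (Or.inl hv)
      · exact Or.inl (Or.inl hv)
    · exact Or.inl (Or.inr hv)
  · rintro ((hv | hv) | (hv | hv))
    · exact Or.inl (Set.mem_insert_of_mem _ hv)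
    · exact Or.inr hv
    · exact Or.inl (hv ▸ Set.mem_insert _ _)
    · have : v ∈ keep sg S := by
        rcases hv with rfl | hv
        · exact h.obs_mem_keep i
        · exact (h.contr_supp hv).2
      rcases this with hv | hv
      · exact Or.inl (Set.mem_insert_of_mem _ hv)
      · exact Or.inr hv

/-- This justifies `nodeDist`: the path between the leaders of two nodes of the neighborhood passes
through both nodes. -/
theorem dist_sg_nbd {a b : V} (ha : a ∈ nbd D sg S i) (hb : b ∈ nbd D sg S i) (hab : a ≠ b) :
    sg a ≠ sg b ∧ D (sg a) (sg b) = D a (sg a) + D a b + D b (sg b) := by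
  have hD := h.metric
  have at_i : ∀ x ∈ nbd D sg S i, sg x = i → x = i := by
    intro x hx e
    rcases (h.mem_nbd hi).1 hx with rfl | ⟨u, v, -, -, ev, rfl⟩
    · rfl
    · exact absurd ((h.sg_retract v).symm.trans e) ev
  have hsg : sg a ≠ sg b := by
    intro e
    apply hab
    by_cases hai : sg a = i
    · rw [at_i a ha hai, at_i b hb (e ▸ hai)]
    · exact h.region_unique hi (Or.inr ha) (Or.inr hb) e hai
  -- If the group of `x` is expanded, `x` is the outer end of an edge from the group of `i` and
  -- separates its own leader from the other groups around `i`. If it is not, `x` is its own leader.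
  have out : ∀ x ∈ nbd D sg S i, ∀ y, y ∈ region D sg S i → sg x ≠ sg y → x ≠ i →
      ∀ z, sg z = sg y → MBtw D (sg x) x z := by
    intro x hx y hy hxy hxi z hz
    by_cases hxS : sg x ∈ S
    · obtain ⟨u, v, huv, eu, ev, rfl⟩ := ((h.mem_nbd hi).1 hx).resolve_left hxi
      rw [h.sg_retract] at hxS hxy ⊢
      rw [retract_of_sg_mem hxS]
      have hne : sg u ≠ sg v := eu ▸ ev.symm
      have k1 : MBtw D v u z := by
        by_cases hyi : sg y = i
        · exact h.btw_of_sg_eq huv hne (hz.trans (hyi.trans eu.symm))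
        · obtain ⟨u', v', huv', eu', ev', rfl⟩ := h.exists_of_mem_region hi hy hyi
          rw [h.sg_retract] at hz hxy
          exact h.btw_of_neighbor huv hne huv' (eu'.trans eu.symm) hxy.symm hz
      have k2 := h.btw_of_sg_eq huv.symm hne.symm (h.sg_obs (sg v))
      exact hD.btw_chain (hD.btw_symm k2) k1 huv.ne'
    · have hxk : x ∈ keep sg S := by
        obtain ⟨u, v, huv, eu, ev, rfl⟩ := ((h.mem_nbd hi).1 hx).resolve_left hxi
        exact h.retract_mem_keep v
      rw [hxk.resolve_left hxS]
      exact hD.btw_left _ _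
  have out' : ∀ x ∈ nbd D sg S i, ∀ y, y ∈ region D sg S i → sg x ≠ sg y →
      ∀ z, sg z = sg y → MBtw D (sg x) x z := by
    intro x hx y hy hxy z hz
    by_cases hxi : x = i
    · rw [hxi, h.sg_obs]
      exact hD.btw_left _ _
    · exact out x hx y hy hxy hxi z hz
  refine ⟨hsg, ?_⟩
  have k1 := out' a ha b (Or.inr hb) hsg (sg b) (h.sg_obs _)
  have k2 := out' b hb a (Or.inr ha) hsg.symm a rfl
  have e1 := hD.symm (sg a) a
  have e2 := hD.symm a (sg b)
  have e3 := hD.symm b (sg b)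
  have e4 := hD.symm a b
  unfold MBtw at k1 k2
  linarith

end IsSurrogateMap

end Regions

/-! ### The serial algorithm -/

section Serial

variable {V : Type*}

/-- Two bijections that agree where they overlap, and whose images only overlap there, can be glued
together. -/
theorem bijOn_union_of_agree {N : Type*} {f g f' : N → V} {W A Ω : Set N} {K R : Set V}
    (hf : Set.BijOn f W K) (hg : Set.BijOn g A R) (ef : Set.EqOn f' f W) (eg : Set.EqOn f' g A)
    (hW : Ω ⊆ W) (hA : Ω ⊆ A) (hKR : K ∩ R ⊆ f' '' Ω) : Set.BijOn f' (W ∪ A) (K ∪ R) := by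
  have hf' := hf.congr ef.symm
  have hg' := hg.congr eg.symm
  have key : ∀ x ∈ W, ∀ y ∈ A, f' x = f' y → x = y := by
    intro x hx y hy e
    obtain ⟨z, hz, ez⟩ := hKR ⟨hf'.mapsTo hx, e ▸ hg'.mapsTo hy⟩
    rw [← hf'.injOn (hW hz) hx ez, hg'.injOn (hA hz) hy (ez.trans e)]
  refine ⟨hf'.mapsTo.union_union hg'.mapsTo, ?_, hf'.surjOn.union_union hg'.surjOn⟩
  rintro x (hx | hx) y (hy | hy) e
  · exact hf'.injOn hx hy e
  · exact key x hx y hy e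
  · exact (key y hy x hx e.symm).symm
  · exact hg'.injOn hx hy e

/-- The second vertex of a path lies between its ends, so the lengths of the edges add up. This
gives the offsets of new hidden nodes. -/
theorem pathLength_eq [Finite V] {N : Type*} {D : V → V → ℝ} (hD : IsTreeMetric D) {R : Set V}
    (hR : MedClosed D R) {φ : N → V} {A : NamedGraph N} (hA : Models φ A R (skel D R))
    {len : N → N → ℝ} (hlen : ∀ a b, A.graph.Adj a b → len a b = D (φ a) (φ b)) {a b : N}
    (ha : a ∈ A.verts) (hb : b ∈ A.verts) : pathLength A.graph len a b = D (φ a) (φ b) := by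
  have hac := hD.skel_isAcyclic hR
  obtain ⟨l, hl, hlR⟩ := hD.exists_isPathOf (hA.bij.mapsTo ha) (hA.bij.mapsTo hb)
  obtain ⟨h1, h2, h3⟩ := hA.pathList hac ha hb hl fun x hx => ((hlR x).1 hx).1
  unfold pathLength
  have hl' : IsPathOf (skel D R) ((pathList A.graph a b).map φ) (φ a) (φ b) := h1 ▸ hl
  generalize pathList A.graph a b = p at h2 h3 hl'
  clear h1 hlR hl
  induction p generalizing a with
  | nil => exact absurd rfl h2.ne_nil
  | cons x t ih =>
    obtain rfl : x = a := by simpa using h2.head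
    cases t with
    | nil =>
      obtain rfl : x = b := by simpa using h2.last
      simp [hD.self]
    | cons y t =>
      have hc := List.isChain_cons_cons.1 h2.chain
      have h2' : IsPathOf A.graph (y :: t) y b :=
        ⟨hc.2, h2.nodup.of_cons, rfl, by simpa using h2.last⟩
      have hl2 : IsPathOf (skel D R) ((y :: t).map φ) (φ y) (φ b) :=
        ⟨(List.isChain_cons_cons.1 hl'.chain).2, hl'.nodup.of_cons, rfl, by simpa using hl'.last⟩
      have hy : y ∈ A.verts := (hA.supp _ _ hc.1).2
      have := ih hy h2' (fun z hz => h3 z (List.mem_cons_of_mem _ hz)) hl2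
      simp only [List.tail_cons, List.zipWith_cons_cons, List.sum_cons] at this ⊢
      rw [this, hlen _ _ hc.1]
      have hbtw : φ y ∈ pathList (skel D R) (φ x) (φ b) := by
        rw [pathList_eq hac hl']
        simp
      have := ((hD.mem_pathList_skel hR (hA.bij.mapsTo ha) (hA.bij.mapsTo hb)).1 hbtw).2
      exact this.symm

/-- The state of the serial algorithm after the nodes of `S` have been visited. -/
structure CLRGInvariant (D : V → V → ℝ) {obs : Finset V} (sg : V → obs) (S : Set obs)
    (f : Node obs → V) (s : CLRGState obs) : Prop where
  models : Models f s.tree (keep sg S) (contr D sg S)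
  obs_mem : ∀ x, Node.obs x ∈ s.tree.verts
  map_obs : ∀ x, f (Node.obs x) = x
  leader : ∀ p ∈ s.tree.verts, sg (f p) = p.leader
  off : ∀ p ∈ s.tree.verts, s.off p = D (f p) (sg (f p))
  hid : ∀ i r, Node.hid i r ∈ s.tree.verts → i ∈ S

namespace CLRGInvariant

variable [Finite V] {D : V → V → ℝ} {obs : Finset V} {sg : V → obs} (h : IsSurrogateMap D obs sg)
  (hdeg : ∀ v, v ∉ obs → 3 ≤ ((skel D Set.univ).neighborSet v).ncard)
  {d : obs → obs → ℝ} (hd : ∀ x y, x ≠ y → d x y = D x y)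
  {S : Set obs} {f : Node obs → V} {s : CLRGState obs}

include h in
omit [Finite V] in
theorem init : CLRGInvariant D sg ∅ (fun p => p.leader)
    { tree := observedTree (groupGraph D sg), off := fun _ => 0 } where
  models :=
    { bij := by
        refine ⟨?_, ?_, ?_⟩
        · intro p hp
          exact h.obs_mem_keep _
        · intro p hp q hq e
          simp only [observedTree, Finset.coe_image, Finset.coe_univ, Set.image_univ,
            Set.mem_range] at hp hq
          obtain ⟨x, rfl⟩ := hp
          obtain ⟨y, rfl⟩ := hq
          exact congrArg _ (Subtype.ext e)
        · rintro v (hv | hv)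
          · exact absurd hv (Set.notMem_empty _)
          · exact ⟨Node.obs (sg v), by simp [observedTree], hv⟩
      adj := by
        intro p hp q hq
        simp only [observedTree, Finset.mem_image, Finset.mem_univ, true_and] at hp hq
        obtain ⟨x, rfl⟩ := hp
        obtain ⟨y, rfl⟩ := hq
        simp only [observedTree, SimpleGraph.map_adj', Node.leader]
        rw [IsSurrogateMap.contr_empty_adj]
        constructor
        · rintro ⟨-, a, b, k, e1, e2⟩
          cases e1
          cases e2
          exact ⟨x, y, k, rfl, rfl⟩
        · rintro ⟨a, b, k, e1, e2⟩
          obtain rfl : a = x := Subtype.ext e1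
          obtain rfl : b = y := Subtype.ext e2
          exact ⟨fun e => k.ne (Node.obs.inj e), a, b, k, rfl, rfl⟩
      supp := by
        intro p q k
        simp only [observedTree, SimpleGraph.map_adj'] at k
        obtain ⟨-, a, b, -, rfl, rfl⟩ := k
        simp [observedTree] }
  obs_mem x := by simp [observedTree]
  map_obs _ := rfl
  leader p _ := h.sg_obs _
  off p hp := by simp only [h.sg_obs, h.metric.self]
  hid i r hr := by simp [observedTree] at hr

variable (hs : CLRGInvariant D sg S f s) {i : obs} (hi : i ∉ S)
include h hs hi

omit hi [Finite V] in
theorem image_closedNbd : f '' (s.tree.closedNbd (Node.obs i)) = nbd D sg S i := by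
  ext v
  simp only [NamedGraph.closedNbd, Finset.coe_filter, Set.mem_image, Set.mem_ofPred_eq]
  constructor
  · rintro ⟨p, ⟨hp, rfl | k⟩, rfl⟩
    · exact Or.inl (hs.map_obs i)
    · right
      rw [← hs.map_obs i]
      exact (hs.models.adj _ (hs.obs_mem i) _ hp).1 k
  · rintro (rfl | k)
    · exact ⟨Node.obs i, ⟨hs.obs_mem i, Or.inl rfl⟩, hs.map_obs i⟩
    · obtain ⟨p, hp, rfl⟩ := hs.models.bij.surjOn (h.contr_supp k).2
      rw [← hs.map_obs i] at k
      exact ⟨p, ⟨hp, Or.inr ((hs.models.adj _ (hs.obs_mem i) _ hp).2 k)⟩, rfl⟩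

include hdeg hd in
/-- Recursive grouping on the neighborhood of `i` recovers the group of `i`. -/
theorem groupAt_spec : ∃ φ, Set.EqOn φ f (s.tree.closedNbd (Node.obs i)) ∧
    Models φ (groupAt d s.off s.tree i).tree (region D sg S i) (skel D (region D sg S i)) ∧
    s.tree.closedNbd (Node.obs i) ⊆ (groupAt d s.off s.tree i).tree.verts ∧
    (∀ p ∈ (groupAt d s.off s.tree i).tree.verts,
      p ∈ s.tree.closedNbd (Node.obs i) ∨ ∃ r, p = Node.hid i r) ∧
    ∀ a b, (groupAt d s.off s.tree i).tree.graph.Adj a b →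
      (groupAt d s.off s.tree i).len a b = D (φ a) (φ b) := by
  have : Nonempty (Node obs) := ⟨Node.obs i⟩
  have hsub : s.tree.closedNbd (Node.obs i) ⊆ s.tree.verts := Finset.filter_subset _ _
  have himg := hs.image_closedNbd h (i := i)
  have hfresh : Function.Injective (Node.hid i) := fun a b e => (Node.hid.inj e).2
  have := recursiveGrouping_spec h.metric hfresh (φ₀ := f)
    (Ω := s.tree.closedNbd (Node.obs i)) (d := nodeDist d s.off)
    ⟨Node.obs i, by simp [NamedGraph.closedNbd, hs.obs_mem]⟩
    (hs.models.bij.injOn.mono (Finset.coe_subset.2 hsub))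
    (by
      intro a ha b hb hab
      have ha' : f a ∈ nbd D sg S i := himg ▸ ⟨a, ha, rfl⟩
      have hb' : f b ∈ nbd D sg S i := himg ▸ ⟨b, hb, rfl⟩
      obtain ⟨k1, k2⟩ := h.dist_sg_nbd hi ha' hb'
        fun e => hab (hs.models.bij.injOn (hsub ha) (hsub hb) e)
      unfold nodeDist
      rw [hs.off a (hsub ha), hs.off b (hsub hb), ← hs.leader a (hsub ha),
        ← hs.leader b (hsub hb), hd _ _ k1, k2]
      ring)
    (fun r hr => hi (hs.hid i r (hsub hr)))
  rw [himg, h.medClosure_nbd hi hdeg] at this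
  exact this

omit h hs [Finite V] in
-- Old and new nodes overlap only in the neighborhood, where they can be glued. The serial algorithm
-- needs `S' = S`, the parallel one `S' = ∅`.
theorem keep_inter_region {S' : Set obs} :
    keep sg S ∩ region D sg S' i ⊆ nbd D sg S' i := by
  rintro v ⟨hv, hv' | hv'⟩
  · rcases hv with hv | hv
    · exact absurd (hv' ▸ hv) hi
    · left
      rw [← hv]
      exact congrArg _ hv'
  · exact hv'

include hdeg hd in
theorem step : ∃ f', CLRGInvariant D sg (insert i S) f' (clrgStep d s i) := by
  obtain ⟨φ, hφf, hφ, hΩA, hA, hlen⟩ := hs.groupAt_spec h hdeg hd hi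
  have himg := hs.image_closedNbd h (i := i)
  have hΩ : s.tree.closedNbd (Node.obs i) ⊆ s.tree.verts := Finset.filter_subset _ _
  unfold clrgStep
  generalize groupAt d s.off s.tree i = g at hφ hΩA hA hlen ⊢
  have hmc : MedClosed D (region D sg S i) := by
    rw [← h.medClosure_nbd hi hdeg]
    exact h.metric.medClosed_medClosure _
  -- Old nodes keep their places and new ones are placed by `φ`. The two placements agree on common
  -- names, because no name `Node.hid i r` is in use before `i` is visited.
  set f' : Node obs → V := fun p => if p ∈ s.tree.verts then f p else φ p with hf'
  have ef : Set.EqOn f' f s.tree.verts := fun p hp => if_pos hp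
  have eφ : Set.EqOn f' φ g.tree.verts := by
    intro p hp
    by_cases hpW : p ∈ s.tree.verts
    · rcases hA p hp with k | ⟨r, rfl⟩
      · exact (ef hpW).trans (hφf k).symm
      · exact absurd (hs.hid i r hpW) hi
    · exact if_neg hpW
  have himg' : f' '' (s.tree.closedNbd (Node.obs i)) = nbd D sg S i := by
    rw [← himg]
    exact Set.image_congr fun p hp => ef (hΩ hp)
  have hbij : Set.BijOn f' (s.tree.verts ∪ g.tree.verts : Finset (Node obs))
      (keep sg (insert i S)) := by
    rw [h.keep_insert, Finset.coe_union]
    refine bijOn_union_of_agree hs.models.bij hφ.bij ef eφ (Finset.coe_subset.2 hΩ)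
      (Finset.coe_subset.2 hΩA) ?_
    rw [himg']
    exact keep_inter_region hi
  have hnew : ∀ p ∈ g.tree.verts, p ∉ s.tree.verts → f' p = φ p ∧ sg (φ p) = i ∧ p.leader = i := by
    intro p hp hpW
    refine ⟨eφ hp, ?_, ?_⟩
    · rcases hφ.bij.mapsTo hp with k | k
      · exact k
      · rw [← himg] at k
        obtain ⟨q, hq, e⟩ := k
        rw [← hφf hq] at e
        exact absurd (hφ.bij.injOn (hΩA hq) hp e ▸ hΩ hq) hpW
    · rcases hA p hp with k | ⟨r, rfl⟩
      · exact absurd (hΩ k) hpW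
      · rfl
  have hmemW : ∀ p ∈ s.tree.verts ∪ g.tree.verts, f' p ∈ keep sg S → p ∈ s.tree.verts := by
    intro p hp k
    obtain ⟨q, hq, e⟩ := hs.models.bij.surjOn k
    rw [← ef hq] at e
    exact hbij.injOn (Finset.mem_union_left _ hq) hp e ▸ hq
  have hmemA : ∀ p ∈ s.tree.verts ∪ g.tree.verts, f' p ∈ region D sg S i → p ∈ g.tree.verts := by
    intro p hp k
    obtain ⟨q, hq, e⟩ := hφ.bij.surjOn k
    rw [← eφ hq] at e
    exact hbij.injOn (Finset.mem_union_right _ hq) hp e ▸ hq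
  have hΩ_iff : ∀ p ∈ s.tree.verts, p ∈ s.tree.closedNbd (Node.obs i) ↔
      f p ∈ nbd D sg S i := by
    intro p hp
    rw [← himg]
    refine ⟨fun k => ⟨p, k, rfl⟩, fun ⟨q, hq, e⟩ => ?_⟩
    exact hs.models.bij.injOn (hΩ hq) hp e ▸ hq
  have hrel : ∀ a b, (s.tree.graph.Adj a b ∧ ¬ (a ∈ s.tree.closedNbd (Node.obs i) ∧
      b ∈ s.tree.closedNbd (Node.obs i))) ∨ g.tree.graph.Adj a b →
      (contr D sg (insert i S)).Adj (f' a) (f' b) ∧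
        a ∈ s.tree.verts ∪ g.tree.verts ∧ b ∈ s.tree.verts ∪ g.tree.verts := by
    rintro a b (⟨k, kn⟩ | k)
    · obtain ⟨ha, hb⟩ := hs.models.supp a b k
      refine ⟨?_, Finset.mem_union_left _ ha, Finset.mem_union_left _ hb⟩
      rw [h.contr_insert_adj hi, ef ha, ef hb]
      have k' := (hs.models.adj a ha b hb).1 k
      rw [hΩ_iff a ha, hΩ_iff b hb, h.not_mem_nbd_iff hi k'] at kn
      exact Or.inl ⟨k', kn⟩
    · obtain ⟨ha, hb⟩ := hφ.supp a b k
      refine ⟨?_, Finset.mem_union_right _ ha, Finset.mem_union_right _ hb⟩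
      rw [h.contr_insert_adj hi, eφ ha, eφ hb]
      exact Or.inr ((hφ.adj a ha b hb).1 k)
  refine ⟨f', ⟨⟨hbij, ?_, ?_⟩, ?_, ?_, ?_, ?_, ?_⟩⟩
  · intro a ha b hb
    simp only [SimpleGraph.fromRel_adj]
    constructor
    · rintro ⟨-, k | k⟩
      · exact (hrel a b k).1
      · exact (hrel b a k).1.symm
    · intro k
      refine ⟨fun e => k.ne (congrArg _ e), Or.inl ?_⟩
      rcases (h.contr_insert_adj hi).1 k with ⟨k, kn⟩ | k
      · have ha' := hmemW a ha (h.contr_supp k).1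
        have hb' := hmemW b hb (h.contr_supp k).2
        rw [← h.not_mem_nbd_iff hi k] at kn
        rw [ef ha', ef hb'] at k kn
        rw [← hΩ_iff a ha', ← hΩ_iff b hb'] at kn
        exact Or.inl ⟨(hs.models.adj a ha' b hb').2 k, kn⟩
      · have ha' := hmemA a ha k.1
        have hb' := hmemA b hb k.2.1
        rw [eφ ha', eφ hb'] at k
        exact Or.inr ((hφ.adj a ha' b hb').2 k)
  · intro a b k
    simp only [SimpleGraph.fromRel_adj] at k
    rcases k.2 with k | k
    · exact (hrel a b k).2
    · exact (hrel b a k).2.symm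
  · exact fun x => Finset.mem_union_left _ (hs.obs_mem x)
  · exact fun x => (ef (hs.obs_mem x)).trans (hs.map_obs x)
  · intro p hp
    by_cases hpW : p ∈ s.tree.verts
    · rw [ef hpW, hs.leader p hpW]
    · obtain ⟨e1, e2, e3⟩ := hnew p ((Finset.mem_union.1 hp).resolve_left hpW) hpW
      rw [e1, e2, e3]
  · intro p hp
    by_cases hpW : p ∈ s.tree.verts
    · simp only
      rw [if_neg fun k => k.2 hpW, ef hpW, hs.off p hpW]
    · have hpA := (Finset.mem_union.1 hp).resolve_left hpW
      obtain ⟨e1, e2, e3⟩ := hnew p hpA hpW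
      have hiΩ : Node.obs i ∈ s.tree.closedNbd (Node.obs i) := by
        simp [NamedGraph.closedNbd, hs.obs_mem]
      simp only
      rw [if_pos ⟨hpA, hpW⟩, pathLength_eq h.metric hmc hφ hlen (hΩA hiΩ) hpA, e1, e2,
        hφf hiΩ, hs.map_obs, h.metric.symm]
  · intro j r hr
    rcases Finset.mem_union.1 hr with k | k
    · exact Set.mem_insert_of_mem _ (hs.hid j r k)
    · rcases hA _ k with k | ⟨r', e⟩
      · exact Set.mem_insert_of_mem _ (hs.hid j r (hΩ k))
      · rw [(Node.hid.inj e).1]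
        exact Set.mem_insert _ _

end CLRGInvariant

end Serial

/-! ### The parallel algorithm -/

section Parallel

variable {V : Type*}

namespace IsSurrogateMap

variable {D : V → V → ℝ} {obs : Finset V} {sg : V → obs} (h : IsSurrogateMap D obs sg)
  {S : Set obs} {i : obs}
include h

theorem sg_of_mem_pathList [Finite V] {a b x : V} (e : sg a = sg b)
    (hx : x ∈ pathList (skel D Set.univ) a b) : sg x = sg a :=
  h.sg_of_btw_of_eq e ((h.metric.mem_pathList_skel (fun _ _ _ _ _ _ _ _ => trivial) trivial
    trivial).1 hx).2

theorem isPathOf_pathList_univ [Finite V] (a b : V) :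
    IsPathOf (skel D Set.univ) (pathList (skel D Set.univ) a b) a b :=
  have : Nonempty V := ⟨a⟩
  isPathOf_pathList (h.metric.connected.preconnected a b)

/-- The paths from `i` to a neighbor `j` in the contracted tree and in the local tree. -/
theorem exists_paths [Finite V] (hi : i ∉ S) (j : obs) : ∃ u v P Q,
    (groupGraph D sg).Adj i j → TAdj D u v ∧ sg u = i ∧ sg v = j ∧
      IsPathOf (skel D (region D sg ∅ i)) P i u ∧ (∀ x ∈ P, sg x = i) ∧
      IsPathOf (contr D sg S) Q (retract sg S v) j ∧
      ∀ x ∈ Q, sg x = j ∧ x ∈ keep sg S := by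
  by_cases hij : (groupGraph D sg).Adj i j
  swap
  -- The witnesses are arbitrary if `j` is not a neighbor; the implication under the quantifiers
  -- allows choosing the paths for all `j` at once.
  · exact ⟨i, i, [], [], fun k => absurd k hij⟩
  obtain ⟨hne, u, v, huv, rfl, rfl⟩ := hij
  have hP : ∀ x ∈ pathList (skel D Set.univ) (sg u) u, sg x = sg u := fun x hx =>
    (h.sg_of_mem_pathList (h.sg_obs _) hx).trans (h.sg_obs _)
  have hP' : IsPathOf (skel D (region D sg ∅ (sg u))) (pathList (skel D Set.univ) (sg u) u)
      (sg u) u :=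
    (h.isPathOf_pathList_univ _ _).mono fun x hx y hy k =>
      (h.skel_region_adj (Set.notMem_empty _)).2 (Or.inl ⟨k, hP x hx, hP y hy⟩)
  by_cases hv : sg v ∈ S
  · have hQ : ∀ x ∈ pathList (skel D Set.univ) v (sg v), sg x = sg v := fun x hx =>
      h.sg_of_mem_pathList (h.sg_obs _).symm hx
    refine ⟨u, v, _, pathList (skel D Set.univ) v (sg v), fun _ => ⟨huv, rfl, rfl, hP', hP, ?_,
      fun x hx => ⟨hQ x hx, Or.inl (hQ x hx ▸ hv)⟩⟩⟩
    rw [retract_of_sg_mem hv]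
    exact (h.isPathOf_pathList_univ _ _).mono fun x hx y hy k =>
      ⟨k.ne, x, y, k, retract_of_sg_mem (hQ x hx ▸ hv), retract_of_sg_mem (hQ y hy ▸ hv)⟩
  · refine ⟨u, v, _, [(sg v : V)], fun _ => ⟨huv, rfl, rfl, hP', hP, ?_, fun x hx => ?_⟩⟩
    · rw [retract_of_notMem hv]
      exact isPathOf_singleton _ _
    · obtain rfl : x = sg v := by simpa using hx
      exact ⟨h.sg_obs _, h.obs_mem_keep _⟩

omit h in
theorem groupGraph_adj_of_tadj {u v : V} (k : TAdj D u v) (hu : sg u = i) (hv : sg v ≠ i) :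
    (groupGraph D sg).Adj i (sg v) := ⟨hv.symm, u, v, k, hu, rfl⟩

/-- Merging the local tree of `i` into the contracted tree for `S` gives the contracted tree for
`S` with `i`. -/
theorem contr_insert_adj_iff_merge (hi : i ∉ S) {u v : obs → V} {P Q : obs → List V}
    (hpaths : ∀ j, (groupGraph D sg).Adj i j → TAdj D (u j) (v j) ∧ sg (u j) = i ∧ sg (v j) = j ∧
      IsPathOf (skel D (region D sg ∅ i)) (P j) i (u j) ∧ (∀ x ∈ P j, sg x = i) ∧
      IsPathOf (contr D sg S) (Q j) (retract sg S (v j)) j ∧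
      ∀ x ∈ Q j, sg x = j ∧ x ∈ keep sg S) (p q : V) :
    (contr D sg (insert i S)).Adj p q ↔
      ((contr D sg S).Adj p q ∧
        ¬ ∃ j, (groupGraph D sg).Adj i j ∧ Consecutive ([(i : V)] ++ Q j) p q) ∨
      ((skel D (region D sg ∅ i)).Adj p q ∧
        ¬ ∃ j, (groupGraph D sg).Adj i j ∧ Consecutive (P j ++ [(j : V)]) p q) ∨
      ∃ j, (groupGraph D sg).Adj i j ∧ Consecutive (P j ++ Q j) p q := by
  have hi0 : i ∉ (∅ : Set obs) := Set.notMem_empty i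
  -- With `uv` the edge of `T` between the groups, the path from `i` to `j` is `i, Q` in the
  -- contracted tree, `P, j` in the local tree, and `P, Q` after the union. The net effect is that
  -- the shortcuts from `i` to the retract of `v` and from `u` to `j` give way to the edge from `u`
  -- to the retract of `v`.
  have cT : ∀ j, (groupGraph D sg).Adj i j → (Consecutive ([(i : V)] ++ Q j) p q ↔
      Consecutive (Q j) p q ∨ (p = i ∧ q = retract sg S (v j)) ∨
        (p = retract sg S (v j) ∧ q = i)) := by
    intro j hj
    obtain ⟨-, -, -, -, -, k, -⟩ := hpaths j hj
    rw [consecutive_append (a := (i : V)) rfl k.head]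
    have := @not_consecutive_singleton _ (i : V) p q
    tauto
  have cA : ∀ j, (groupGraph D sg).Adj i j → (Consecutive (P j ++ [(j : V)]) p q ↔
      Consecutive (P j) p q ∨ (p = u j ∧ q = j) ∨ (p = j ∧ q = u j)) := by
    intro j hj
    obtain ⟨-, -, -, k, -, -, -⟩ := hpaths j hj
    rw [consecutive_append (b := (j : V)) k.last rfl]
    have := @not_consecutive_singleton _ (j : V) p q
    tauto
  have cU : ∀ j, (groupGraph D sg).Adj i j → (Consecutive (P j ++ Q j) p q ↔
      Consecutive (P j) p q ∨ Consecutive (Q j) p q ∨ (p = u j ∧ q = retract sg S (v j)) ∨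
        (p = retract sg S (v j) ∧ q = u j)) := by
    intro j hj
    obtain ⟨-, -, -, k, -, k', -⟩ := hpaths j hj
    exact consecutive_append k.last k'.head
  have cross : ∀ a b, TAdj D a b → sg a = i → sg b ≠ i →
      (groupGraph D sg).Adj i (sg b) ∧ a = u (sg b) ∧ b = v (sg b) := by
    intro a b k ha hb
    have hj := groupGraph_adj_of_tadj k ha hb
    obtain ⟨k', eu, ev, -⟩ := hpaths _ hj
    obtain ⟨e1, e2⟩ := h.crossing_unique k' k (by rw [eu, ev]; exact hb.symm) (ha.trans eu.symm)
      ev.symm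
    exact ⟨hj, e1, e2⟩
  have atT : ∀ a b, (contr D sg S).Adj a b → sg a = i → ∃ w, TAdj D (u (sg w)) w ∧
      (groupGraph D sg).Adj i (sg w) ∧ a = i ∧ b = retract sg S (v (sg w)) := by
    rintro a b ⟨hne, x, y, hxy, rfl, rfl⟩ ha
    rw [h.sg_retract] at ha
    have hy : sg y ≠ i := by
      intro e
      rw [retract_of_notMem (by rwa [ha]), retract_of_notMem (by rwa [e]), ha, e] at hne
      exact hne rfl
    obtain ⟨k1, k2, k3⟩ := cross x y hxy ha hy
    refine ⟨y, k2 ▸ hxy, k1, ?_, by rw [← k3]⟩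
    rw [retract_of_notMem (by rwa [ha]), ha]
  rw [h.contr_insert_adj hi, h.skel_region_adj hi]
  constructor
  · rintro (⟨k, kp, kq⟩ | ⟨k, kp, kq⟩ | ⟨w, k, kp, kw, rfl⟩ | ⟨w, k, kp, kw, rfl⟩)
    · by_cases hex : ∃ j, (groupGraph D sg).Adj i j ∧ Consecutive ([(i : V)] ++ Q j) p q
      · obtain ⟨j, hj, c⟩ := hex
        rcases (cT j hj).1 c with c | ⟨e, -⟩ | ⟨-, e⟩
        · exact Or.inr (Or.inr ⟨j, hj, (cU j hj).2 (Or.inr (Or.inl c))⟩)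
        · exact absurd (e ▸ h.sg_obs i) kp
        · exact absurd (e ▸ h.sg_obs i) kq
      · exact Or.inl ⟨k, hex⟩
    · by_cases hex : ∃ j, (groupGraph D sg).Adj i j ∧ Consecutive (P j ++ [(j : V)]) p q
      · obtain ⟨j, hj, c⟩ := hex
        rcases (cA j hj).1 c with c | ⟨-, e⟩ | ⟨e, -⟩
        · exact Or.inr (Or.inr ⟨j, hj, (cU j hj).2 (Or.inl c)⟩)
        · rw [e, h.sg_obs] at kq
          exact absurd kq.symm hj.ne
        · rw [e, h.sg_obs] at kp
          exact absurd kp.symm hj.ne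
      · exact Or.inr (Or.inl ⟨(h.skel_region_adj hi0).2 (Or.inl ⟨k, kp, kq⟩), hex⟩)
    · obtain ⟨hj, e1, e2⟩ := cross p w k kp kw
      exact Or.inr (Or.inr ⟨_, hj, (cU _ hj).2 (Or.inr (Or.inr (Or.inl ⟨e1, by rw [← e2]⟩)))⟩)
    · obtain ⟨hj, e1, e2⟩ := cross q w k kp kw
      exact Or.inr (Or.inr ⟨_, hj, (cU _ hj).2 (Or.inr (Or.inr (Or.inr ⟨by rw [← e2], e1⟩)))⟩)
  · rintro (⟨k, hn⟩ | ⟨k, hn⟩ | ⟨j, hj, c⟩)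
    · refine Or.inl ⟨k, fun e => hn ?_, fun e => hn ?_⟩
      · obtain ⟨w, -, hj, e1, e2⟩ := atT p q k e
        exact ⟨_, hj, (cT _ hj).2 (Or.inr (Or.inl ⟨e1, e2⟩))⟩
      · obtain ⟨w, -, hj, e1, e2⟩ := atT q p k.symm e
        exact ⟨_, hj, (cT _ hj).2 (Or.inr (Or.inr ⟨e2, e1⟩))⟩
    · rw [h.skel_region_adj hi0] at k
      rcases k with k | ⟨w, k, kp, kw, rfl⟩ | ⟨w, k, kp, kw, rfl⟩
      · exact Or.inr (Or.inl k)
      · obtain ⟨hj, e1, e2⟩ := cross p w k kp kw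
        exact absurd ⟨_, hj, (cA _ hj).2 (Or.inr (Or.inl ⟨e1,
          retract_of_notMem (Set.notMem_empty _)⟩))⟩ hn
      · obtain ⟨hj, e1, e2⟩ := cross q w k kp kw
        exact absurd ⟨_, hj, (cA _ hj).2 (Or.inr (Or.inr
          ⟨retract_of_notMem (Set.notMem_empty _), e1⟩))⟩ hn
    · obtain ⟨huv, eu, ev, hP, hP', hQ, hQ'⟩ := hpaths j hj
      rcases (cU j hj).1 c with c | c | ⟨e1, e2⟩ | ⟨e1, e2⟩
      · have kp := hP' p c.mem.1
        have kq := hP' q c.mem.2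
        rcases (h.skel_region_adj hi0).1 (c.adj hP.chain) with k | ⟨w, -, -, kw, e⟩ | ⟨w, -, -, kw, e⟩
        · exact Or.inr (Or.inl k)
        · rw [e, h.sg_retract] at kq
          exact absurd kq kw
        · rw [e, h.sg_retract] at kp
          exact absurd kp kw
      · exact Or.inl ⟨c.adj hQ.chain, (hQ' p c.mem.1).1 ▸ hj.ne', (hQ' q c.mem.2).1 ▸ hj.ne'⟩
      · exact Or.inr (Or.inr (Or.inl ⟨v j, e1 ▸ huv, e1 ▸ eu, by rw [ev]; exact hj.ne', e2⟩))
      · exact Or.inr (Or.inr (Or.inr ⟨v j, e2 ▸ huv, e2 ▸ eu, by rw [ev]; exact hj.ne', e1⟩))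

theorem isPathOf_append_leader {j : obs} (hj : (groupGraph D sg).Adj i j) {u v : V}
    (huv : TAdj D u v) (eu : sg u = i) (ev : sg v = j) {P : List V}
    (hP : IsPathOf (skel D (region D sg ∅ i)) P i u) (hP' : ∀ x ∈ P, sg x = i) :
    IsPathOf (skel D (region D sg ∅ i)) (P ++ [(j : V)]) i j ∧
      ∀ x ∈ P ++ [(j : V)], x ∈ region D sg ∅ i := by
  have hi0 : i ∉ (∅ : Set obs) := Set.notMem_empty i
  have hjr : (j : V) = retract sg ∅ v := by
    rw [IsSurrogateMap.retract_of_notMem (Set.notMem_empty _), ev]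
  refine ⟨hP.append (isPathOf_singleton _ _) ((h.skel_region_adj hi0).2
    (Or.inr (Or.inl ⟨v, huv, eu, by rw [ev]; exact hj.ne', hjr⟩))) ?_, ?_⟩
  · intro x hx hx'
    obtain rfl : x = j := by simpa using hx'
    have := hP' _ hx
    rw [h.sg_obs] at this
    exact hj.ne' this
  · intro x hx
    rcases List.mem_append.1 hx with hx | hx
    · exact Or.inl (hP' x hx)
    · obtain rfl : x = j := by simpa using hx
      exact Or.inr ((h.mem_nbd hi0).2 (Or.inr ⟨u, v, huv, eu, by rw [ev]; exact hj.ne', hjr⟩))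

end IsSurrogateMap

/-- The placement `φ` of the local tree `A` of `i`. -/
structure IsLocalPlacement (D : V → V → ℝ) {obs : Finset V} (sg : V → obs) (i : obs)
    (A : NamedGraph (Node obs)) (φ : Node obs → V) : Prop where
  models : Models φ A (region D sg ∅ i) (skel D (region D sg ∅ i))
  map_obs : ∀ x, φ (Node.obs x) = x
  obs_mem : ∀ x, Node.obs x ∈ A.verts ↔ (x : V) ∈ nbd D sg ∅ i
  names : ∀ p ∈ A.verts, (∃ x, p = Node.obs x) ∨ ∃ r, p = Node.hid i r

namespace IsSurrogateMap

variable [Finite V] {D : V → V → ℝ} {obs : Finset V} {sg : V → obs} (h : IsSurrogateMap D obs sg)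
  (hdeg : ∀ v, v ∉ obs → 3 ≤ ((skel D Set.univ).neighborSet v).ncard)
  {d : obs → obs → ℝ} (hd : ∀ x y, x ≠ y → d x y = D x y)
include h hdeg hd

theorem exists_isLocalPlacement (i : obs) :
    ∃ φ, IsLocalPlacement D sg i (localTree d (groupGraph D sg) i) φ := by
  have hinit := CLRGInvariant.init h
  have hi : i ∉ (∅ : Set obs) := Set.notMem_empty i
  obtain ⟨φ, e, hφ, hΩ, hA, -⟩ := hinit.groupAt_spec h hdeg hd hi
  have himg := hinit.image_closedNbd h (i := i)
  have hnames : ∀ p ∈ (observedTree (groupGraph D sg)).closedNbd (Node.obs i),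
      ∃ x, p = Node.obs x := by
    intro p hp
    have := (Finset.mem_filter.1 hp).1
    simp only [observedTree, Finset.mem_image, Finset.mem_univ, true_and] at this
    obtain ⟨x, rfl⟩ := this
    exact ⟨x, rfl⟩
  have hΩ' : ∀ x, Node.obs x ∈ (localTree d (groupGraph D sg) i).verts →
      Node.obs x ∈ (observedTree (groupGraph D sg)).closedNbd (Node.obs i) := by
    intro x hx
    rcases hA _ hx with k | ⟨r, k⟩
    · exact k
    · cases k
  -- Nothing is known about `φ` at names outside the local tree, so the observed names are placed by
  -- hand.
  refine ⟨fun p => if ∃ x, p = Node.obs x then p.leader else φ p, ?_, ?_, ?_, ?_⟩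
  · refine hφ.congr fun p hp => ?_
    split_ifs with k
    · obtain ⟨x, rfl⟩ := k
      exact (e (hΩ' x hp)).symm
    · rfl
  · intro x
    exact if_pos ⟨x, rfl⟩
  · intro x
    rw [← himg]
    constructor
    · intro hx
      exact ⟨_, hΩ' x hx, rfl⟩
    · rintro ⟨p, hp, ep⟩
      obtain ⟨y, rfl⟩ := hnames p hp
      obtain rfl : y = x := Subtype.ext ep
      exact hΩ hp
  · intro p hp
    exact (hA p hp).imp_left (hnames p)

end IsSurrogateMap

/-- The tree of the parallel algorithm after the local trees of `S` have been merged. -/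
structure LRGInvariant (D : V → V → ℝ) {obs : Finset V} (sg : V → obs) (S : Set obs)
    (f : Node obs → V) (T : NamedGraph (Node obs)) : Prop where
  models : Models f T (keep sg S) (contr D sg S)
  obs_mem : ∀ x, Node.obs x ∈ T.verts

theorem LRGInvariant.merge [Finite V] {D : V → V → ℝ} {obs : Finset V} {sg : V → obs}
    (h : IsSurrogateMap D obs sg)
    (hdeg : ∀ v, v ∉ obs → 3 ≤ ((skel D Set.univ).neighborSet v).ncard) {S : Set obs} {f : Node obs → V} {T A : NamedGraph (Node obs)}
    (hT : LRGInvariant D sg S f T) {i : obs} (hi : i ∉ S) {φ : Node obs → V}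
    (hA : IsLocalPlacement D sg i A φ) (hf : ∀ x, f (Node.obs x) = x)
    (hfφ : ∀ p ∈ A.verts, f p = φ p) :
    LRGInvariant D sg (insert i S) f (mergeAt (groupGraph D sg) i T A) := by
  have hD := h.metric
  have hi0 : i ∉ (∅ : Set obs) := Set.notMem_empty i
  have hAm : Models f A (region D sg ∅ i) (skel D (region D sg ∅ i)) := hA.models.congr hfφ
  -- The local tree is built over the region for `∅`, not for `S`. The two regions contain the same
  -- group of `i`, and their other points are kept anyway.
  have hreg : region D sg (∅ : Set obs) i ∪ keep sg S = region D sg S i ∪ keep sg S := by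
    ext x
    simp only [region, Set.mem_union]
    have h1 : x ∈ nbd D sg ∅ i → x ∈ keep sg S := by
      intro hx
      rcases (h.mem_nbd hi0).1 hx with rfl | ⟨u, v, -, -, -, rfl⟩
      · exact h.obs_mem_keep i
      · rw [IsSurrogateMap.retract_of_notMem (Set.notMem_empty _)]
        exact h.obs_mem_keep _
    have h2 : x ∈ nbd D sg S i → x ∈ keep sg S := by
      intro hx
      rcases (h.mem_nbd hi).1 hx with rfl | ⟨u, v, -, -, -, rfl⟩
      · exact h.obs_mem_keep i
      · exact h.retract_mem_keep v
    tauto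
  have hbij : Set.BijOn f (T.verts ∪ A.verts : Finset (Node obs)) (keep sg (insert i S)) := by
    have e : keep sg (insert i S) = keep sg S ∪ region D sg ∅ i := by
      rw [h.keep_insert, Set.union_comm, ← hreg, Set.union_comm]
    rw [e, Finset.coe_union]
    refine bijOn_union_of_agree (Ω := Node.obs '' {x : obs | (x : V) ∈ nbd D sg ∅ i}) hT.models.bij
      hAm.bij (fun _ _ => rfl) (fun _ _ => rfl) ?_ ?_ ?_
    · rintro _ ⟨x, -, rfl⟩
      exact hT.obs_mem x
    · rintro _ ⟨x, hx, rfl⟩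
      exact (hA.obs_mem x).2 hx
    · intro x hx
      have hx' := CLRGInvariant.keep_inter_region hi hx
      have : ∃ y : obs, (y : V) = x := by
        rcases (h.mem_nbd hi0).1 hx' with rfl | ⟨u, v, -, -, -, rfl⟩
        · exact ⟨i, rfl⟩
        · exact ⟨sg v, (IsSurrogateMap.retract_of_notMem (Set.notMem_empty _)).symm⟩
      obtain ⟨y, rfl⟩ := this
      exact ⟨Node.obs y, ⟨y, hx', rfl⟩, hf y⟩
  have hjA : ∀ j, (groupGraph D sg).Adj i j → Node.obs j ∈ A.verts := fun j hj =>
    (hA.obs_mem j).2 (Or.inr (IsSurrogateMap.contr_empty_adj.2 ⟨i, j, hj, rfl, rfl⟩))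
  have hiA : Node.obs i ∈ A.verts := (hA.obs_mem i).2 (Or.inl rfl)
  have hmemT : ∀ p ∈ T.verts ∪ A.verts, f p ∈ keep sg S → p ∈ T.verts := by
    intro p hp k
    obtain ⟨q, hq, e⟩ := hT.models.bij.surjOn k
    exact hbij.injOn (Finset.mem_union_left _ hq) hp e ▸ hq
  have hmemA : ∀ p ∈ T.verts ∪ A.verts, f p ∈ region D sg ∅ i → p ∈ A.verts := by
    intro p hp k
    obtain ⟨q, hq, e⟩ := hAm.bij.surjOn k
    exact hbij.injOn (Finset.mem_union_right _ hq) hp e ▸ hq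
  choose u v P Q hpaths using fun j => h.exists_paths hi j
  have hac : (skel D (region D sg ∅ i)).IsAcyclic := by
    rw [← h.medClosure_nbd hi0 hdeg]
    exact hD.skel_isAcyclic (hD.medClosed_medClosure _)
  have hQS : ∀ j, (groupGraph D sg).Adj i j → IsPathOf (contr D sg S) ([(i : V)] ++ Q j) i j ∧
      ∀ x ∈ [(i : V)] ++ Q j, x ∈ keep sg S := by
    intro j hj
    obtain ⟨huv, eu, ev, -, -, hQ, hQ'⟩ := hpaths j hj
    refine ⟨(isPathOf_singleton _ _).append hQ ⟨?_, u j, v j, huv, ?_, rfl⟩ ?_, ?_⟩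
    · intro e
      have := (hQ' _ hQ.start_mem).1
      rw [← e, h.sg_obs] at this
      exact hj.ne this
    · rw [IsSurrogateMap.retract_of_notMem (by rwa [eu]), eu]
    · intro x hx hx'
      obtain rfl : x = i := by simpa using hx
      have := (hQ' _ hx').1
      rw [h.sg_obs] at this
      exact hj.ne this
    · intro x hx
      rcases List.mem_append.1 hx with hx | hx
      · obtain rfl : x = i := by simpa using hx
        exact h.obs_mem_keep i
      · exact (hQ' x hx).2
  have hPS : ∀ j, (groupGraph D sg).Adj i j →
      IsPathOf (skel D (region D sg ∅ i)) (P j ++ [(j : V)]) i j ∧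
      ∀ x ∈ P j ++ [(j : V)], x ∈ region D sg ∅ i := by
    intro j hj
    obtain ⟨huv, eu, ev, hP, hP', -, -⟩ := hpaths j hj
    exact h.isPathOf_append_leader hj huv eu ev hP hP'
  have pT : ∀ j, (groupGraph D sg).Adj i j →
      (pathList T.graph (Node.obs i) (Node.obs j)).map f = [(i : V)] ++ Q j ∧
      ∀ x ∈ pathList T.graph (Node.obs i) (Node.obs j), x ∈ T.verts := by
    intro j hj
    have := hT.models.pathList h.contr_isAcyclic (hT.obs_mem i) (hT.obs_mem j)
      (l := [(i : V)] ++ Q j) (by rw [hf, hf]; exact (hQS j hj).1) (hQS j hj).2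
    exact ⟨this.1, this.2.2⟩
  have pA : ∀ j, (groupGraph D sg).Adj i j →
      (pathList A.graph (Node.obs i) (Node.obs j)).map f = P j ++ [(j : V)] ∧
      ∀ x ∈ pathList A.graph (Node.obs i) (Node.obs j), x ∈ A.verts := by
    intro j hj
    have := hAm.pathList hac hiA (hjA j hj)
      (l := P j ++ [(j : V)]) (by rw [hf, hf]; exact (hPS j hj).1) (hPS j hj).2
    exact ⟨this.1, this.2.2⟩
  set s : Set (Node obs) := ((T.verts ∪ A.verts : Finset (Node obs)) : Set (Node obs)) with hs
  have sT : ∀ p ∈ T.verts, p ∈ s := fun p hp => Finset.mem_union_left _ hp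
  have sA : ∀ p ∈ A.verts, p ∈ s := fun p hp => Finset.mem_union_right _ hp
  have sU : ∀ j, (groupGraph D sg).Adj i j →
      ∀ x ∈ unionPath (pathList A.graph (Node.obs i) (Node.obs j))
        (pathList T.graph (Node.obs i) (Node.obs j)), x ∈ s := by
    intro j hj x hx
    rcases List.mem_append.1 hx with hx | hx
    · exact sA _ ((pA j hj).2 x (List.dropLast_subset _ hx))
    · exact sT _ ((pT j hj).2 x (List.mem_of_mem_tail hx))
  have key : ∀ a b, a ∈ s → b ∈ s → ((contr D sg (insert i S)).Adj (f a) (f b) ↔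
      (T.graph.Adj a b ∧ ¬ ∃ j, (groupGraph D sg).Adj i j ∧
        Consecutive (pathList T.graph (Node.obs i) (Node.obs j)) a b) ∨
      (A.graph.Adj a b ∧ ¬ ∃ j, (groupGraph D sg).Adj i j ∧
        Consecutive (pathList A.graph (Node.obs i) (Node.obs j)) a b) ∨
      ∃ j, (groupGraph D sg).Adj i j ∧ Consecutive
        (unionPath (pathList A.graph (Node.obs i) (Node.obs j))
          (pathList T.graph (Node.obs i) (Node.obs j))) a b) := by
    intro a b ha hb
    rw [h.contr_insert_adj_iff_merge hi hpaths]
    have eT : ∀ j, ((groupGraph D sg).Adj i j ∧ Consecutive ([(i : V)] ++ Q j) (f a) (f b)) ↔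
        ((groupGraph D sg).Adj i j ∧
          Consecutive (pathList T.graph (Node.obs i) (Node.obs j)) a b) := fun j =>
      and_congr_right fun hj => by
        rw [← (pT j hj).1]
        exact consecutive_map hbij.injOn (fun z hz => sT z ((pT j hj).2 z hz)) ha hb
    have eA : ∀ j, ((groupGraph D sg).Adj i j ∧ Consecutive (P j ++ [(j : V)]) (f a) (f b)) ↔
        ((groupGraph D sg).Adj i j ∧
          Consecutive (pathList A.graph (Node.obs i) (Node.obs j)) a b) := fun j =>
      and_congr_right fun hj => by
        rw [← (pA j hj).1]
        exact consecutive_map hbij.injOn (fun z hz => sA z ((pA j hj).2 z hz)) ha hb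
    have eU : ∀ j, ((groupGraph D sg).Adj i j ∧ Consecutive (P j ++ Q j) (f a) (f b)) ↔
        ((groupGraph D sg).Adj i j ∧ Consecutive
          (unionPath (pathList A.graph (Node.obs i) (Node.obs j))
            (pathList T.graph (Node.obs i) (Node.obs j))) a b) := fun j =>
      and_congr_right fun hj => by
        have : P j ++ Q j = (unionPath (pathList A.graph (Node.obs i) (Node.obs j))
            (pathList T.graph (Node.obs i) (Node.obs j))).map f := by
          rw [unionPath_map, (pA j hj).1, (pT j hj).1]
          simp [unionPath]
        rw [this]
        exact consecutive_map hbij.injOn (sU j hj) ha hb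
    have aT : (contr D sg S).Adj (f a) (f b) ↔ T.graph.Adj a b :=
      ⟨fun k => (hT.models.adj a (hmemT a ha (h.contr_supp k).1) b
        (hmemT b hb (h.contr_supp k).2)).2 k,
      fun k => (hT.models.adj a (hT.models.supp a b k).1 b (hT.models.supp a b k).2).1 k⟩
    have aA : (skel D (region D sg ∅ i)).Adj (f a) (f b) ↔ A.graph.Adj a b :=
      ⟨fun k => (hAm.adj a (hmemA a ha k.1) b (hmemA b hb k.2.1)).2 k,
      fun k => (hAm.adj a (hAm.supp a b k).1 b (hAm.supp a b k).2).1 k⟩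
    rw [aT, aA, exists_congr eT, exists_congr eA, exists_congr eU]
  have hmem : ∀ a b, ((T.graph.Adj a b ∧ ¬ ∃ j, (groupGraph D sg).Adj i j ∧
        Consecutive (pathList T.graph (Node.obs i) (Node.obs j)) a b) ∨
      (A.graph.Adj a b ∧ ¬ ∃ j, (groupGraph D sg).Adj i j ∧
        Consecutive (pathList A.graph (Node.obs i) (Node.obs j)) a b) ∨
      ∃ j, (groupGraph D sg).Adj i j ∧ Consecutive
        (unionPath (pathList A.graph (Node.obs i) (Node.obs j))
          (pathList T.graph (Node.obs i) (Node.obs j))) a b) → a ∈ s ∧ b ∈ s := by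
    rintro a b (⟨k, -⟩ | ⟨k, -⟩ | ⟨j, hj, c⟩)
    · exact ⟨sT _ (hT.models.supp a b k).1, sT _ (hT.models.supp a b k).2⟩
    · exact ⟨sA _ (hAm.supp a b k).1, sA _ (hAm.supp a b k).2⟩
    · exact ⟨sU j hj a c.mem.1, sU j hj b c.mem.2⟩
  refine ⟨⟨hbij, fun a ha b hb => ?_, fun a b k => ?_⟩, fun x => Finset.mem_union_left _
    (hT.obs_mem x)⟩
  · constructor
    · rintro ⟨-, k | k⟩
      · exact (key a b ha hb).2 k
      · exact ((key b a hb ha).2 k).symm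
    · intro k
      exact ⟨fun e => k.ne (congrArg f e), Or.inl ((key a b ha hb).1 k)⟩
  · obtain ⟨-, k | k⟩ := k
    · exact hmem a b k
    · exact (hmem b a k).symm

end Parallel

/-! ### Local trees are inconsistent only on the paths between neighboring leaders -/

section Inconsistency

variable {V : Type*} [Finite V] {D : V → V → ℝ} {obs : Finset V} {sg : V → obs}
  (h : IsSurrogateMap D obs sg)

namespace IsSurrogateMap

include h

omit [Finite V] in
theorem mem_region_empty {i : obs} {x : V} :
    x ∈ region D sg ∅ i ↔ sg x = i ∨ ∃ k : obs, (groupGraph D sg).Adj i k ∧ x = k := by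
  have hi0 : i ∉ (∅ : Set obs) := Set.notMem_empty i
  constructor
  · rintro (hx | hx)
    · exact Or.inl hx
    · rcases (h.mem_nbd hi0).1 hx with rfl | ⟨u, v, huv, eu, ev, rfl⟩
      · exact Or.inl (h.sg_obs _)
      · exact Or.inr ⟨sg v, groupGraph_adj_of_tadj huv eu ev,
          retract_of_notMem (Set.notMem_empty _)⟩
  · rintro (hx | ⟨k, hk, rfl⟩)
    · exact Or.inl hx
    · exact Or.inr (Or.inr (contr_empty_adj.2 ⟨i, k, hk, rfl, rfl⟩))

omit [Finite V] in
-- A common node is one of the leaders, which are then adjacent, or an observed node adjacent to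
-- both. As `i` and `j` are joined by only one path, either they are adjacent or they have at most
-- one common neighbor, but not both.
theorem eq_leaders_of_mem_regions (hG : (groupGraph D sg).IsAcyclic) {i j : obs} (hij : i ≠ j)
    {u w : V} (hui : u ∈ region D sg ∅ i) (huj : u ∈ region D sg ∅ j) (hwi : w ∈ region D sg ∅ i)
    (hwj : w ∈ region D sg ∅ j) (hne : u ≠ w) :
    (groupGraph D sg).Adj i j ∧ s(u, w) = s((i : V), (j : V)) := by
  have hx : ∀ x, x ∈ region D sg ∅ i → x ∈ region D sg ∅ j →
      ((groupGraph D sg).Adj i j ∧ (x = i ∨ x = j)) ∨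
      ∃ k : obs, x = k ∧ (groupGraph D sg).Adj i k ∧ (groupGraph D sg).Adj j k := by
    intro x hi hj
    rcases h.mem_region_empty.1 hi with hi | ⟨k, hk, rfl⟩ <;>
      rcases h.mem_region_empty.1 hj with hj | ⟨k', hk', e⟩
    · exact absurd (hi.symm.trans hj) hij
    · subst e
      obtain rfl : k' = i := (h.sg_obs k').symm.trans hi
      exact Or.inl ⟨hk'.symm, Or.inl rfl⟩
    · obtain rfl : k = j := (h.sg_obs k).symm.trans hj
      exact Or.inl ⟨hk, Or.inr rfl⟩
    · obtain rfl : k = k' := Subtype.ext e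
      exact Or.inr ⟨k, rfl, hk, hk'⟩
  have path2 : ∀ k, (groupGraph D sg).Adj i k → (groupGraph D sg).Adj j k →
      pathList (groupGraph D sg) i j = [i, k, j] := fun k hk hk' =>
    pathList_eq hG ⟨by simp [hk, hk'.symm], by simp [hij, hk.ne, hk'.ne'], rfl, rfl⟩
  have path1 : (groupGraph D sg).Adj i j → pathList (groupGraph D sg) i j = [i, j] := fun hk =>
    pathList_eq hG ⟨by simp [hk], by simp [hij], rfl, rfl⟩
  rcases hx u hui huj with ⟨ha, hu⟩ | ⟨k, rfl, hk, hk'⟩ <;>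
    rcases hx w hwi hwj with ⟨hb, hw⟩ | ⟨l, rfl, hl, hl'⟩
  · refine ⟨ha, ?_⟩
    rcases hu with rfl | rfl <;> rcases hw with rfl | rfl
    · exact absurd rfl hne
    · rfl
    · exact Sym2.eq_swap
    · exact absurd rfl hne
  · have := (path1 ha).symm.trans (path2 l hl hl')
    simp at this
  · have := (path1 hb).symm.trans (path2 k hk hk')
    simp at this
  · have := (path2 k hk hk').symm.trans (path2 l hl hl')
    simp at this
    exact absurd (congrArg _ this) hne

/-- The edge from `a` to the leader of `v` stands for a path of `T` that crosses to `v` at once and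
then stays in the group of `v`. A skipped node is thus in this group without being its leader, and
only the local tree of this very leader contains such a node. -/
theorem skipped_of_tadj (hdeg : ∀ v, v ∉ obs → 3 ≤ ((skel D Set.univ).neighborSet v).ncard)
    {i j : obs} (hij : i ≠ j) {a v c : V} (k : TAdj D a v) (ha : sg a = i) (hv : sg v ≠ i)
    (hc : c ∈ region D sg ∅ j) (hbtw : MBtw D a c (sg v)) (hca : c ≠ a) (hcv : c ≠ sg v) :
    (groupGraph D sg).Adj i j ∧ sg v = j ∧
      Consecutive (pathList (skel D (region D sg ∅ i)) i j) a j ∧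
      c ∈ pathList (skel D (region D sg ∅ j)) i j := by
  have hD := h.metric
  have hi0 : i ∉ (∅ : Set obs) := Set.notMem_empty i
  have hadj := groupGraph_adj_of_tadj k ha hv
  have b1 : MBtw D a v (sg v) := h.btw_of_sg_eq k.symm (by rwa [ha]) (h.sg_obs _)
  have b2 : MBtw D v a i := h.btw_of_sg_eq k (by rw [ha]; exact hv.symm) ((h.sg_obs _).trans ha.symm)
  have esc : sg c = sg v := by
    rcases h.sg_of_btw_region hi0 ha (h.mem_region_empty.2 (Or.inr ⟨_, hadj, rfl⟩)) hbtw with e | e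
    · have b3 : MBtw D v a c := h.btw_of_sg_eq k (by rw [ha]; exact hv.symm) (e.trans ha.symm)
      exact (hD.not_btw_and_btw hca hbtw
        (hD.btw_chain (hD.btw_symm b3) b1 k.ne)).elim
    · exact e.trans (h.sg_obs _)
  have ej : sg v = j := by
    rcases h.mem_region_empty.1 hc with e | ⟨l, -, rfl⟩
    · exact esc.symm.trans e
    · rw [h.sg_obs] at esc
      exact absurd (congrArg _ esc) hcv
  subst ej
  refine ⟨hadj, rfl, ?_, ?_⟩
  · obtain ⟨u', v', P, Q, hpaths⟩ := h.exists_paths hi0 (sg v)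
    obtain ⟨huv, eu, ev, hP, hP', -⟩ := hpaths hadj
    obtain ⟨rfl, -⟩ := h.crossing_unique huv k (by rw [eu, ev]; exact hv.symm) (ha.trans eu.symm)
      ev.symm
    have hac : (skel D (region D sg ∅ i)).IsAcyclic := by
      rw [← h.medClosure_nbd hi0 hdeg]
      exact hD.skel_isAcyclic (hD.medClosed_medClosure _)
    rw [pathList_eq hac (h.isPathOf_append_leader hadj huv eu ev hP hP').1,
      consecutive_append hP.last rfl]
    exact Or.inr (Or.inr (Or.inl ⟨rfl, rfl⟩))
  · have hj0 : sg v ∉ (∅ : Set obs) := Set.notMem_empty _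
    have hcl : MedClosed D (region D sg ∅ (sg v)) := by
      rw [← h.medClosure_nbd hj0 hdeg]
      exact hD.medClosed_medClosure _
    refine (hD.mem_pathList_skel hcl (h.mem_region_empty.2 (Or.inr ⟨_, hadj.symm, rfl⟩))
      (Or.inl (h.sg_obs _))).2 ⟨hc, ?_⟩
    exact hD.btw_of_btw_right (hD.btw_chain (hD.btw_symm b2) b1 k.ne) hbtw

theorem inconsistentOnlyOnPath
    (hdeg : ∀ v, v ∉ obs → 3 ≤ ((skel D Set.univ).neighborSet v).ncard)
    (hG : (groupGraph D sg).IsAcyclic) {i j : obs} (hij : i ≠ j) {A B : NamedGraph V}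
    (hA : A.graph = skel D (region D sg ∅ i)) (hA' : ∀ v, v ∈ A.verts ↔ v ∈ region D sg ∅ i)
    (hB : B.graph = skel D (region D sg ∅ j)) (hB' : ∀ v, v ∈ B.verts ↔ v ∈ region D sg ∅ j) :
    InconsistentOnlyOnPath (skel D Set.univ) obs (groupGraph D sg) i j A B := by
  have hD := h.metric
  have hi0 : i ∉ (∅ : Set obs) := Set.notMem_empty i
  constructor
  · intro u hu w hw hne
    rw [Finset.mem_inter, hA', hB'] at hu hw
    refine h.eq_leaders_of_mem_regions hG hij hu.1 hu.2 hw.1 hw.2 ?_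
    rintro rfl
    have hac : ∀ l, (skel D (region D sg ∅ l)).IsAcyclic := fun l => by
      rw [← h.medClosure_nbd (Set.notMem_empty l) hdeg]
      exact hD.skel_isAcyclic (hD.medClosed_medClosure _)
    rw [hA, hB, pathList_eq (hac i) (isPathOf_singleton _ _),
      pathList_eq (hac j) (isPathOf_singleton _ _)] at hne
    exact hne rfl
  · intro a b hab c hc hbtw hca hcb
    rw [hA] at hab ⊢
    rw [hB'] at hc
    rw [hB]
    replace hbtw := ((hD.mem_pathList_skel (fun _ _ _ _ _ _ _ _ => trivial) trivial
      trivial).1 hbtw).2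
    rcases (h.skel_region_adj hi0).1 hab with ⟨k, -, -⟩ | ⟨v, k, ha, hv, e⟩ | ⟨v, k, ha, hv, e⟩
    · obtain ⟨-, -, -, k⟩ := hD.skel_adj.1 k
      rcases k c trivial hbtw with e | e
      · exact absurd e hca
      · exact absurd e hcb
    · rw [retract_of_notMem (Set.notMem_empty _)] at e
      subst e
      obtain ⟨h1, h2, h3, h4⟩ := h.skipped_of_tadj hdeg hij k ha hv hc hbtw hca hcb
      rw [h2]
      exact ⟨h1, h3, h4⟩
    · rw [retract_of_notMem (Set.notMem_empty _)] at e
      subst e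
      obtain ⟨h1, h2, h3, h4⟩ := h.skipped_of_tadj hdeg hij k ha hv hc (hD.btw_symm hbtw) hcb hca
      rw [h2]
      exact ⟨h1, consecutive_symm h3, h4⟩

theorem isIdentification (hdeg : ∀ v, v ∉ obs → 3 ≤ ((skel D Set.univ).neighborSet v).ncard)
    {i : obs} {A : NamedGraph (Node obs)} {φ : Node obs → V} (hA : IsLocalPlacement D sg i A φ) :
    IsIdentification (skel D Set.univ) obs A φ where
  inj := hA.models.bij.injOn
  observed x _ := hA.map_obs x
  hidden j r hr := by
    intro ho
    have hi0 : i ∉ (∅ : Set obs) := Set.notMem_empty i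
    have hmem : φ (Node.hid j r) ∈ nbd D sg ∅ i := by
      rcases hA.models.bij.mapsTo hr with e | e
      · have : sg (φ (Node.hid j r)) = ⟨_, ho⟩ := h.sg_obs ⟨_, ho⟩
        have e' : φ (Node.hid j r) = i := by
          rw [← show sg (φ (Node.hid j r)) = i from e, this]
        exact Or.inl e'
      · exact e
    -- The observed node at this place is in the local tree under its own name, which contradicts
    -- injectivity.
    have := hA.models.bij.injOn hr ((hA.obs_mem ⟨_, ho⟩).2 hmem) (hA.map_obs ⟨_, ho⟩).symm
    cases this
  between a ha b hb c hc := by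
    have hD := h.metric
    have hcl : MedClosed D (region D sg ∅ i) := by
      rw [← h.medClosure_nbd (Set.notMem_empty i) hdeg]
      exact hD.medClosed_medClosure _
    have hma := hA.models.bij.mapsTo ha
    have hmb := hA.models.bij.mapsTo hb
    have hmc := hA.models.bij.mapsTo hc
    obtain ⟨l, hl, hl'⟩ := hD.exists_isPathOf hma hmc
    obtain ⟨e, -, hv⟩ := hA.models.pathList (hD.skel_isAcyclic hcl) ha hc hl
      fun x hx => ((hl' x).1 hx).1
    rw [hD.mem_pathList_skel (S := Set.univ) (fun _ _ _ _ _ _ _ _ => trivial) trivial trivial]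
    trans φ b ∈ l
    · rw [← e, List.mem_map]
      constructor
      · exact fun k => ⟨b, k, rfl⟩
      · rintro ⟨x, hx, ex⟩
        exact hA.models.bij.injOn (hv x hx) hb ex ▸ hx
    · rw [hl']
      exact ⟨fun k => ⟨trivial, k.2⟩, fun k => ⟨hmb, k.2⟩⟩

end IsSurrogateMap

end Inconsistency

/-! ### Correctness for surrogate maps -/

section Correctness

variable {V : Type*} [Finite V] {D : V → V → ℝ} {obs : Finset V} {sg : V → obs}
  (h : IsSurrogateMap D obs sg)
  (hdeg : ∀ v, v ∉ obs → 3 ≤ ((skel D Set.univ).neighborSet v).ncard)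
  {d : obs → obs → ℝ} (hd : ∀ x y, x ≠ y → d x y = D x y)

namespace CLRGInvariant

include h hdeg hd

theorem foldl (l : List obs) : ∀ {S : Set obs} {f : Node obs → V} {s : CLRGState obs},
    CLRGInvariant D sg S f s → l.Nodup → (∀ i ∈ l, i ∉ S) →
      ∃ f', CLRGInvariant D sg (S ∪ {i | i ∈ l}) f' (l.foldl (clrgStep d) s) := by
  induction l with
  | nil =>
    intro S f s hs _ _
    exact ⟨f, by simpa using hs⟩
  | cons i l ih =>
    intro S f s hs hl hS
    obtain ⟨f', hf'⟩ := hs.step h hdeg hd (hS i List.mem_cons_self)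
    have := ih hf' hl.of_cons (fun j hj k => ?_)
    · rw [List.foldl_cons]
      convert this using 3
      ext j
      simp only [Set.mem_union, Set.mem_ofPred_eq, List.mem_cons, Set.mem_insert_iff]
      tauto
    · rcases k with rfl | k
      · exact (List.nodup_cons.1 hl).1 hj
      · exact hS j (List.mem_cons_of_mem _ hj) k

theorem treeCLRG {l : List obs} (hl : l.Nodup) :
    ∃ f, Models f (treeCLRG d (groupGraph D sg) l) (keep sg {i | i ∈ l}) (contr D sg {i | i ∈ l}) ∧
      (∀ x, Node.obs x ∈ (_root_.treeCLRG d (groupGraph D sg) l).verts) ∧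
      ∀ x, f (Node.obs x) = x := by
  obtain ⟨f, hf⟩ := foldl h hdeg hd l (CLRGInvariant.init h) hl fun _ _ => Set.notMem_empty _
  rw [Set.empty_union] at hf
  exact ⟨f, hf.models, hf.obs_mem, hf.map_obs⟩

end CLRGInvariant

namespace LRGInvariant

include h hdeg

theorem foldl {F : Node obs → V} (hF : ∀ x, F (Node.obs x) = x)
    (hloc : ∀ i, IsLocalPlacement D sg i (localTree d (groupGraph D sg) i) F) (l : List obs) :
    ∀ {S : Set obs} {T : NamedGraph (Node obs)},
    LRGInvariant D sg S F T → l.Nodup → (∀ i ∈ l, i ∉ S) →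
      LRGInvariant D sg (S ∪ {i | i ∈ l}) F (l.foldl (fun T i => mergeAt (groupGraph D sg) i T
        (localTree d (groupGraph D sg) i)) T) := by
  induction l with
  | nil =>
    intro S T hs _ _
    simpa using hs
  | cons i l ih =>
    intro S T hs hl hS
    have := ih (hs.merge h hdeg (hS i List.mem_cons_self) (hloc i) hF fun _ _ => rfl) hl.of_cons
      (fun j hj k => ?_)
    · rw [List.foldl_cons]
      convert this using 1
      ext j
      simp only [Set.mem_union, Set.mem_ofPred_eq, List.mem_cons, Set.mem_insert_iff]
      tauto
    · rcases k with rfl | k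
      · exact (List.nodup_cons.1 hl).1 hj
      · exact hS j (List.mem_cons_of_mem _ hj) k

include hd in
theorem treeLRG {l : List obs} (hl : l.Nodup) :
    ∃ f, Models f (treeLRG d (groupGraph D sg) l) (keep sg {i | i ∈ l}) (contr D sg {i | i ∈ l}) ∧
      (∀ x, Node.obs x ∈ (_root_.treeLRG d (groupGraph D sg) l).verts) ∧
      ∀ x, f (Node.obs x) = x := by
  choose φ hφ using fun i => h.exists_isLocalPlacement hdeg hd i
  -- One placement serves all local trees, since a hidden name records the leader that introduced
  -- it.
  let F : Node obs → V := fun p => if ∃ x, p = Node.obs x then p.leader else φ p.leader p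
  have hF : ∀ x, F (Node.obs x) = x := fun x => if_pos ⟨x, rfl⟩
  have hFφ : ∀ i, ∀ p ∈ (localTree d (groupGraph D sg) i).verts, F p = φ i p := by
    intro i p hp
    rcases (hφ i).names p hp with ⟨x, rfl⟩ | ⟨r, rfl⟩
    · rw [hF, (hφ i).map_obs]
    · exact if_neg (by rintro ⟨x, k⟩; cases k)
  have hloc : ∀ i, IsLocalPlacement D sg i (localTree d (groupGraph D sg) i) F := fun i =>
    { models := (hφ i).models.congr (hFφ i)
      map_obs := hF
      obs_mem := (hφ i).obs_mem
      names := (hφ i).names }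
  have hinit := CLRGInvariant.init h
  have h0 : LRGInvariant D sg ∅ F (observedTree (groupGraph D sg)) :=
    { models := hinit.models.congr fun p hp => by
        simp only [observedTree, Finset.mem_image, Finset.mem_univ, true_and] at hp
        obtain ⟨x, rfl⟩ := hp
        exact hF x
      obs_mem := hinit.obs_mem }
  have := foldl h hdeg hF hloc l h0 hl fun _ _ => Set.notMem_empty _
  rw [Set.empty_union] at this
  exact ⟨F, this.models, this.obs_mem, hF⟩

end LRGInvariant

omit [Finite V] in
/-- Two models of the same graph that agree on the observed nodes are the same latent tree. -/
theorem Models.sameLatentTree {f g : Node obs → V} {A B : NamedGraph (Node obs)} {S : Set V}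
    {H : SimpleGraph V} (hf : Models f A S H) (hg : Models g B S H)
    (hA : ∀ x, Node.obs x ∈ A.verts) (hB : ∀ x, Node.obs x ∈ B.verts)
    (ef : ∀ x, f (Node.obs x) = x) (eg : ∀ x, g (Node.obs x) = x) : SameLatentTree A B := by
  have hinv : ∀ a ∈ A.verts, ∃ b ∈ B.verts, g b = f a := fun a ha =>
    hg.bij.surjOn (hf.bij.mapsTo ha)
  choose! F hF hFe using hinv
  refine ⟨F, ⟨hF, ?_, ?_⟩, fun x => iff_of_true (hA x) (hB x), fun x hx => ?_, ?_⟩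
  · intro a ha b hb e
    exact hf.bij.injOn ha hb (by rw [← hFe a ha, ← hFe b hb, e])
  · intro b hb
    obtain ⟨a, ha, e⟩ := hf.bij.surjOn (hg.bij.mapsTo hb)
    exact ⟨a, ha, hg.bij.injOn (hF a ha) hb ((hFe a ha).trans e)⟩
  · exact hg.bij.injOn (hF _ hx) (hB x) (by rw [hFe _ hx, ef, eg])
  · intro a ha b hb
    rw [hf.adj a ha b hb, hg.adj _ (hF a ha) _ (hF b hb), hFe a ha, hFe b hb]

include h hdeg in
-- Both trees are copies of `contr D sg S`, and a list enters only through the set `S` of its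
-- members, so the order is irrelevant. The surrogate of a hidden node is internal; hence nothing is
-- contracted any more when `S` contains all internal nodes.
theorem IsSurrogateMap.lrgCorrect {dist : V → V → ℝ}
    (hd : ∀ x y : obs, x ≠ y → dist x y = D x y) (hG : (groupGraph D sg).IsAcyclic) :
    LRGCorrect (skel D Set.univ) obs dist (groupGraph D sg) where
  agree l l' hl _ hp := by
    obtain ⟨f, h1, h2, h3⟩ := CLRGInvariant.treeCLRG h hdeg (d := fun x y : obs => dist x y) hd hl
    obtain ⟨g, k1, k2, k3⟩ := LRGInvariant.treeLRG h hdeg (d := fun x y : obs => dist x y) hd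
      (hp.nodup_iff.2 hl)
    have e : {i | i ∈ l'} = {i | i ∈ l} := Set.ext fun i => hp.mem_iff
    rw [e] at k1
    exact k1.sameLatentTree h1 k2 h2 k3 h3
  recovers l hl hint := by
    obtain ⟨g, k1, k2, k3⟩ := LRGInvariant.treeLRG h hdeg (d := fun x y : obs => dist x y) hd hl
    have hk : ∀ v, v ∈ keep sg {i | i ∈ l} := by
      intro v
      by_cases hv : v ∈ obs
      · exact h.obs_mem_keep ⟨v, hv⟩
      · exact Or.inl ((hint _).2 (h.isInternal_sg hdeg hv))
    rw [IsSurrogateMap.contr_univ hk, Set.eq_univ_of_forall hk] at k1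
    exact ⟨g, k1.bij, fun x => ⟨k2 x, k3 x⟩, k1.adj⟩
  inconsistency := by
    choose φ hφ using fun i => h.exists_isLocalPlacement hdeg (d := fun x y : obs => dist x y) hd i
    refine ⟨φ, fun i _ => h.isIdentification hdeg (hφ i), fun i j _ _ hij => ?_⟩
    exact h.inconsistentOnlyOnPath hdeg hG hij
      ((hφ i).models.map_graph fun a b k => ⟨k.1, k.2.1⟩) (fun _ => (hφ i).models.mem_map_verts)
      ((hφ j).models.map_graph fun a b k => ⟨k.1, k.2.1⟩) (fun _ => (hφ j).models.mem_map_verts)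

/-- The algorithms are correct for additive distances. -/
theorem lrgCorrect_of_isAdditiveDistance {V : Type*} [Finite V] {T : SimpleGraph V}
    {obs : Finset V} (hT : IsMinimalLatentTree T obs) {dist : V → V → ℝ}
    (hdist : IsAdditiveDistance T dist) (hs : SurrogatesDefined obs dist) {M : SimpleGraph obs}
    (hM : IsMST (fun x y : obs => dist x y) M) : LRGCorrect T obs dist M := by
  have hD := hdist.isTreeMetric hT.1
  have eT := hdist.eq_skel hT.1
  have hex : ∀ v, ∃ x : obs, ∀ x' : obs, x' ≠ x → offDiag dist v x < offDiag dist v x' := by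
    intro v
    by_cases hv : v ∈ obs
    · refine ⟨⟨v, hv⟩, fun x' hx' => ?_⟩
      rw [offDiag_self]
      exact hD.pos _ _ fun e => hx' (Subtype.ext e.symm)
    · obtain ⟨x, hx, hmin⟩ := hs v hv
      refine ⟨⟨x, hx⟩, fun x' hx' => ?_⟩
      rw [offDiag_of_ne fun e => hv (by rw [e]; exact hx), offDiag_of_ne fun e => hv (by rw [e]; exact x'.2)]
      exact hmin _ x'.2 fun e => hx' (Subtype.ext e)
  choose sg hsg using hex
  have h : IsSurrogateMap (offDiag dist) obs sg := ⟨hD, fun v x hx => hsg v x hx⟩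
  have hd : ∀ x y : obs, x ≠ y → dist x y = offDiag dist x y := fun x y hxy =>
    (offDiag_of_ne fun e => hxy (Subtype.ext e)).symm
  have : Nonempty V := hT.1.connected.nonempty
  have e := h.mst_eq hd hM
  subst e
  have := h.lrgCorrect (by rw [← eT]; exact hT.2) hd hM.1.isAcyclic
  rwa [← eT] at this

end Correctness

/-! ### Products of the largest singular values -/

section SingularValues

open Polynomial Matrix

/-- The squares of the singular values are the eigenvalues of `Aᵀ * A`. Identities between singular
values are thereby reduced to identities of polynomials. -/
theorem prod_X_sub_C_sq_singularValues {m n : ℕ} (A : Matrix (Fin m) (Fin n) ℝ) :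
    ∏ i ∈ Finset.range n, (X - C ((toEuclideanLin A).singularValues i ^ 2)) =
      (Aᵀ * A).charpoly := by
  have hn : Module.finrank ℝ (EuclideanSpace ℝ (Fin n)) = n := finrank_euclideanSpace_fin
  have h1 := (toEuclideanLin A).isSymmetric_adjoint_comp_self.charpoly_eq hn
  have h2 : (toEuclideanLin A).adjoint ∘ₗ toEuclideanLin A = toEuclideanLin (Aᵀ * A) := by
    rw [← toEuclideanLin_conjTranspose_eq_adjoint, conjTranspose_eq_transpose_of_trivial]
    ext x i
    simp [toLpLin_apply, mulVec_mulVec]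
  rw [← charpoly_toLin (Aᵀ * A) (PiLp.basisFun 2 ℝ (Fin n)), ← toLpLin_eq_toLin, ← h2, h1,
    Finset.prod_range]
  refine Finset.prod_congr rfl fun i _ => ?_
  rw [LinearMap.sq_singularValues_fin _ hn]
  rfl

theorem prod_X_sub_C_sq_singularValues_of_le {m n N : ℕ} (A : Matrix (Fin m) (Fin n) ℝ)
    (hN : n ≤ N) : ∏ i ∈ Finset.range N, (X - C ((toEuclideanLin A).singularValues i ^ 2)) =
      X ^ (N - n) * (Aᵀ * A).charpoly := by
  obtain ⟨r, rfl⟩ := Nat.exists_eq_add_of_le hN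
  rw [Finset.prod_range_add, prod_X_sub_C_sq_singularValues, mul_comm, Nat.add_sub_cancel_left]
  congr 1
  rw [Finset.prod_eq_pow_card (b := X)]
  · simp
  · intro i _
    rw [LinearMap.singularValues_of_finrank_le _ (by simp)]
    simp

theorem eq_of_prod_X_sub_C {f g : ℕ → ℝ} (hf : Antitone f) (hg : Antitone g) {N : ℕ}
    (h : ∏ i ∈ Finset.range N, (X - C (f i)) = ∏ i ∈ Finset.range N, (X - C (g i))) {i : ℕ}
    (hi : i < N) : f i = g i := by
  have roots : ∀ f : ℕ → ℝ, (∏ i ∈ Finset.range N, (X - C (f i))).roots =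
      ((List.range N).map f : Multiset ℝ) := by
    intro f
    have := roots_multiset_prod_X_sub_C (((List.range N).map f : List ℝ) : Multiset ℝ)
    rw [← this]
    congr 1
    simp only [Multiset.map_coe, List.map_map, Multiset.prod_coe]
    rw [Finset.prod_eq_multiset_prod, Finset.range_val, Multiset.range, Multiset.map_coe,
      Multiset.prod_coe]
    rfl
  have hp : ((List.range N).map f).Perm ((List.range N).map g) := by
    rw [← Multiset.coe_eq_coe, ← roots f, ← roots g, h]
  have hs : ∀ f : ℕ → ℝ, Antitone f → ((List.range N).map f).SortedGE := by
    intro f hf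
    rw [List.sortedGE_iff_pairwise, List.pairwise_map]
    exact List.pairwise_lt_range.imp fun h => hf h.le
  have := hp.eq_of_sortedGE (hs f hf) (hs g hg)
  rw [List.map_inj_left] at this
  exact this i (List.mem_range.2 hi)

/-- A matrix and its transpose have the same singular values. -/
theorem singularValues_transpose {m n : ℕ} (A : Matrix (Fin m) (Fin n) ℝ) (i : ℕ) :
    (toEuclideanLin Aᵀ).singularValues i = (toEuclideanLin A).singularValues i := by
  have hanti : ∀ {m n : ℕ} (A : Matrix (Fin m) (Fin n) ℝ),
      Antitone fun i => (toEuclideanLin A).singularValues i ^ 2 := fun A i j hij =>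
    pow_le_pow_left₀ (LinearMap.singularValues_nonneg _ _)
      (LinearMap.singularValues_antitone _ hij) 2
  -- Any common length that is at least `m` and `n` and larger than `i` would do; the excess is
  -- filled with zero singular values.
  have key := eq_of_prod_X_sub_C (N := m + n + i + 1) (hanti Aᵀ) (hanti A) (i := i) (by
    rw [prod_X_sub_C_sq_singularValues_of_le _ (by omega),
      prod_X_sub_C_sq_singularValues_of_le _ (by omega), transpose_transpose,
      show m + n + i + 1 - m = i + 1 + n by omega, show m + n + i + 1 - n = i + 1 + m by omega,
      pow_add X _ n, pow_add X _ m, mul_assoc, mul_assoc]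
    congr 1
    simpa using charpoly_mul_comm' A Aᵀ) (by omega)
  exact (pow_left_inj₀ (LinearMap.singularValues_nonneg _ _)
    (LinearMap.singularValues_nonneg _ _) two_ne_zero).1 key

/-- The product of the `k` largest singular values. -/
noncomputable def topProd (k : ℕ) {m n : ℕ} (A : Matrix (Fin m) (Fin n) ℝ) : ℝ :=
  ∏ i ∈ Finset.range k, (toEuclideanLin A).singularValues i

theorem topProd_nonneg (k : ℕ) {m n : ℕ} (A : Matrix (Fin m) (Fin n) ℝ) : 0 ≤ topProd k A :=
  Finset.prod_nonneg fun _ _ => LinearMap.singularValues_nonneg _ _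

theorem topProd_transpose (k : ℕ) {m n : ℕ} (A : Matrix (Fin m) (Fin n) ℝ) :
    topProd k Aᵀ = topProd k A :=
  Finset.prod_congr rfl fun i _ => singularValues_transpose A i

/-- The rank of `A * B` is at most `k`, so the other singular values vanish and contribute a power
of `X`. It cancels against the one that appears when the characteristic polynomial of `Bᵀ * (Aᵀ * A
* B)` is replaced by that of the `k × k` matrix `Aᵀ * A * (B * Bᵀ)`; the constant coefficients are
then compared. -/
theorem sq_topProd_mul {m k n : ℕ} (A : Matrix (Fin m) (Fin k) ℝ) (B : Matrix (Fin k) (Fin n) ℝ)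
    (hkn : k ≤ n) : topProd k (A * B) ^ 2 = (Aᵀ * A).det * (B * Bᵀ).det := by
  have hrank : Module.finrank ℝ (toEuclideanLin (A * B)).range ≤ k := by
    have e : toEuclideanLin (A * B) = toEuclideanLin A ∘ₗ toEuclideanLin B := by
      ext x i
      simp [toLpLin_apply, mulVec_mulVec]
    rw [e]
    refine (Submodule.finrank_mono (LinearMap.range_comp_le_range _ _)).trans ?_
    simpa using (toEuclideanLin A).finrank_range_le
  have h1 := prod_X_sub_C_sq_singularValues (A * B)
  obtain ⟨r, rfl⟩ := Nat.exists_eq_add_of_le hkn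
  have h2 : ∏ i ∈ Finset.range r,
      (X - C ((toEuclideanLin (A * B)).singularValues (k + i) ^ 2)) = X ^ r := by
    rw [Finset.prod_eq_pow_card (b := X)]
    · simp
    · intro i _
      rw [(LinearMap.singularValues_eq_zero_iff_le_finrank_range _).2 (hrank.trans (Nat.le_add_right k i))]
      simp
  have h3 : (((A * B)ᵀ * (A * B)).charpoly : ℝ[X]) = X ^ r * (Aᵀ * A * (B * Bᵀ)).charpoly := by
    have := charpoly_mul_comm_of_le Bᵀ (Aᵀ * A * B) (by simp)
    simp only [Fintype.card_fin, Nat.add_sub_cancel_left] at this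
    rw [transpose_mul, Matrix.mul_assoc, ← Matrix.mul_assoc Aᵀ, this, Matrix.mul_assoc _ B]
  rw [Finset.prod_range_add, h2, h3, mul_comm] at h1
  have h4 := mul_left_cancel₀ (pow_ne_zero r (X_ne_zero (R := ℝ))) h1
  have h5 := congrArg (eval 0) h4
  rw [eval_prod] at h5
  simp only [eval_sub, eval_X, eval_C, zero_sub] at h5
  rw [Finset.prod_neg, Finset.card_range, ← Polynomial.coeff_zero_eq_eval_zero] at h5
  rw [← det_mul, det_eq_sign_charpoly_coeff, ← h5, Fintype.card_fin, ← mul_assoc, ← mul_pow]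
  simp [topProd, Finset.prod_pow]

end SingularValues

/-! ### Integrals of products under conditional independence -/

section CondIndep

open MeasureTheory ProbabilityTheory

variable {Ω : Type*} {m m' m₁ m₂ mΩ : MeasurableSpace Ω} {μ : Measure Ω} [IsFiniteMeasure μ]

theorem integral_condExp_mul (hm : m ≤ mΩ) {f g : Ω → ℝ} (hg : StronglyMeasurable[m] g)
    (hf : Integrable f μ) (hfg : Integrable (f * g) μ) :
    ∫ ω, μ[f | m] ω * g ω ∂μ = ∫ ω, f ω * g ω ∂μ := by
  have h1 := condExp_mul_of_stronglyMeasurable_right hg hfg hf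
  have h2 := integral_condExp (μ := μ) hm (f := f * g)
  rw [integral_congr_ae h1] at h2
  exact h2

theorem integral_mul_eq_zero_of_setIntegral (hm : m ≤ mΩ) {f g : Ω → ℝ}
    (hg : StronglyMeasurable[m] g) (hf : Integrable f μ) (hfg : Integrable (f * g) μ)
    (h0 : ∀ t, MeasurableSet[m] t → ∫ ω in t, f ω ∂μ = 0) : ∫ ω, f ω * g ω ∂μ = 0 := by
  have h1 : (0 : Ω → ℝ) =ᵐ[μ] μ[f | m] :=
    ae_eq_condExp_of_forall_setIntegral_eq hm hf (fun _ _ _ => (integrable_zero _ _ _).integrableOn)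
      (fun t ht _ => by simp [h0 t ht]) stronglyMeasurable_zero.aestronglyMeasurable
  rw [← integral_condExp_mul hm hg hf hfg]
  rw [integral_eq_zero_of_ae]
  filter_upwards [h1] with ω hω
  simp [← hω]

theorem integrable_condExp_indicator_mul {t : Set Ω} {f : Ω → ℝ} (hf : Integrable f μ) :
    Integrable (fun ω => (μ⟦t | m⟧) ω * f ω) μ := by
  by_cases hm : m ≤ mΩ
  swap
  · simp [condExp_of_not_le hm]
  refine hf.bdd_mul (c := 1) (stronglyMeasurable_condExp.mono hm).aestronglyMeasurable ?_
  have := ae_bdd_abs_condExp_of_ae_bdd_abs (m := m) (μ := μ) (R := 1) (f := t.indicator fun _ => (1 : ℝ))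
    (Filter.Eventually.of_forall fun ω => by
      by_cases h : ω ∈ t <;> simp [h])
  filter_upwards [this] with ω hω
  simpa using hω

theorem integral_condExp_indicator_mul (hm : m ≤ mΩ) {t : Set Ω} (ht : MeasurableSet[mΩ] t)
    {f : Ω → ℝ} (hf : Integrable f μ) :
    ∫ ω, (μ⟦t | m⟧) ω * f ω ∂μ = ∫ ω in t, μ[f | m] ω ∂μ := by
  have h1 : Integrable (t.indicator fun _ => (1 : ℝ)) μ := (integrable_const 1).indicator ht
  have h2 := integral_condExp_mul hm (stronglyMeasurable_condExp (f := t.indicator fun _ => (1 : ℝ))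
    (m := m) (μ := μ)) hf (by
      refine (integrable_condExp_indicator_mul (t := t) (m := m) hf).congr ?_
      filter_upwards with ω
      exact mul_comm _ _)
  have h3 := integral_condExp_mul hm (stronglyMeasurable_condExp (f := f) (m := m) (μ := μ)) h1 (by
      refine ((integrable_condExp (f := f) (m := m) (μ := μ)).indicator ht).congr ?_
      filter_upwards with ω
      by_cases h : ω ∈ t <;> simp [h])
  have h4 : ∫ ω in t, μ[f | m] ω ∂μ =
      ∫ ω, (t.indicator fun _ => (1 : ℝ)) ω * μ[f | m] ω ∂μ := by
    rw [← integral_indicator ht]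
    congr 1
    ext ω
    by_cases h : ω ∈ t <;> simp [h]
  rw [h4, ← h3]
  simp_rw [mul_comm _ (f _)]
  rw [← h2]
  simp_rw [mul_comm]

/-- If `f` and `g` are square-integrable and conditionally independent given `m'`, then `f` can be
replaced by its conditional expectation in the integral of `f * g`. -/
theorem integral_mul_of_condIndep [StandardBorelSpace Ω] (hm' : m' ≤ mΩ) (hm₁ : m₁ ≤ mΩ)
    (hm₂ : m₂ ≤ mΩ) (hind : CondIndep m' m₁ m₂ hm' μ) {f g f' : Ω → ℝ}
    (hf : StronglyMeasurable[m₁] f) (hg : StronglyMeasurable[m₂] g) (hf2 : MemLp f 2 μ)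
    (hg2 : MemLp g 2 μ) (hf' : μ[f | m'] =ᵐ[μ] f') (hf'2 : MemLp f' 2 μ) :
    ∫ ω, f ω * g ω ∂μ = ∫ ω, f' ω * g ω ∂μ := by
  rw [condIndep_iff m' m₁ m₂ hm' hm₁ hm₂] at hind
  have hfi : Integrable f μ := hf2.integrable one_le_two
  have hf'i : Integrable f' μ := hf'2.integrable one_le_two
  have hone : ∀ t, MeasurableSet[mΩ] t → Integrable (t.indicator fun _ => (1 : ℝ)) μ :=
    fun t ht => (integrable_const 1).indicator ht
  -- Conditional independence speaks of indicators. For fixed `t₂`, vanishing of the integrals over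
  -- all `t₁` passes from indicators to `f`; `stage2` then has vanishing integrals over all `t₂`,
  -- which passes to `g`. Both passages use that a function whose integrals over a σ-algebra vanish
  -- has conditional expectation zero.
  have stage1 : ∀ t₁ t₂, MeasurableSet[m₁] t₁ → MeasurableSet[m₂] t₂ →
      ∫ ω in t₁, ((t₂.indicator fun _ => (1 : ℝ)) ω - (μ⟦t₂ | m'⟧) ω) ∂μ = 0 := by
    intro t₁ t₂ h₁ h₂
    have h₁' := hm₁ _ h₁
    have h₂' := hm₂ _ h₂
    rw [integral_sub (hone t₂ h₂').integrableOn integrable_condExp.integrableOn,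
      ← integral_condExp_indicator_mul hm' h₁' (hone t₂ h₂'), sub_eq_zero]
    have e1 : ∫ ω in t₁, (t₂.indicator fun _ => (1 : ℝ)) ω ∂μ =
        ∫ ω, ((t₁ ∩ t₂).indicator fun _ => (1 : ℝ)) ω ∂μ := by
      rw [← integral_indicator h₁', Set.indicator_indicator]
    have e2 := integral_condExp_mul hm' (stronglyMeasurable_condExp
      (f := t₁.indicator fun _ => (1 : ℝ)) (m := m') (μ := μ)) (hone t₂ h₂') (by
        refine (integrable_condExp_indicator_mul (t := t₁) (m := m') (hone t₂ h₂')).congr ?_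
        filter_upwards with ω
        exact mul_comm _ _)
    rw [e1, ← integral_condExp hm', integral_congr_ae (hind t₁ t₂ h₁ h₂)]
    simp_rw [mul_comm _ ((t₂.indicator fun _ => (1 : ℝ)) _)]
    rw [← e2]
    simp_rw [Pi.mul_apply, mul_comm]
  have stage2 : ∀ t₂, MeasurableSet[m₂] t₂ → ∫ ω in t₂, (f ω - f' ω) ∂μ = 0 := by
    intro t₂ h₂
    have h₂' := hm₂ _ h₂
    have i1 : Integrable (fun ω => (t₂.indicator fun _ => (1 : ℝ)) ω * f ω) μ := by
      refine (hfi.indicator h₂').congr ?_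
      filter_upwards with ω
      by_cases h : ω ∈ t₂ <;> simp [h]
    have i2 := integrable_condExp_indicator_mul (t := t₂) (m := m') hfi
    have h1 := integral_mul_eq_zero_of_setIntegral hm₁ hf
      (f := fun ω => (t₂.indicator fun _ => (1 : ℝ)) ω - (μ⟦t₂ | m'⟧) ω)
      ((hone t₂ h₂').sub integrable_condExp) (by
        refine (i1.sub i2).congr ?_
        filter_upwards with ω
        simp [sub_mul]) (fun t₁ h₁ => stage1 t₁ t₂ h₁ h₂)
    simp_rw [sub_mul] at h1
    rw [integral_sub i1 i2, integral_condExp_indicator_mul hm' h₂' hfi] at h1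
    rw [integral_sub hfi.integrableOn hf'i.integrableOn,
      ← integral_congr_ae (ae_restrict_of_ae hf'), ← h1, ← integral_indicator h₂']
    congr 2
    ext ω
    by_cases h : ω ∈ t₂ <;> simp [h]
  have j1 : Integrable (fun ω => f ω * g ω) μ := hf2.integrable_mul hg2
  have j2 : Integrable (fun ω => f' ω * g ω) μ := hf'2.integrable_mul hg2
  have h1 := integral_mul_eq_zero_of_setIntegral hm₂ hg (f := fun ω => f ω - f' ω)
    (hfi.sub hf'i) (by
      refine (j1.sub j2).congr ?_
      filter_upwards with ω
      simp [sub_mul]) stage2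
  simp_rw [sub_mul] at h1
  rw [integral_sub j1 j2] at h1
  linarith

end CondIndep

/-! ### Additivity of the multivariate information distance -/

/-- Additivity along an edge at the start of a path is enough. -/
theorem isAdditiveDistance_of_step {V : Type*} {T : SimpleGraph V} (hT : T.IsTree)
    {dist : V → V → ℝ} (symm : ∀ a b, dist a b = dist b a) (pos : ∀ a b, T.Adj a b → 0 < dist a b)
    (step : ∀ a b c, T.Adj a b → b ∈ pathList T a c → b ≠ c → dist a c = dist a b + dist b c) :
    IsAdditiveDistance T dist where
  symm := symm
  pos := pos
  add a b c hb hba hbc := by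
    obtain ⟨p, hp, -⟩ := exists_path_support hT a c
    induction p with
    | nil =>
      rw [pathList_eq hT.isAcyclic (isPathOf_singleton _ _)] at hb
      exact absurd (List.mem_singleton.1 hb) hba
    | @cons a a' c hadj p ih =>
      obtain ⟨e, -⟩ := pathList_cons hT hadj hp
      have ha' : a' ∈ pathList T a c := by
        rw [e]
        exact List.mem_cons_of_mem _ (start_mem_pathList hT _ _)
      by_cases hba' : b = a'
      · exact step _ _ _ (hba' ▸ hadj) hb hbc
      have hb' : b ∈ pathList T a' c := by
        rw [e] at hb
        exact (List.mem_cons.1 hb).resolve_left hba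
      have ha'c : a' ≠ c := by
        rintro rfl
        rw [pathList_eq hT.isAcyclic (isPathOf_singleton _ _)] at hb'
        exact hba' (List.mem_singleton.1 hb')
      have hbp : b ∈ p.support := mem_support_of_mem_pathList hT hb' p
      have hq : (SimpleGraph.Walk.cons hadj (p.takeUntil b hbp)).IsPath := by
        rw [SimpleGraph.Walk.cons_isPath_iff] at hp ⊢
        exact ⟨hp.1.takeUntil hbp, fun k => hp.2 (p.support_takeUntil_subset_support hbp k)⟩
      have ha'b : a' ∈ pathList T a b := by
        rw [(pathList_cons hT hadj hq).1]
        exact List.mem_cons_of_mem _ (start_mem_pathList hT _ _)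
      rw [step _ _ _ hadj ha' ha'c, ih hb' hba' hbc hp.of_cons,
        step _ _ _ hadj ha'b (Ne.symm hba'), add_assoc]

section Model

open MeasureTheory ProbabilityTheory Matrix

variable {V Ω : Type*} [MeasurableSpace Ω] {dim : V → ℕ} {μ : Measure Ω}
  {y : ∀ v, Ω → EuclideanSpace ℝ (Fin (dim v))}

theorem corrMatrix_transpose (a b : V) : (corrMatrix μ y a b)ᵀ = corrMatrix μ y b a := by
  ext i j
  simp only [corrMatrix, transpose_apply, of_apply, mul_comm]

theorem infoDist_symm (k : ℕ) (a b : V) : infoDist k μ y a b = infoDist k μ y b a := by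
  unfold infoDist
  rw [mul_comm (corrMatrix μ y a a).det, ← corrMatrix_transpose b a]
  exact congrArg (fun t => -Real.log (t / _)) (topProd_transpose k (corrMatrix μ y b a))

theorem memLp_coord {v : V} (h : MemLp (y v) 2 μ) (i : Fin (dim v)) :
    MemLp (fun ω => y v ω i) 2 μ :=
  (EuclideanSpace.proj i : EuclideanSpace ℝ (Fin (dim v)) →L[ℝ] ℝ).comp_memLp' h

omit [MeasurableSpace Ω] in
theorem stronglyMeasurable_coord (v : V) (i : Fin (dim v)) :
    StronglyMeasurable[sigmaOf y {v}] fun ω => y v ω i := by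
  have h1 : Measurable[sigmaOf y {v}] (y v) :=
    Measurable.of_comap_le (le_iSup₂_of_le v (Set.mem_singleton v) le_rfl)
  have h2 : Measurable fun x : EuclideanSpace ℝ (Fin (dim v)) => x i := by fun_prop
  exact (h2.comp h1).stronglyMeasurable

theorem corrMatrix_posSemidef {v : V} (h : MemLp (y v) 2 μ) :
    (corrMatrix μ y v v).PosSemidef := by
  have hint : ∀ i j, Integrable (fun ω => y v ω i * y v ω j) μ := fun i j =>
    (memLp_coord h i).integrable_mul (memLp_coord h j)
  refine PosSemidef.of_dotProduct_mulVec_nonneg ?_ fun x => ?_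
  · rw [IsHermitian, conjTranspose_eq_transpose_of_trivial, corrMatrix_transpose]
  · have e : star x ⬝ᵥ (corrMatrix μ y v v *ᵥ x) = ∫ ω, (∑ i, x i * y v ω i) ^ 2 ∂μ := by
      have e1 : ∀ ω, (∑ i, x i * y v ω i) ^ 2 = ∑ i, ∑ j, x i * x j * (y v ω i * y v ω j) := by
        intro ω
        rw [sq, Finset.sum_mul_sum]
        refine Finset.sum_congr rfl fun i _ => Finset.sum_congr rfl fun j _ => by ring
      simp_rw [e1]
      rw [integral_finsetSum _ fun i _ => integrable_finsetSum _ fun j _ =>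
        (hint i j).const_mul _]
      simp only [dotProduct, mulVec, star_trivial, corrMatrix, of_apply]
      refine Finset.sum_congr rfl fun i _ => ?_
      rw [integral_finsetSum _ fun j _ => (hint i j).const_mul _, Finset.mul_sum]
      refine Finset.sum_congr rfl fun j _ => ?_
      rw [integral_const_mul]
      ring
    rw [e]
    exact integral_nonneg fun ω => sq_nonneg _

namespace IsLinearLatentTreeModel

variable [StandardBorelSpace Ω] [IsFiniteMeasure μ] {T : SimpleGraph V} {obs : Finset V} {k : ℕ}
  (hM : IsLinearLatentTreeModel T obs k μ y)
include hM

theorem det_pos (v : V) : 0 < (corrMatrix μ y v v).det :=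
  lt_of_le_of_ne (corrMatrix_posSemidef (hM.memLp v)).det_nonneg (hM.det_ne_zero v).symm

/-- Correlations across a node `b` next to `a` factor through `b`. -/
theorem exists_corrMatrix_eq_mul (hT : T.IsTree) {a b : V} (hab : T.Adj a b)
    (hb : b ∉ obs ∨ IsInternal T b) : ∃ L : Matrix (Fin (dim a)) (Fin (dim b)) ℝ,
      ∀ c, c ≠ a → b ∈ pathList T a c → corrMatrix μ y a c = L * corrMatrix μ y b c := by
  obtain ⟨L, -, hL⟩ := hM.linear a b hab hb
  refine ⟨L, fun c hca hbc => ?_⟩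
  have hle := sigmaOf_le hM.measurable
  have hcoord : ∀ i, μ[fun ω => y a ω i | sigmaOf y {b}] =ᵐ[μ]
      fun ω => ∑ l, L i l * y b ω l := by
    intro i
    have h1 := (EuclideanSpace.proj i : EuclideanSpace ℝ (Fin (dim a)) →L[ℝ] ℝ).comp_condExp_comm
      (m := sigmaOf y {b}) ((hM.memLp a).integrable one_le_two)
    refine h1.symm.trans ?_
    filter_upwards [hL] with ω hω
    simp [hω, mulVec, dotProduct]
  have hL2 : ∀ i, MemLp (fun ω => ∑ l, L i l * y b ω l) 2 μ := fun i =>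
    memLp_finsetSum _ fun l _ => (memLp_coord (hM.memLp b) l).const_mul _
  have key : ∀ i j, ∫ ω, y a ω i * y c ω j ∂μ = ∫ ω, (∑ l, L i l * y b ω l) * y c ω j ∂μ := by
    intro i j
    -- The Markov property needs disjoint sets, so `c = b` is treated apart: there the factor can be
    -- pulled out of the conditional expectation.
    by_cases hcb : c = b
    · subst hcb
      rw [← integral_condExp_mul (hle {c}) (stronglyMeasurable_coord c j)
        ((memLp_coord (hM.memLp a) i).integrable one_le_two)
        ((memLp_coord (hM.memLp a) i).integrable_mul (memLp_coord (hM.memLp c) j))]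
      refine integral_congr_ae ?_
      filter_upwards [hcoord i] with ω hω
      rw [hω]
    · refine integral_mul_of_condIndep (hle {b}) (hle {a}) (hle {c})
        (hM.markov {a} {c} {b} ?_ ?_ ?_ ?_) (stronglyMeasurable_coord a i)
        (stronglyMeasurable_coord c j) (memLp_coord (hM.memLp a) i) (memLp_coord (hM.memLp c) j)
        (hcoord i) (hL2 i)
      · exact Set.disjoint_singleton.2 hca.symm
      · exact Set.disjoint_singleton.2 hab.ne
      · exact Set.disjoint_singleton.2 hcb
      · rintro _ rfl _ rfl p
        exact ⟨b, rfl, mem_support_of_mem_pathList hT hbc p⟩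
  ext i j
  simp only [corrMatrix, of_apply, mul_apply]
  rw [key]
  simp_rw [Finset.sum_mul, mul_assoc]
  have hint : ∀ l, Integrable (fun ω => L i l * (y b ω l * y c ω j)) μ := fun l =>
    ((memLp_coord (hM.memLp b) l).integrable_mul (memLp_coord (hM.memLp c) j)).const_mul _
  rw [integral_finsetSum _ fun l _ => hint l]
  exact Finset.sum_congr rfl fun l _ => integral_const_mul _ _

/-- The same `L` gives the correlations of `a` with `b` and with `c`. Since `b` has dimension `k`,
`sq_topProd_mul` applies to both products, and with the identity as left factor to the correlations
of `b` and `c`; the factor `det (Lᵀ * L)` is common to both sides of the squared equation. -/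
theorem topProd_mul_topProd (hT : T.IsTree) {a b c : V} (hab : T.Adj a b)
    (hb : b ∉ obs ∨ IsInternal T b) (hca : c ≠ a) (hbc : b ∈ pathList T a c) :
    topProd k (corrMatrix μ y a c) * (corrMatrix μ y b b).det =
      topProd k (corrMatrix μ y a b) * topProd k (corrMatrix μ y b c) := by
  obtain ⟨L, hL⟩ := hM.exists_corrMatrix_eq_mul hT hab hb
  have hk := hM.dim_eq b hb
  have hdet := hM.det_pos b
  have hc := hM.le_dim c
  have e1 := hL b hab.ne' (end_mem_pathList hT a b)
  have e2 := hL c hca hbc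
  clear hM hL
  subst hk
  have h1 := sq_topProd_mul L (corrMatrix μ y b b) le_rfl
  have h2 := sq_topProd_mul L (corrMatrix μ y b c) hc
  have h3 := sq_topProd_mul (1 : Matrix (Fin (dim b)) (Fin (dim b)) ℝ) (corrMatrix μ y b c) hc
  rw [← e1, det_mul, det_transpose] at h1
  rw [← e2] at h2
  rw [Matrix.one_mul, transpose_one, Matrix.one_mul, det_one, one_mul] at h3
  refine (pow_left_inj₀ (mul_nonneg (topProd_nonneg _ _) hdet.le)
    (mul_nonneg (topProd_nonneg _ _) (topProd_nonneg _ _)) two_ne_zero).1 ?_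
  rw [mul_pow, mul_pow, h1, h2, h3]
  ring

theorem isAdditiveDistance [Finite V] (hT : T.IsTree)
    (hpos : ∀ a b, T.Adj a b → 0 < infoDist k μ y a b) :
    IsAdditiveDistance T (infoDist k μ y) := by
  -- The middle node of a path is not a leaf, which provides the dimension `k` and the linear
  -- conditional mean there.
  have hinner : ∀ {a b c}, T.Adj a b → b ∈ pathList T a c → b ≠ c → IsInternal T b := by
    intro a b c hab hb hbc
    obtain ⟨p, hp, hp'⟩ := exists_path_support hT a c
    rw [← hp'] at hb
    have hq := hp.dropUntil hb
    cases hd : p.dropUntil b hb with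
    | nil => exact absurd rfl hbc
    | @cons _ b' _ hadj q =>
      have hne : a ≠ b' := by
        rintro rfl
        have h1 := p.take_spec hb
        rw [hd] at h1
        have h2 := hp.support_nodup
        rw [← h1, SimpleGraph.Walk.support_append, List.nodup_append] at h2
        exact h2.2.2 _ (SimpleGraph.Walk.start_mem_support _) _
          (by simp) rfl
      have : ({a, b'} : Set V) ⊆ T.neighborSet b := by
        rintro x (rfl | rfl)
        · exact hab.symm
        · exact hadj
      exact (Set.ncard_pair hne).symm.le.trans (Set.ncard_le_ncard this (Set.toFinite _))
  have hmul : ∀ {a b c}, T.Adj a b → b ∈ pathList T a c → b ≠ c →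
      topProd k (corrMatrix μ y a c) * (corrMatrix μ y b b).det =
        topProd k (corrMatrix μ y a b) * topProd k (corrMatrix μ y b c) := by
    intro a b c hab hb hbc
    refine hM.topProd_mul_topProd hT hab (Or.inr (hinner hab hb hbc)) ?_ hb
    rintro rfl
    rw [pathList_eq hT.isAcyclic (isPathOf_singleton _ _)] at hb
    exact hab.ne (List.mem_singleton.1 hb).symm
  -- Since `Real.log 0 = 0`, a vanishing product would make the length of the edge zero rather than
  -- infinite, and positivity excludes this.
  have hedge : ∀ {a b}, T.Adj a b → topProd k (corrMatrix μ y a b) ≠ 0 := by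
    intro a b hab e
    have := hpos a b hab
    change 0 < -Real.log (topProd k (corrMatrix μ y a b) / _) at this
    rw [e] at this
    simp at this
  -- The product must not vanish for any pair, or else the logarithms could not be added; along a
  -- path it inherits this from the edges.
  have hne : ∀ a c, a ≠ c → topProd k (corrMatrix μ y a c) ≠ 0 := by
    intro a c hac
    obtain ⟨p, hp, -⟩ := exists_path_support hT a c
    induction p with
    | nil => exact absurd rfl hac
    | @cons a a' c hadj p ih =>
      by_cases ha'c : a' = c
      · exact ha'c ▸ hedge hadj
      have h1 := hmul hadj (c := c) (by
        rw [(pathList_cons hT hadj hp).1]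
        exact List.mem_cons_of_mem _ (start_mem_pathList hT _ _)) ha'c
      exact left_ne_zero_of_mul (h1 ▸ mul_ne_zero (hedge hadj) (ih ha'c hp.of_cons))
  refine isAdditiveDistance_of_step hT (infoDist_symm k) hpos fun a b c hab hb hbc => ?_
  have hda := hM.det_pos a
  have hdb := hM.det_pos b
  have hdc := hM.det_pos c
  change -Real.log (topProd k (corrMatrix μ y a c) / _) =
    -Real.log (topProd k (corrMatrix μ y a b) / _) + -Real.log (topProd k (corrMatrix μ y b c) / _)
  rw [← neg_add, ← Real.log_mul (div_ne_zero (hedge hab) (Real.sqrt_pos.2 (mul_pos hda hdb)).ne')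
    (div_ne_zero (hne b c hbc) (Real.sqrt_pos.2 (mul_pos hdb hdc)).ne'), div_mul_div_comm,
    ← hmul hab hb hbc, Real.sqrt_mul hda.le, Real.sqrt_mul hda.le, Real.sqrt_mul hdb.le]
  have hs := Real.mul_self_sqrt hdb.le
  have e : √(corrMatrix μ y a a).det * √(corrMatrix μ y b b).det *
      (√(corrMatrix μ y b b).det * √(corrMatrix μ y c c).det) =
      √(corrMatrix μ y a a).det * √(corrMatrix μ y c c).det * (corrMatrix μ y b b).det := by
    rw [← hs]
    simp only [Real.sqrt_mul_self (Real.sqrt_nonneg _)]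
    ring
  rw [e, mul_div_mul_right _ _ hdb.ne']

end IsLinearLatentTreeModel

end Model

theorem mainTheorem4 {V : Type*} [Fintype V] (T : SimpleGraph V) (obs : Finset V)
    (hT : IsMinimalLatentTree T obs) :
    (∀ dist : V → V → ℝ, IsAdditiveDistance T dist → SurrogatesDefined obs dist →
      ∀ M : SimpleGraph obs, IsMST (fun x y : obs => dist x y) M →
        LRGCorrect T obs dist M) ∧
    (∀ (Ω : Type*) [MeasurableSpace Ω] [StandardBorelSpace Ω] (μ : MeasureTheory.Measure Ω)
      [MeasureTheory.IsProbabilityMeasure μ] (k : ℕ) (dim : V → ℕ)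
      (y : ∀ v, Ω → EuclideanSpace ℝ (Fin (dim v))),
      IsLinearLatentTreeModel T obs k μ y →
      (∀ a b, T.Adj a b → 0 < infoDist k μ y a b) →
      SurrogatesDefined obs (infoDist k μ y) →
      ∀ M : SimpleGraph obs, IsMST (fun x y' : obs => infoDist k μ y x y') M →
        LRGCorrect T obs (infoDist k μ y) M) := by
  refine ⟨fun dist hdist hs M hM => lrgCorrect_of_isAdditiveDistance hT hdist hs hM, ?_⟩
  intro Ω _ _ μ _ k dim y hmodel hpos hs M hM
  exact lrgCorrect_of_isAdditiveDistance hT (hmodel.isAdditiveDistance hT.1 hpos) hs hM
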